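/- Let $n\ge 4$ be an even integer, let $u\colon\mathbb{R}^n\to\mathbb{R}$ be smooth, and let $g=e^{2u}|dx|^2$ be the corresponding conformal metric on $\mathbb{R}^n$ (not assumed complete). Let $R_g$ be the scalar curvature of $g$, and let its Q-curvature be the function $Q$ given by $(-\Delta)^{n/2}u=Qe^{nu}$. Assume that $g$ has finite total Q-curvature, that is, $Qe^{nu}\in L^1(\mathbb{R}^n)$. Write $|\mathbb{S}^k|$ for the volume of the standard unit $k$-sphere, and put $$\alpha_0=\frac{2}{(n-1)!\,|\mathbb{S}^n|}\int_{\mathbb{R}^n}Qe^{nu}\,dx .$$ The metric $g$ is called normal if there is a constant $C$ such that for all $x\in\mathbb{R}^n$ $$u(x)=\frac{2}{(n-1)!\,|\mathbb{S}^n|}\int_{\mathbb{R}^n}\log\frac{|y|}{|x-y|}\,Q(y)e^{nu(y)}\,dy+C ,$$ where the integral converges absolutely. The conformal mass of $g$ is the extended real number $$m_c(g)=\frac{1}{(n-1)(n-2)|\mathbb{S}^{n-1}|}\,\inf_{x\in\mathbb{R}^n}\,\liminf_{r\to\infty}\,r^{3-n}\int_{\partial B_r(x)}R_g e^{2u}\,d\sigma\in[-\infty,\infty],$$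 where $B_r(x)$ is the Euclidean ball and $d\sigma$ is the Euclidean area element on $\partial B_r(x)$. Then: 1. $g$ is normal if and only if $m_c(g)>-\infty$. 2. If $g$ is normal, then $m_c(g)=\alpha_0(2-\alpha_0)$. -/

import Mathlib

open MeasureTheory Filter Topology
open scoped ContDiff

noncomputable section

namespace ConformalMass

/-- Euclidean space `ℝⁿ`. -/
abbrev E (n : ℕ) := EuclideanSpace ℝ (Fin n)

/-- The partial derivative `∂ᵢ f` in the standard coordinates of `ℝⁿ`. -/
def partialDeriv {n : ℕ} (i : Fin n) (f : E n → ℝ) (x : E n) : ℝ :=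
  fderiv ℝ f x (EuclideanSpace.single i 1)

/-! ### Riemannian metrics on `ℝⁿ` in the standard global chart, and their curvature -/

/-- The Christoffel symbol `Γᵏᵢⱼ = ½ ∑ₗ gᵏˡ (∂ᵢ gⱼₗ + ∂ⱼ gᵢₗ - ∂ₗ gᵢⱼ)` of the metric with
coordinate matrix `g`. -/
def christoffel {n : ℕ} (g : E n → Matrix (Fin n) (Fin n) ℝ) (k i j : Fin n) (x : E n) : ℝ :=
  (1 / 2 : ℝ) * ∑ l, (g x)⁻¹ k l *
    (partialDeriv i (fun y => g y j l) x + partialDeriv j (fun y => g y i l) x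
      - partialDeriv l (fun y => g y i j) x)

/-- The Ricci tensor
`Ricⱼₖ = ∑ᵢ (∂ᵢ Γⁱⱼₖ - ∂ⱼ Γⁱᵢₖ + ∑ₚ (Γⁱᵢₚ Γᵖⱼₖ - Γⁱⱼₚ Γᵖᵢₖ))`
(positive on round spheres). -/
def ricci {n : ℕ} (g : E n → Matrix (Fin n) (Fin n) ℝ) (j k : Fin n) (x : E n) : ℝ :=
  ∑ i, (partialDeriv i (christoffel g i j k) x - partialDeriv j (christoffel g i i k) x
    + ∑ p, (christoffel g i i p x * christoffel g p j k x
      - christoffel g i j p x * christoffel g p i k x))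

/-- The scalar curvature `R_g = ∑ⱼₖ gʲᵏ Ricⱼₖ`. -/
def scalarCurvature {n : ℕ} (g : E n → Matrix (Fin n) (Fin n) ℝ) (x : E n) : ℝ :=
  ∑ j, ∑ k, (g x)⁻¹ j k * ricci g j k x

/-- The conformal metric `e^{2u} |dx|²`. -/
def conformalMetric {n : ℕ} (u : E n → ℝ) (x : E n) : Matrix (Fin n) (Fin n) ℝ :=
  Real.exp (2 * u x) • (1 : Matrix (Fin n) (Fin n) ℝ)

/-! ### Q-curvature and normal metrics -/

/-- The Q-curvature of `e^{2u} |dx|²` on `ℝⁿ`, `n` even: the function `Q` determined by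
`(-Δ)^{n/2} u = Q e^{nu}`. -/
def qCurvature {n : ℕ} (u : E n → ℝ) (x : E n) : ℝ :=
  Real.exp (-(n * u x)) * ((fun f : E n → ℝ => -Laplacian.laplacian f)^[n / 2] u) x

/-- Finite total Q-curvature: `Q e^{nu} ∈ L¹(ℝⁿ)`. -/
def HasFiniteTotalQ {n : ℕ} (u : E n → ℝ) : Prop :=
  Integrable (fun y : E n => qCurvature u y * Real.exp (n * u y))

/-- The surface measure on the unit sphere of `ℝᵐ`. -/
def unitSphereMeasure (m : ℕ) : Measure (Metric.sphere (0 : E m) 1) :=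
  (volume : Measure (E m)).toSphere

/-- The volume `|𝕊ᵏ|` of the standard `k`-sphere, the unit sphere of `ℝᵏ⁺¹`. -/
def sphereVolume (k : ℕ) : ℝ :=
  (unitSphereMeasure (k + 1)).real Set.univ

/-- The metric `e^{2u} |dx|²` is normal: for some constant `C` and all `x`,
`u(x) = 2 / ((n-1)! |𝕊ⁿ|) ∫ log (|y| / |x-y|) Q(y) e^{nu(y)} dy + C`, the integral converging
absolutely. -/
def IsNormal {n : ℕ} (u : E n → ℝ) : Prop :=
  ∃ C : ℝ, ∀ x : E n,
    Integrable (fun y : E n =>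
      Real.log (‖y‖ / ‖x - y‖) * (qCurvature u y * Real.exp (n * u y))) ∧
    u x = 2 / ((Nat.factorial (n - 1) : ℝ) * sphereVolume n) *
      (∫ y : E n, Real.log (‖y‖ / ‖x - y‖) * (qCurvature u y * Real.exp (n * u y))) + C

/-- `α₀ = 2 / ((n-1)! |𝕊ⁿ|) ∫ Q e^{nu} dx`. -/
def alphaZero {n : ℕ} (u : E n → ℝ) : ℝ :=
  2 / ((Nat.factorial (n - 1) : ℝ) * sphereVolume n) *
    ∫ y : E n, qCurvature u y * Real.exp (n * u y)

/-! ### The conformal mass -/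

/-- The integral `∫_{∂B_r(x)} f dσ` over the Euclidean sphere of radius `r > 0` about `x`, with
respect to the Euclidean area element, written in the polar coordinate `θ ↦ x + r θ`. -/
def sphereIntegral {n : ℕ} (f : E n → ℝ) (x : E n) (r : ℝ) : ℝ :=
  r ^ (n - 1) * ∫ θ : Metric.sphere (0 : E n) 1, f (x + r • (θ : E n)) ∂(unitSphereMeasure n)

/-- The conformal mass, as an extended real number,
`m_c(g) = 1 / ((n-1)(n-2)|𝕊ⁿ⁻¹|) inf_x liminf_{r → ∞} r^{3-n} ∫_{∂B_r(x)} R_g e^{2u} dσ`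
of the metric `g = e^{2u} |dx|²`. -/
def conformalMass {n : ℕ} (u : E n → ℝ) : EReal :=
  ((1 / (((n : ℝ) - 1) * ((n : ℝ) - 2) * sphereVolume (n - 1)) : ℝ) : EReal) *
    ⨅ x : E n, liminf (fun r : ℝ =>
      ((r ^ (3 - (n : ℤ)) * sphereIntegral
        (fun y => scalarCurvature (conformalMetric u) y * Real.exp (2 * u y)) x r : ℝ) : EReal))
      atTop

end ConformalMass

end

/-! Write `f = Q e^{nu} = (-Δ)^{n/2} u` and `c = 2 / ((n-1)! |𝕊ⁿ|)`, and let `v = c ∫ log(|y|/|x-y|)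
f(y) dy`, so that normality says that `u - v` is constant. The conformal change formula `R e^{2u} =
-2(n-1) Δu - (n-1)(n-2) |∇u|²` (`scalarCurvature_conformalMetric`) turns the mass into a statement
about spherical means of `Δu` and `|∇u|²`.

If `g` is normal, then `-Δu = c(n-2) ∫ f(y) |x-y|⁻² dy` and `∇u = -c ∫ f(y) (x-y) |x-y|⁻² dy`. After
rescaling a large sphere to unit size, the mass of `f` concentrates at the centre, and the means of
`r²(-Δu)` and `r²|∇u|²` tend to `(n-2) α₀` and `α₀²`. The kernels stay uniformly integrable over the
sphere, even for `y` near it, because their singularity is at most inverse square and the sphere has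
dimension at least three. Hence the liminf is a limit, independent of the centre, and equals
`α₀(2-α₀)` after normalisation (`tendsto_massFunction_of_isNormal`).

Conversely, a mass above `-∞` bounds the means of `2Δu + (n-2)|∇u|²` from above by a multiple of
`r⁻²`, about every centre. Averaging over an annulus of scale `ρ`, integrating `Δu` by parts and
absorbing the result by Young's inequality leaves `|∇u|² = O(ρ⁻²)` in the mean
(`hasAnnularDecay_gradient`); the potential `v` satisfies the same bound. The function `w = u - v`
solves `(-Δ)^{n/2} w = 0`, because the normalised logarithm is a fundamental solution
(`isWeakPolyLap_logPotential`). As in Pizzetti's formula, its weighted radial averages are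
polynomials in the scale (`IsWeakPolyLap.exists_polynomial`). Decay of `∇w` forces these polynomials
to be constant, so `w` has a mean value property at every scale; differentiating it in the centre
and letting `ρ → ∞` gives `∇w = 0` (`IsWeakPolyLap.eq_const_of_hasAnnularDecay`).

The equations are used in the weak form `IsWeakNegLap`, with an explicit continuous gradient, so the
potentials never have to be differentiated twice. -/

noncomputable section

namespace ConformalMass

variable {n : ℕ}

/-! ### Polar coordinates -/

instance instIsFiniteMeasureUnitSphereMeasure (m : ℕ) : IsFiniteMeasure (unitSphereMeasure m) := by
  unfold unitSphereMeasure; infer_instance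

theorem volume_comap_prod_sphere (n : ℕ) :
    MeasurePreserving (homeomorphUnitSphereProd (E n))
      (Measure.comap Subtype.val (volume : Measure (E n)))
      ((unitSphereMeasure n).prod (Measure.volumeIoiPow (n - 1))) := by
  have := (volume : Measure (E n)).measurePreserving_homeomorphUnitSphereProd
  simpa [unitSphereMeasure, finrank_euclideanSpace] using this

theorem integral_polar_prod [NeZero n] (f : E n → ℝ) :
    ∫ x, f x = ∫ p, f ((p.2 : ℝ) • (p.1 : E n))
      ∂((unitSphereMeasure n).prod (Measure.volumeIoiPow (n - 1))) := by
  have h1 : ∫ x, f x = ∫ x : ({(0)}ᶜ : Set (E n)), f x.1 ∂(Measure.comap Subtype.val (volume : Measure (E n))) := by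
    rw [integral_subtype_comap (measurableSet_singleton _).compl, restrict_compl_singleton]
  rw [h1, ← (volume_comap_prod_sphere n).integral_comp
    (Homeomorph.measurableEmbedding _)]
  congr 1
  ext x
  congr 1
  rw [← homeomorphUnitSphereProd_symm_apply_coe]
  simp

theorem integrable_polar_prod [NeZero n] {f : E n → ℝ} (hf : Integrable f) :
    Integrable (fun p : Metric.sphere (0 : E n) 1 × Set.Ioi (0 : ℝ) => f ((p.2 : ℝ) • (p.1 : E n)))
      ((unitSphereMeasure n).prod (Measure.volumeIoiPow (n - 1))) := by
  rw [← (volume_comap_prod_sphere n).integrable_comp_emb (Homeomorph.measurableEmbedding _)]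
  have h1 : Integrable (fun x : ({(0)}ᶜ : Set (E n)) => f x.1) (Measure.comap Subtype.val (volume : Measure (E n))) := by
    have := (integrableOn_iff_comap_subtypeVal (μ := volume)
      (measurableSet_singleton (0 : E n)).compl (f := f)).1 hf.integrableOn
    exact this
  convert h1 using 1
  ext x
  simp only [Function.comp]
  congr 1
  rw [← homeomorphUnitSphereProd_symm_apply_coe]
  simp

theorem lintegral_polar_prod [NeZero n] (f : E n → ENNReal) :
    ∫⁻ x, f x = ∫⁻ p, f ((p.2 : ℝ) • (p.1 : E n))
      ∂((unitSphereMeasure n).prod (Measure.volumeIoiPow (n - 1))) := by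
  have h1 : ∫⁻ x, f x = ∫⁻ x : ({(0)}ᶜ : Set (E n)), f x.1 ∂(Measure.comap Subtype.val (volume : Measure (E n))) := by
    rw [lintegral_subtype_comap (measurableSet_singleton _).compl, restrict_compl_singleton]
  rw [h1, ← (volume_comap_prod_sphere n).lintegral_comp_emb
    (Homeomorph.measurableEmbedding _)]
  congr 1
  ext x
  congr 1
  rw [← homeomorphUnitSphereProd_symm_apply_coe]
  simp

theorem integral_volumeIoiPow (k : ℕ) (g : ℝ → ℝ) :
    ∫ r, g r ∂(Measure.volumeIoiPow k) = ∫ r in Set.Ioi (0 : ℝ), r ^ k * g r := by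
  simp only [Measure.volumeIoiPow, ENNReal.ofReal]
  rw [integral_withDensity_eq_integral_smul,
    integral_subtype_comap measurableSet_Ioi fun a : ℝ ↦ Real.toNNReal (a ^ k) • g a]
  · refine setIntegral_congr_fun measurableSet_Ioi fun x hx ↦ ?_
    simp only [NNReal.smul_def, smul_eq_mul]
    rw [Real.coe_toNNReal _ (pow_nonneg (le_of_lt hx) _)]
  · exact (measurable_subtype_coe.pow_const _).real_toNNReal

theorem lintegral_volumeIoiPow (k : ℕ) (g : ℝ → ENNReal) (hg : Measurable g) :
    ∫⁻ r, g r ∂(Measure.volumeIoiPow k)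
      = ∫⁻ r in Set.Ioi (0 : ℝ), ENNReal.ofReal (r ^ k) * g r := by
  rw [Measure.volumeIoiPow, lintegral_withDensity_eq_lintegral_mul _ (by fun_prop) (by fun_prop)]
  exact lintegral_subtype_comap measurableSet_Ioi (fun r => ENNReal.ofReal (r ^ k) * g r)

/-- Integration in polar coordinates, the radius innermost. -/
theorem integral_polar [NeZero n] {f : E n → ℝ} (hf : Integrable f) :
    ∫ x, f x = ∫ θ : Metric.sphere (0 : E n) 1, ∫ r in Set.Ioi (0 : ℝ), r ^ (n - 1) * f (r • (θ : E n))
      ∂volume ∂(unitSphereMeasure n) := by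
  rw [integral_polar_prod, integral_prod _ (integrable_polar_prod hf)]
  congr 1
  ext θ
  exact integral_volumeIoiPow (n - 1) (fun r => f (r • (θ : E n)))

/-- Integration in polar coordinates, the angle innermost. -/
theorem integral_polar' [NeZero n] {f : E n → ℝ} (hf : Integrable f) :
    ∫ x, f x = ∫ r in Set.Ioi (0 : ℝ), r ^ (n - 1) *
      ∫ θ : Metric.sphere (0 : E n) 1, f (r • (θ : E n)) ∂(unitSphereMeasure n) := by
  rw [integral_polar_prod, integral_prod_symm _ (integrable_polar_prod hf)]
  exact integral_volumeIoiPow (n - 1)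
    (fun r => ∫ θ : Metric.sphere (0 : E n) 1, f (r • (θ : E n)) ∂(unitSphereMeasure n))

theorem lintegral_polar [NeZero n] {f : E n → ENNReal} (hf : Measurable f) :
    ∫⁻ x, f x = ∫⁻ θ : Metric.sphere (0 : E n) 1, ∫⁻ r in Set.Ioi (0 : ℝ), ENNReal.ofReal (r ^ (n - 1)) *
      f (r • (θ : E n)) ∂volume ∂(unitSphereMeasure n) := by
  rw [lintegral_polar_prod f, lintegral_prod _ (by fun_prop)]
  congr 1
  ext θ
  exact lintegral_volumeIoiPow (n - 1) (fun r => f (r • (θ : E n))) (by fun_prop)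

/-! ### Integrability of negative powers of the norm -/

theorem integrableOn_ball_inv_norm_pow [NeZero n] {b : ℕ} (hb : b < n) (R : ℝ) :
    IntegrableOn (fun x : E n => (‖x‖ ^ b)⁻¹) (Metric.ball 0 R) := by
  rw [integrableOn_fun_norm_addHaar (μ := (volume : Measure (E n))) (f := fun r : ℝ => (r ^ b)⁻¹), finrank_euclideanSpace,
    Fintype.card_fin]
  have : IntegrableOn (fun r : ℝ => r ^ (n - 1 - b)) (Set.Ioo 0 R) :=
    ((continuous_pow _).integrableOn_Icc (a := (0 : ℝ)) (b := R)).mono_set Set.Ioo_subset_Icc_self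
  refine this.congr_fun (fun r hr => ?_) measurableSet_Ioo
  have hr0 : r ≠ 0 := hr.1.ne'
  simp only [smul_eq_mul]
  rw [← div_eq_mul_inv, eq_div_iff (pow_ne_zero _ hr0), ← pow_add]
  congr 1; omega

/-- The integrals of `‖x - y‖⁻ᵇ` over a ball are bounded uniformly in the pole `y`. -/
theorem exists_lintegral_inv_norm_sub_pow_le [NeZero n] {b : ℕ} (hb : b < n) (R : ℝ) :
    ∃ C : ℝ, 0 ≤ C ∧ ∀ x₀ y : E n, ∫⁻ x in Metric.ball x₀ R, ENNReal.ofReal ((‖x - y‖ ^ b)⁻¹)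
      ≤ ENNReal.ofReal C := by
  set I := ∫⁻ x in Metric.ball (0 : E n) 1, ENNReal.ofReal ((‖x‖ ^ b)⁻¹)
  have hI : I < ⊤ := (integrableOn_ball_inv_norm_pow hb 1).lintegral_lt_top
  have hV : volume (Metric.ball (0 : E n) R) < ⊤ := measure_ball_lt_top
  refine ⟨(I + volume (Metric.ball (0 : E n) R)).toReal, ENNReal.toReal_nonneg, fun x₀ y => ?_⟩
  rw [ENNReal.ofReal_toReal (ENNReal.add_lt_top.2 ⟨hI, hV⟩).ne]
  -- Within distance one of the pole, translation reduces to the fixed integral `I`; farther away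
  -- the kernel is at most one.
  have h1 : ∀ x : E n, ENNReal.ofReal ((‖x - y‖ ^ b)⁻¹) ≤
      (Metric.ball y 1).indicator (fun x => ENNReal.ofReal ((‖x - y‖ ^ b)⁻¹)) x + 1 := by
    intro x
    by_cases hx : x ∈ Metric.ball y 1
    · simp [hx]
    · simp only [hx, not_false_eq_true, Set.indicator_of_notMem, zero_add]
      rw [← ENNReal.ofReal_one]
      apply ENNReal.ofReal_le_ofReal
      have : 1 ≤ ‖x - y‖ := by simpa [dist_eq_norm] using hx
      exact inv_le_one_of_one_le₀ (one_le_pow₀ this)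
  have hm : Measurable fun x : E n => ENNReal.ofReal ((‖x - y‖ ^ b)⁻¹) := by fun_prop
  calc ∫⁻ x in Metric.ball x₀ R, ENNReal.ofReal ((‖x - y‖ ^ b)⁻¹)
      ≤ ∫⁻ x in Metric.ball x₀ R, ((Metric.ball y 1).indicator
          (fun x => ENNReal.ofReal ((‖x - y‖ ^ b)⁻¹)) x + 1) := lintegral_mono h1
    _ = (∫⁻ x in Metric.ball x₀ R, (Metric.ball y 1).indicator
          (fun x => ENNReal.ofReal ((‖x - y‖ ^ b)⁻¹)) x) + volume (Metric.ball x₀ R) := by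
        rw [lintegral_add_right _ measurable_const]; simp
    _ ≤ I + volume (Metric.ball (0 : E n) R) := by
        refine add_le_add ?_ (by rw [Measure.addHaar_ball_center])
        refine (lintegral_mono' Measure.restrict_le_self le_rfl).trans ?_
        rw [← lintegral_sub_right_eq_self _ (-y)]
        simp only [sub_neg_eq_add]
        simp only [I]
        rw [← lintegral_indicator measurableSet_ball]
        refine lintegral_mono fun x => ?_
        simp [Set.indicator, dist_eq_norm]

/-! ### The kernels `z / ‖z‖ᵃ` -/

/-- The vector field `z / ‖z‖ᵃ`. -/
def radialKernel (a : ℕ) (z : E n) : E n := (‖z‖ ^ a)⁻¹ • z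

theorem measurable_radialKernel (a : ℕ) : Measurable (radialKernel a : E n → E n) := by
  unfold radialKernel; fun_prop

/-- Equality holds off the origin. At `z = 0` the left side is zero by the convention `0⁻¹ = 0`, and
for `a = 0` the right side is one. -/
theorem norm_radialKernel_succ (a : ℕ) (z : E n) :
    ‖radialKernel (a + 1) z‖ ≤ (‖z‖ ^ a)⁻¹ := by
  rw [radialKernel, norm_smul, norm_inv, norm_pow, norm_norm]
  by_cases hz : ‖z‖ = 0
  · rw [hz]; simp
  · rw [pow_succ, mul_inv, mul_assoc, inv_mul_cancel₀ hz, mul_one]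

/-- Integration by parts on the half-line: the positive power of `r` kills the boundary term at
zero. -/
theorem integral_Ioi_pow_succ_mul_deriv {φ : ℝ → ℝ} (hφ : ContDiff ℝ 1 φ)
    (hc : HasCompactSupport φ) (k : ℕ) :
    ∫ r in Set.Ioi (0 : ℝ), r ^ (k + 1) * deriv φ r
      = -((k + 1 : ℕ) : ℝ) * ∫ r in Set.Ioi (0 : ℝ), r ^ k * φ r := by
  have hF : ContDiff ℝ 1 fun r : ℝ => r ^ (k + 1) * φ r := by fun_prop
  have h := (hc.mul_left (f := fun r : ℝ => r ^ (k + 1))).integral_Ioi_deriv_eq hF 0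
  have hd : ∀ r : ℝ, deriv (fun r : ℝ => r ^ (k + 1) * φ r) r
      = ((k + 1 : ℕ) : ℝ) * (r ^ k * φ r) + r ^ (k + 1) * deriv φ r := by
    intro r
    have := ((hasDerivAt_pow (k + 1) r).mul
      ((hφ.differentiable one_ne_zero).differentiableAt (x := r)).hasDerivAt).deriv
    simp only [Nat.add_sub_cancel] at this
    rw [← mul_assoc, ← this]; rfl
  have hcφ : Continuous φ := hφ.continuous
  have hcd : Continuous (deriv φ) := hφ.continuous_deriv le_rfl
  have hi1 : Integrable fun r : ℝ => ((k + 1 : ℕ) : ℝ) * (r ^ k * φ r) :=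
    Integrable.const_mul ((by fun_prop : Continuous fun r : ℝ => r ^ k * φ r).integrable_of_hasCompactSupport
      (hc.mul_left)) _
  have hi2 : Integrable fun r : ℝ => r ^ (k + 1) * deriv φ r :=
    (by fun_prop : Continuous fun r : ℝ => r ^ (k + 1) * deriv φ r).integrable_of_hasCompactSupport
      (hc.deriv.mul_left)
  rw [funext hd, integral_add hi1.integrableOn hi2.integrableOn, integral_const_mul] at h
  simp at h ⊢
  linarith

/-- A compactly supported function integrated against a kernel of order `b < n`. -/
theorem integrable_mul_inv_norm_sub_pow [NeZero n] {b : ℕ} (hb : b < n) {g : E n → ℝ}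
    (hg : Continuous g) (hc : HasCompactSupport g) :
    Integrable (fun z : E n => g z * (‖z‖ ^ b)⁻¹) := by
  obtain ⟨R, hR⟩ := hc.isCompact.isBounded.subset_ball 0
  have h1 := integrableOn_ball_inv_norm_pow hb R
  obtain ⟨M, hM⟩ := hc.exists_bound_of_continuous hg
  have h2 : IntegrableOn (fun z : E n => g z * (‖z‖ ^ b)⁻¹) (Metric.ball 0 R) :=
    Integrable.bdd_mul h1 hg.aestronglyMeasurable (Filter.Eventually.of_forall hM)
  refine (integrableOn_iff_integrable_of_support_subset fun z hz => ?_).1 h2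
  apply hR
  apply subset_tsupport
  intro h0
  simp [h0] at hz

section
variable {Ψ : E n → ℝ}

theorem hasDerivAt_comp_ray (hΨ : ContDiff ℝ 1 Ψ) (y θ : E n) (r : ℝ) :
    HasDerivAt (fun r : ℝ => Ψ (y + r • θ)) (fderiv ℝ Ψ (y + r • θ) θ) r := by
  have h1 : HasDerivAt (fun r : ℝ => y + r • θ) θ r := by
    simpa using ((hasDerivAt_id r).smul_const θ).const_add y
  exact ((hΨ.differentiable one_ne_zero).differentiableAt.hasFDerivAt).comp_hasDerivAt r h1

theorem hasCompactSupport_comp_ray (hc : HasCompactSupport Ψ) (y : E n)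
    {θ : E n} (hθ : ‖θ‖ = 1) : HasCompactSupport (fun r : ℝ => Ψ (y + r • θ)) := by
  refine hc.comp_isClosedEmbedding (g := fun r : ℝ => y + r • θ) ?_
  refine Isometry.isClosedEmbedding (Isometry.of_dist_eq fun r s => ?_)
  rw [dist_add_left, dist_eq_norm, ← sub_smul, norm_smul, hθ, mul_one, Real.dist_eq,
    Real.norm_eq_abs]

theorem integrable_fderiv_radialKernel [NeZero n] (hΨ : ContDiff ℝ 1 Ψ)
    (hc : HasCompactSupport Ψ) {a : ℕ} (ha : a + 1 ≤ n) (y : E n) :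
    Integrable (fun z => fderiv ℝ Ψ (y + z) (radialKernel (a + 1) z)) := by
  have hcf : Continuous (fderiv ℝ Ψ) := hΨ.continuous_fderiv one_ne_zero
  have h := integrable_mul_inv_norm_sub_pow (b := a) (by omega)
    (g := fun z => ‖fderiv ℝ Ψ (y + z)‖) (by fun_prop)
    ((hc.fderiv ℝ).norm.comp_homeomorph (Homeomorph.addLeft y))
  refine h.mono' ?_ (Filter.Eventually.of_forall fun z => ?_)
  · have hm := measurable_radialKernel (n := n) (a + 1)
    refine Measurable.aestronglyMeasurable ?_
    have : Measurable fun z => fderiv ℝ Ψ (y + z) := (hcf.comp (by fun_prop)).measurable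
    exact ((isBoundedBilinearMap_apply (𝕜 := ℝ) (E := E n) (F := ℝ)).continuous.measurable).comp
      (this.prodMk hm)
  · refine (ContinuousLinearMap.le_opNorm _ _).trans ?_
    gcongr
    exact norm_radialKernel_succ a z

/-- The polar Jacobian absorbs the singularity of the kernel, so distributional divergences reduce
to one-dimensional integrals along rays. -/
theorem pow_mul_fderiv_radialKernel_ray (y : E n) {θ : E n} (hθ : ‖θ‖ = 1) {a k : ℕ}
    (hn : n = a + 1 + k) {r : ℝ} (hr : 0 < r) :
    r ^ (n - 1) * fderiv ℝ Ψ (y + r • θ) (radialKernel (a + 1) (r • θ))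
      = r ^ k * fderiv ℝ Ψ (y + r • θ) θ := by
  rw [radialKernel, norm_smul, hθ, mul_one, Real.norm_of_nonneg hr.le, smul_smul, map_smul,
    smul_eq_mul, ← mul_assoc]
  congr 1
  rw [hn, show a + 1 + k - 1 = a + k by omega]
  field_simp
  ring

/-- The distributional divergence of `z / ‖z‖ᵃ` is `(n - a) / ‖z‖ᵃ` for `a < n`. -/
theorem integral_fderiv_radialKernel [NeZero n] (hΨ : ContDiff ℝ 1 Ψ)
    (hc : HasCompactSupport Ψ) {a : ℕ} (ha : a + 1 < n) (y : E n) :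
    ∫ x, fderiv ℝ Ψ x (radialKernel (a + 1) (x - y))
      = -((n : ℝ) - (a + 1 : ℕ)) * ∫ x, Ψ x * (‖x - y‖ ^ (a + 1))⁻¹ := by
  obtain ⟨k, hk⟩ : ∃ k, n = a + 1 + (k + 1) := ⟨n - (a + 2), by omega⟩
  have t1 := integral_add_left_eq_self
    (fun x => fderiv ℝ Ψ x (radialKernel (a + 1) (x - y))) y (μ := volume)
  have t2 := integral_add_left_eq_self
    (fun x => Ψ x * (‖x - y‖ ^ (a + 1))⁻¹) y (μ := volume)
  simp only [add_sub_cancel_left] at t1 t2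
  rw [← t1, ← t2, integral_polar (integrable_fderiv_radialKernel hΨ hc (by omega) y),
    integral_polar (integrable_mul_inv_norm_sub_pow ha (g := fun z => Ψ (y + z))
      (hΨ.continuous.comp (by fun_prop)) (hc.comp_homeomorph (Homeomorph.addLeft y))),
    ← integral_const_mul]
  congr 1
  ext θ
  have hθ : ‖(θ : E n)‖ = 1 := by simp
  have e1 : ∫ r in Set.Ioi (0 : ℝ), r ^ (n - 1) *
      fderiv ℝ Ψ (y + r • (θ : E n)) (radialKernel (a + 1) (r • (θ : E n)))
      = ∫ r in Set.Ioi (0 : ℝ), r ^ (k + 1) * deriv (fun r : ℝ => Ψ (y + r • (θ : E n))) r := by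
    refine setIntegral_congr_fun measurableSet_Ioi fun r hr => ?_
    rw [pow_mul_fderiv_radialKernel_ray y hθ hk hr, (hasDerivAt_comp_ray hΨ y θ r).deriv]
  have e2 : ∫ r in Set.Ioi (0 : ℝ), r ^ (n - 1) *
      (Ψ (y + r • (θ : E n)) * (‖r • (θ : E n)‖ ^ (a + 1))⁻¹)
      = ∫ r in Set.Ioi (0 : ℝ), r ^ k * Ψ (y + r • (θ : E n)) := by
    refine setIntegral_congr_fun measurableSet_Ioi fun r hr => ?_
    have hr' : (0 : ℝ) < r := hr
    rw [norm_smul, hθ, mul_one, Real.norm_of_nonneg hr'.le,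
      show n - 1 = k + (a + 1) by omega, pow_add]
    field_simp
  rw [e1, e2, integral_Ioi_pow_succ_mul_deriv (by fun_prop) (hasCompactSupport_comp_ray hc y hθ)]
  have hk' : (n : ℝ) = a + 1 + (k + 1) := by exact_mod_cast hk
  congr 2
  rw [hk']; push_cast; ring

/-- The distributional divergence of `z / ‖z‖ⁿ` is `|𝕊ⁿ⁻¹| δ₀`. -/
theorem integral_fderiv_radialKernel_dim [NeZero n] (hΨ : ContDiff ℝ 1 Ψ)
    (hc : HasCompactSupport Ψ) (y : E n) :
    ∫ x, fderiv ℝ Ψ x (radialKernel n (x - y))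
      = -((unitSphereMeasure n).real Set.univ * Ψ y) := by
  obtain ⟨a, ha⟩ : ∃ a, n = a + 1 := ⟨n - 1, by have := NeZero.pos n; omega⟩
  have t1 := integral_add_left_eq_self
    (fun x => fderiv ℝ Ψ x (radialKernel n (x - y))) y (μ := volume)
  simp only [add_sub_cancel_left] at t1
  have hI : Integrable (fun z => fderiv ℝ Ψ (y + z) (radialKernel n z)) := by
    have := integrable_fderiv_radialKernel hΨ hc (a := a) (by omega) y
    rwa [← ha] at this
  rw [← t1, integral_polar hI]
  -- In the critical case no power of `r` is left, so the boundary term at `r = 0` survives on every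
  -- ray and produces the point mass.
  have e1 : ∀ θ : Metric.sphere (0 : E n) 1, ∫ r in Set.Ioi (0 : ℝ), r ^ (n - 1) *
      fderiv ℝ Ψ (y + r • (θ : E n)) (radialKernel n (r • (θ : E n))) = -Ψ y := by
    intro θ
    have hθ : ‖(θ : E n)‖ = 1 := by simp
    have h2 := (hasCompactSupport_comp_ray hc y hθ).integral_Ioi_deriv_eq
      (b := (0 : ℝ)) (by fun_prop)
    simp only [zero_smul, add_zero] at h2
    rw [← h2]
    refine setIntegral_congr_fun measurableSet_Ioi fun r hr => ?_
    have h3 := pow_mul_fderiv_radialKernel_ray (Ψ := Ψ) y hθ (k := 0) (by omega : n = a + 1 + 0) hr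
    rw [← ha] at h3
    rw [h3, (hasDerivAt_comp_ray hΨ y θ r).deriv, pow_zero, one_mul]
  simp only [e1, integral_const, smul_eq_mul]
  ring

end

/-! ### Riesz type potentials of a continuous integrable density -/

/-- The potential `∫ f(y) |x - y|⁻ᵇ dy`. -/
def rieszPotential (f : E n → ℝ) (b : ℕ) (x : E n) : ℝ := ∫ y, f y * (‖x - y‖ ^ b)⁻¹

/-- The vector potential `∫ f(y) (x - y) |x - y|⁻ᵃ dy`. -/
def vectorPotential (f : E n → ℝ) (a : ℕ) (x : E n) : E n := ∫ y, f y • radialKernel a (x - y)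

section
variable {f : E n → ℝ}

/-- Within distance one of `x` the density is bounded and the kernel integrable; farther away the
kernel is at most one and the density integrable. Uniformity in `x` is what the Fubini arguments
below need. -/
theorem exists_lintegral_potential_le [NeZero n] (hf : Continuous f) (hi : Integrable f)
    {b : ℕ} (hb : b < n) (R : ℝ) :
    ∃ C : ℝ, 0 ≤ C ∧ ∀ x ∈ Metric.ball (0 : E n) R,
      ∫⁻ y, ENNReal.ofReal (|f y| * (‖x - y‖ ^ b)⁻¹) ≤ ENNReal.ofReal C := by
  obtain ⟨C, hC0, hC⟩ := exists_lintegral_inv_norm_sub_pow_le (n := n) hb 1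
  obtain ⟨M, hM⟩ := (isCompact_closedBall (0 : E n) (R + 1)).exists_bound_of_continuousOn
    hf.continuousOn
  have hM0 : 0 ≤ |M| := abs_nonneg M
  refine ⟨|M| * C + ∫ y, |f y|, by positivity, fun x hx => ?_⟩
  have h1 : ∀ y, ENNReal.ofReal (|f y| * (‖x - y‖ ^ b)⁻¹) ≤
      (Metric.ball x 1).indicator
        (fun y => ENNReal.ofReal |M| * ENNReal.ofReal ((‖y - x‖ ^ b)⁻¹)) y
      + ENNReal.ofReal |f y| := by
    intro y
    rw [norm_sub_rev]
    by_cases hy : y ∈ Metric.ball x 1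
    · simp only [hy, Set.indicator_of_mem]
      refine le_add_right ?_
      rw [← ENNReal.ofReal_mul hM0]
      apply ENNReal.ofReal_le_ofReal
      refine mul_le_mul_of_nonneg_right ?_ (by positivity)
      refine ((hM y ?_).trans (le_abs_self M))
      have h2 : dist x 0 < R := hx
      have h3 : dist y x < 1 := hy
      simp only [Metric.mem_closedBall]
      linarith [dist_triangle y x 0]
    · simp only [hy, not_false_eq_true, Set.indicator_of_notMem, zero_add]
      apply ENNReal.ofReal_le_ofReal
      have h2 : 1 ≤ ‖y - x‖ := by simpa [dist_eq_norm] using hy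
      exact mul_le_of_le_one_right (abs_nonneg _) (inv_le_one_of_one_le₀ (one_le_pow₀ h2))
  calc _ ≤ _ := lintegral_mono h1
    _ = (∫⁻ y in Metric.ball x 1, ENNReal.ofReal |M| * ENNReal.ofReal ((‖y - x‖ ^ b)⁻¹))
        + ∫⁻ y, ENNReal.ofReal |f y| := by
      rw [lintegral_add_right _ (by fun_prop), lintegral_indicator measurableSet_ball]
    _ ≤ ENNReal.ofReal |M| * ENNReal.ofReal C + ENNReal.ofReal (∫ y, |f y|) := by
      rw [lintegral_const_mul _ (by fun_prop)]
      refine add_le_add (by gcongr; exact hC x x) ?_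
      rw [ofReal_integral_eq_lintegral_ofReal hi.abs (Filter.Eventually.of_forall fun _ => abs_nonneg _)]
    _ = _ := by
      rw [← ENNReal.ofReal_mul hM0, ← ENNReal.ofReal_add (by positivity)
        (integral_nonneg fun _ => abs_nonneg _)]

theorem integrable_potential [NeZero n] (hf : Continuous f) (hi : Integrable f)
    {b : ℕ} (hb : b < n) (x : E n) : Integrable fun y => f y * (‖x - y‖ ^ b)⁻¹ := by
  obtain ⟨C, -, hC⟩ := exists_lintegral_potential_le hf hi hb (‖x‖ + 1)
  refine ⟨(Measurable.aestronglyMeasurable (by fun_prop)), ?_⟩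
  rw [hasFiniteIntegral_iff_norm]
  refine lt_of_le_of_lt ?_ ((hC x (by simp)).trans_lt ENNReal.ofReal_lt_top)
  refine lintegral_mono fun y => ENNReal.ofReal_le_ofReal ?_
  rw [norm_mul, Real.norm_eq_abs, Real.norm_of_nonneg (by positivity)]

/-- Joint integrability of the potential along a bounded measurable family of points. -/
theorem integrable_potential_prod [NeZero n] (hf : Continuous f) (hi : Integrable f)
    {b : ℕ} (hb : b < n) {X : Type*} [MeasurableSpace X] (ν : Measure X) [IsFiniteMeasure ν]
    {p : X → E n} (hp : Measurable p) {R : ℝ} (hR : ∀ᵐ t ∂ν, p t ∈ Metric.ball 0 R) :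
    Integrable (fun q : X × E n => f q.2 * (‖p q.1 - q.2‖ ^ b)⁻¹) (ν.prod volume) := by
  obtain ⟨C, -, hC⟩ := exists_lintegral_potential_le hf hi hb R
  refine ⟨(Measurable.aestronglyMeasurable (by fun_prop)), ?_⟩
  rw [hasFiniteIntegral_iff_norm, lintegral_prod _ (by fun_prop)]
  calc _ ≤ ∫⁻ t, ENNReal.ofReal C ∂ν := by
        refine lintegral_mono_ae (hR.mono fun t ht => ?_)
        refine le_trans (lintegral_mono fun y => ENNReal.ofReal_le_ofReal ?_) (hC _ ht)
        simp only
        rw [norm_mul, Real.norm_eq_abs, Real.norm_of_nonneg (by positivity)]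
    _ < ⊤ := by
        rw [lintegral_const]
        exact ENNReal.mul_lt_top ENNReal.ofReal_lt_top (measure_lt_top _ _)

theorem norm_smul_radialKernel_le (a : ℕ) (c : ℝ) (z : E n) :
    ‖c • radialKernel (a + 1) z‖ ≤ ‖c * (‖z‖ ^ a)⁻¹‖ := by
  rw [norm_smul, norm_mul]
  gcongr
  exact (norm_radialKernel_succ a z).trans (le_abs_self _)

theorem integrable_vectorPotential_prod [NeZero n] (hf : Continuous f) (hi : Integrable f)
    {a : ℕ} (ha : a < n) {X : Type*} [MeasurableSpace X] (ν : Measure X) [IsFiniteMeasure ν]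
    {p : X → E n} (hp : Measurable p) {R : ℝ} (hR : ∀ᵐ t ∂ν, p t ∈ Metric.ball 0 R) :
    Integrable (fun q : X × E n => f q.2 • radialKernel (a + 1) (p q.1 - q.2))
      (ν.prod volume) := by
  refine (integrable_potential_prod hf hi ha ν hp hR).mono ?_
    (Filter.Eventually.of_forall fun q => norm_smul_radialKernel_le a _ _)
  have := measurable_radialKernel (n := n) (a + 1)
  exact Measurable.aestronglyMeasurable (by fun_prop)

theorem integrable_vectorPotential [NeZero n] (hf : Continuous f) (hi : Integrable f)
    {a : ℕ} (ha : a < n) (x : E n) :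
    Integrable fun y => f y • radialKernel (a + 1) (x - y) := by
  refine (integrable_potential hf hi ha x).mono ?_
    (Filter.Eventually.of_forall fun q => norm_smul_radialKernel_le a _ _)
  have := measurable_radialKernel (n := n) (a + 1)
  exact Measurable.aestronglyMeasurable (by fun_prop)

/-- A continuous bounded truncation of `radialKernel`. -/
def truncatedKernel (a : ℕ) (z : E n) : E n := ((max ‖z‖ 1) ^ a)⁻¹ • z

theorem continuous_truncatedKernel (a : ℕ) : Continuous (truncatedKernel a : E n → E n) := by
  unfold truncatedKernel
  have h : Continuous fun z : E n => max ‖z‖ 1 ^ a :=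
    (continuous_norm.max continuous_const).pow a
  exact (h.inv₀ fun z => by positivity).smul continuous_id

theorem norm_truncatedKernel_succ (a : ℕ) (z : E n) : ‖truncatedKernel (a + 1) z‖ ≤ 1 := by
  have h1 : (1 : ℝ) ≤ max ‖z‖ 1 := le_max_right _ _
  rw [truncatedKernel, norm_smul, norm_inv, norm_pow, Real.norm_of_nonneg (by positivity),
    inv_mul_le_iff₀ (by positivity), mul_one]
  exact (le_max_left _ _).trans (le_self_pow₀ h1 (by omega))

/-- Split the kernel into a bounded continuous part, handled by domination with `f`, and a singular
part supported in the unit ball. In the latter, the substitution `z = x - y` moves the dependence on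
`x` onto the continuous density. -/
theorem continuous_vectorPotential [NeZero n] (hf : Continuous f) (hi : Integrable f)
    {a : ℕ} (ha : a < n) : Continuous (vectorPotential f (a + 1)) := by
  have hcT := continuous_truncatedKernel (n := n) (a + 1)
  have hmR := measurable_radialKernel (n := n) (a + 1)
  have hT : ∀ x, Integrable fun y => f y • truncatedKernel (a + 1) (x - y) := fun x => by
    refine hi.mono (Measurable.aestronglyMeasurable (by fun_prop))
      (Filter.Eventually.of_forall fun y => ?_)
    rw [norm_smul]
    exact mul_le_of_le_one_right (norm_nonneg _) (norm_truncatedKernel_succ a _)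
  set D : E n → E n := fun z => radialKernel (a + 1) z - truncatedKernel (a + 1) z with hD
  have hD0 : ∀ z, 1 ≤ ‖z‖ → D z = 0 := fun z hz => by
    simp [hD, radialKernel, truncatedKernel, max_eq_left hz]
  have heq : vectorPotential f (a + 1) = fun x =>
      (∫ y, f y • truncatedKernel (a + 1) (x - y)) + ∫ z, f (x - z) • D z := by
    ext1 x
    have h1 : ∫ z, f (x - z) • D z = ∫ y, f y • D (x - y) := by
      rw [← integral_sub_left_eq_self (fun z => f z • D (x - z)) volume x]
      simp
    rw [h1]
    simp only [hD, smul_sub]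
    rw [integral_sub (integrable_vectorPotential hf hi ha x) (hT x)]
    simp [vectorPotential]
  rw [heq]
  refine Continuous.add ?_ ?_
  · refine continuous_of_dominated (bound := fun y => ‖f y‖)
      (fun x => (hT x).aestronglyMeasurable) (fun x => Filter.Eventually.of_forall fun y => ?_)
      hi.norm (Filter.Eventually.of_forall fun y => by fun_prop)
    rw [norm_smul]
    exact mul_le_of_le_one_right (norm_nonneg _) (norm_truncatedKernel_succ a _)
  · rw [continuous_iff_continuousAt]
    intro x₀
    obtain ⟨M, hM⟩ := (isCompact_closedBall x₀ 2).exists_bound_of_continuousOn hf.continuousOn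
    have hDb : Integrable fun z => |M| * ‖(Metric.ball (0 : E n) 1).indicator D z‖ := by
      refine Integrable.const_mul (Integrable.norm ?_) _
      rw [integrable_indicator_iff measurableSet_ball]
      have h1 : IntegrableOn (radialKernel (a + 1) : E n → E n) (Metric.ball 0 1) := by
        refine (integrableOn_ball_inv_norm_pow ha 1).mono' hmR.aestronglyMeasurable
          (Filter.Eventually.of_forall fun z => norm_radialKernel_succ a z)
      have h2 : IntegrableOn (truncatedKernel (a + 1) : E n → E n) (Metric.ball 0 1) :=
        (hcT.continuousOn.integrableOn_compact (isCompact_closedBall 0 1)).mono_set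
          Metric.ball_subset_closedBall
      exact h1.sub h2
    refine continuousAt_of_dominated (bound := fun z =>
      |M| * ‖(Metric.ball (0 : E n) 1).indicator D z‖) ?_ ?_ hDb ?_
    · exact Filter.Eventually.of_forall fun x => Measurable.aestronglyMeasurable (by fun_prop)
    · filter_upwards [Metric.ball_mem_nhds x₀ one_pos] with x hx
      refine Filter.Eventually.of_forall fun z => ?_
      by_cases hz : z ∈ Metric.ball (0 : E n) 1
      · simp only [hz, Set.indicator_of_mem]
        rw [norm_smul]
        gcongr
        refine (hM _ ?_).trans (le_abs_self M)
        have h2 : dist x x₀ < 1 := hx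
        have h3 : ‖z‖ < 1 := by simpa using hz
        simp only [Metric.mem_closedBall]
        have h4 : dist (x - z) x = ‖z‖ := by simp
        linarith [dist_triangle (x - z) x x₀]
      · rw [hD0 z (by simpa using hz)]
        simp; positivity
    · refine Filter.Eventually.of_forall fun z => ?_
      fun_prop

end

/-! ### Differentiation of potentials -/

/-- Continuity of `W` makes the segment average of `W - W x` small. This avoids differentiating
under a singular integral: only an integrated identity along segments is required. -/
theorem hasFDerivAt_of_integral_segment {h : E n → ℝ} {W : E n → E n} (hW : Continuous W)
    (H : ∀ x d, h (x + d) - h x = ∫ t in (0 : ℝ)..1, inner ℝ (W (x + t • d)) d) (x : E n) :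
    HasFDerivAt h (innerSL ℝ (W x)) x := by
  rw [hasFDerivAt_iff_isLittleO_nhds_zero, Asymptotics.isLittleO_iff]
  intro ε hε
  obtain ⟨δ, hδ, hball⟩ := Metric.continuousAt_iff.1 (hW.continuousAt (x := x)) ε hε
  filter_upwards [Metric.ball_mem_nhds (0 : E n) hδ] with d hd
  have hd' : ‖d‖ < δ := by simpa using hd
  have e : h (x + d) - h x - innerSL ℝ (W x) d
      = ∫ t in (0 : ℝ)..1, inner ℝ (W (x + t • d) - W x) d := by
    simp only [inner_sub_left]
    rw [intervalIntegral.integral_sub, ← H]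
    · simp
    · exact Continuous.intervalIntegrable (by fun_prop) _ _
    · exact Continuous.intervalIntegrable (by fun_prop) _ _
  rw [e]
  refine (intervalIntegral.norm_integral_le_of_norm_le_const (C := ε * ‖d‖) fun t ht => ?_).trans
    (by simp)
  rw [Set.uIoc_of_le zero_le_one] at ht
  refine (norm_inner_le_norm _ _).trans ?_
  gcongr
  rw [← dist_eq_norm]
  refine (hball ?_).le
  rw [dist_eq_norm, add_sub_cancel_left, norm_smul, Real.norm_of_nonneg ht.1.le]
  exact (mul_le_of_le_one_left (norm_nonneg _) ht.2).trans_lt hd'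

/-- A line is a null set in dimension at least two, so almost no pole lies on it. -/
theorem ae_forall_add_smul_sub_ne_zero (hn : 2 ≤ n) (x d : E n) :
    ∀ᵐ y : E n, ∀ t : ℝ, x + t • d - y ≠ 0 := by
  have hs : (Submodule.span ℝ {d} : Submodule ℝ (E n)) ≠ ⊤ := by
    intro h
    have h1 := finrank_span_le_card (R := ℝ) ({d} : Set (E n))
    rw [h, finrank_top, finrank_euclideanSpace] at h1
    simp at h1
    omega
  have h0 := Measure.addHaar_submodule (volume : Measure (E n)) _ hs
  have h1 : volume ((fun y => y - x) ⁻¹' (Submodule.span ℝ {d} : Set (E n))) = 0 := by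
    simp only [sub_eq_add_neg]
    rw [measure_preimage_add_right, h0]
  refine (measure_eq_zero_iff_ae_notMem.1 h1).mono fun y hy t ht => hy ?_
  simp only [Set.mem_preimage, SetLike.mem_coe]
  rw [sub_eq_zero] at ht
  rw [← ht, add_sub_cancel_left]
  exact Submodule.smul_mem _ _ (Submodule.mem_span_singleton_self d)

theorem continuousAt_radialKernel (a : ℕ) {z : E n} (hz : z ≠ 0) :
    ContinuousAt (radialKernel a : E n → E n) z := by
  unfold radialKernel
  have : ‖z‖ ^ a ≠ 0 := pow_ne_zero _ (norm_ne_zero_iff.2 hz)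
  fun_prop (disch := assumption)

section
variable {f : E n → ℝ}

/-- For almost every `y` the pole misses the segment, the fundamental theorem of calculus applies,
and Fubini exchanges `t` and `y`. Differences are used because the logarithm itself need not be
integrable against `f` at infinity, whereas its increments are. -/
theorem integral_kernel_sub [NeZero n] (hn : 2 ≤ n) (hf : Continuous f) (hi : Integrable f)
    {a : ℕ} (ha : a < n) {k : E n → ℝ} {κ : ℝ}
    (hk : ∀ z, z ≠ 0 → HasFDerivAt k (κ • innerSL ℝ (radialKernel (a + 1) z)) z) (x d : E n) :
    Integrable (fun y => f y * (k (x + d - y) - k (x - y))) ∧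
    ∫ y, f y * (k (x + d - y) - k (x - y))
      = ∫ t in (0 : ℝ)..1, inner ℝ (κ • vectorPotential f (a + 1) (x + t • d)) d := by
  set F : ℝ → E n → ℝ := fun t y =>
    κ * inner ℝ (f y • radialKernel (a + 1) (x + t • d - y)) d with hF
  have hFi : Integrable (Function.uncurry F)
      ((volume.restrict (Set.Ioc (0 : ℝ) 1)).prod (volume : Measure (E n))) := by
    have hR : ∀ᵐ t ∂(volume.restrict (Set.Ioc (0 : ℝ) 1)),
        x + t • d ∈ Metric.ball (0 : E n) (‖x‖ + ‖d‖ + 1) := by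
      refine (ae_restrict_mem measurableSet_Ioc).mono fun t ht => ?_
      rw [mem_ball_zero_iff]
      calc ‖x + t • d‖ ≤ ‖x‖ + ‖t • d‖ := norm_add_le _ _
        _ ≤ ‖x‖ + ‖d‖ := by
          rw [norm_smul, Real.norm_of_nonneg ht.1.le]
          gcongr
          exact mul_le_of_le_one_left (norm_nonneg _) ht.2
        _ < _ := by linarith
    have := integrable_vectorPotential_prod hf hi ha (volume.restrict (Set.Ioc (0 : ℝ) 1))
      (p := fun t => x + t • d) (by fun_prop) hR
    exact (this.inner_const d).const_mul κ
  have hae : (fun y => ∫ t in Set.Ioc (0 : ℝ) 1, F t y)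
      =ᵐ[volume] fun y => f y * (k (x + d - y) - k (x - y)) := by
    filter_upwards [ae_forall_add_smul_sub_ne_zero hn x d] with y hy
    have hder : ∀ t ∈ Set.uIcc (0 : ℝ) 1, HasDerivAt (fun t : ℝ => k (x + t • d - y))
        (κ * inner ℝ (radialKernel (a + 1) (x + t • d - y)) d) t := by
      intro t _
      have h1 : HasDerivAt (fun t : ℝ => x + t • d - y) d t := by
        simpa using (((hasDerivAt_id t).smul_const d).const_add x).sub_const y
      have h2 := (hk _ (hy t)).comp_hasDerivAt t h1
      simpa [Function.comp_def] using h2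
    have hint := intervalIntegral.integral_eq_sub_of_hasDerivAt hder (by
      refine Continuous.intervalIntegrable ?_ _ _
      have : Continuous fun t : ℝ => radialKernel (a + 1) (x + t • d - y) := by
        rw [continuous_iff_continuousAt]
        intro t
        exact (continuousAt_radialKernel (a + 1) (hy t)).comp
          (f := fun t : ℝ => x + t • d - y) (by fun_prop)
      fun_prop)
    simp only [one_smul, zero_smul, add_zero] at hint
    rw [← hint, ← intervalIntegral.integral_of_le zero_le_one,
      ← intervalIntegral.integral_const_mul]
    refine intervalIntegral.integral_congr fun t _ => ?_
    simp only [hF, inner_smul_left]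
    simp
    ring
  refine ⟨hFi.integral_prod_right.congr hae, ?_⟩
  rw [← integral_congr_ae hae, ← integral_integral_swap hFi,
    intervalIntegral.integral_of_le zero_le_one]
  congr 1
  ext t
  simp only [hF]
  rw [integral_const_mul, inner_smul_left, vectorPotential]
  simp only [conj_trivial]
  congr 1
  rw [real_inner_comm, ← integral_inner (integrable_vectorPotential hf hi ha _)]
  simp only [real_inner_comm]

theorem hasFDerivAt_of_kernel [NeZero n] (hn : 2 ≤ n) (hf : Continuous f) (hi : Integrable f)
    {a : ℕ} (ha : a < n) {k h : E n → ℝ} {κ : ℝ}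
    (hk : ∀ z, z ≠ 0 → HasFDerivAt k (κ • innerSL ℝ (radialKernel (a + 1) z)) z)
    (hh : ∀ x d, h (x + d) - h x = ∫ y, f y * (k (x + d - y) - k (x - y))) (x : E n) :
    HasFDerivAt h (innerSL ℝ (κ • vectorPotential f (a + 1) x)) x :=
  hasFDerivAt_of_integral_segment (W := fun x => κ • vectorPotential f (a + 1) x)
    ((continuous_vectorPotential hf hi ha).const_smul κ)
    (fun x d => (hh x d).trans (integral_kernel_sub hn hf hi ha hk x d).2) x

theorem hasFDerivAt_log_norm {z : E n} (hz : z ≠ 0) :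
    HasFDerivAt (fun z : E n => Real.log ‖z‖) ((1 : ℝ) • innerSL ℝ (radialKernel 2 z)) z := by
  have h0 : ‖z‖ ≠ 0 := norm_ne_zero_iff.2 hz
  have h1 := ((hasStrictFDerivAt_norm_sq z).hasFDerivAt.log (pow_ne_zero 2 h0)).const_mul
    ((1 : ℝ) / 2)
  have e : (fun z : E n => (1 : ℝ) / 2 * Real.log (‖z‖ ^ 2)) = fun z => Real.log ‖z‖ := by
    ext z
    rw [Real.log_pow]; push_cast; ring
  rw [e] at h1
  refine h1.congr_fderiv ?_
  ext w
  simp [radialKernel]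
  ring

theorem hasFDerivAt_inv_norm_pow (j : ℕ) {z : E n} (hz : z ≠ 0) :
    HasFDerivAt (fun z : E n => (‖z‖ ^ (2 * j))⁻¹)
      ((-(2 * j : ℕ) : ℝ) • innerSL ℝ (radialKernel (2 * j + 2) z)) z := by
  have h0 : ‖z‖ ≠ 0 := norm_ne_zero_iff.2 hz
  have h1 := ((hasDerivAt_pow j (‖z‖ ^ 2)).inv (pow_ne_zero _ (pow_ne_zero 2 h0))).comp_hasFDerivAt z
    (hasStrictFDerivAt_norm_sq z).hasFDerivAt
  have e : ((fun t : ℝ => t ^ j)⁻¹ ∘ fun z : E n => ‖z‖ ^ 2) = fun z => (‖z‖ ^ (2 * j))⁻¹ := by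
    ext z
    simp [pow_mul]
  rw [e] at h1
  refine h1.congr_fderiv ?_
  ext w
  simp only [radialKernel, smul_apply, innerSL_apply_apply, inner_smul_left,
    smul_eq_mul, conj_trivial, nsmul_eq_mul]
  rcases j with _ | j
  · simp
  · push_cast
    field_simp
    ring

theorem hasFDerivAt_rieszPotential [NeZero n] (hn : 2 ≤ n) (hf : Continuous f)
    (hi : Integrable f) {j : ℕ} (hj : 2 * j + 2 ≤ n) (x : E n) :
    HasFDerivAt (rieszPotential f (2 * j))
      (innerSL ℝ ((-(2 * j : ℕ) : ℝ) • vectorPotential f (2 * j + 2) x)) x := by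
  refine hasFDerivAt_of_kernel hn hf hi (a := 2 * j + 1) (by omega)
    (fun z hz => hasFDerivAt_inv_norm_pow j hz) (fun x d => ?_) x
  simp only [mul_sub]
  rw [integral_sub (integrable_potential hf hi (by omega) _)
    (integrable_potential hf hi (by omega) _)]
  rfl

/-- The logarithmic potential `∫ log (|y| / |x - y|) f(y) dy`. -/
def logPotential (f : E n → ℝ) (x : E n) : ℝ := ∫ y, Real.log (‖y‖ / ‖x - y‖) * f y

/-- The quotient rule for the logarithm fails only in the default values at `y = 0` and `y = x`, a
null set. -/
theorem log_div_mul_ae_eq [NeZero n] (f : E n → ℝ) (x : E n) :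
    (fun y => Real.log (‖y‖ / ‖x - y‖) * f y) =ᵐ[volume]
      fun y => -(f y * (Real.log ‖0 + x - y‖ - Real.log ‖(0 : E n) - y‖)) := by
  have h1 : ∀ᵐ y : E n, y ≠ 0 := Measure.ae_ne volume 0
  have h2 : ∀ᵐ y : E n, y ≠ x := Measure.ae_ne volume x
  filter_upwards [h1, h2] with y hy hx
  rw [Real.log_div (norm_ne_zero_iff.2 hy) (norm_ne_zero_iff.2 (sub_ne_zero.2 hx.symm))]
  simp
  ring

theorem integrable_logPotential [NeZero n] (hn : 2 ≤ n) (hf : Continuous f) (hi : Integrable f)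
    (x : E n) : Integrable fun y => Real.log (‖y‖ / ‖x - y‖) * f y :=
  (integral_kernel_sub hn hf hi (a := 1) (by omega) (fun _ hz => hasFDerivAt_log_norm hz)
    0 x).1.neg.congr (log_div_mul_ae_eq f x).symm

theorem hasFDerivAt_logPotential [NeZero n] (hn : 2 ≤ n) (hf : Continuous f)
    (hi : Integrable f) (x : E n) :
    HasFDerivAt (logPotential f) (innerSL ℝ (-vectorPotential f 2 x)) x := by
  have hK : ∀ z : E n, z ≠ 0 → HasFDerivAt (fun z : E n => -Real.log ‖z‖)
      ((-1 : ℝ) • innerSL ℝ (radialKernel (1 + 1) z)) z := fun z hz => by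
    have h := (hasFDerivAt_log_norm hz).neg
    simp only [one_smul, neg_smul] at h ⊢
    exact h
  have := hasFDerivAt_of_kernel (h := logPotential f) hn hf hi (a := 1) (by omega) hK
    (fun x d => ?_) x
  · simpa using this
  · have hI := fun x => (integral_kernel_sub hn hf hi (a := 1) (by omega) hK 0 x).1
    have e : ∀ x, logPotential f x = ∫ y, f y * (-Real.log ‖0 + x - y‖ - -Real.log ‖(0 : E n) - y‖) := by
      intro x
      rw [logPotential, integral_congr_ae (log_div_mul_ae_eq f x)]
      congr 1; ext y; ring
    rw [e, e, ← integral_sub (hI _) (hI _)]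
    congr 1; ext y
    simp only [zero_add]
    ring

end

/-! ### The equation `-Δh = g` in the weak sense -/

/-- `h` is continuously differentiable with gradient `V` and `-Δh = g` weakly. -/
structure IsWeakNegLap (h : E n → ℝ) (V : E n → E n) (g : E n → ℝ) : Prop where
  hasFDerivAt : ∀ x, HasFDerivAt h (innerSL ℝ (V x)) x
  continuous_grad : Continuous V
  continuous_rhs : Continuous g
  integral_eq : ∀ Ψ : E n → ℝ, ContDiff ℝ 1 Ψ → HasCompactSupport Ψ →
    ∫ x, fderiv ℝ Ψ x (V x) = ∫ x, Ψ x * g x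

theorem integrable_fderiv_apply {Ψ : E n → ℝ} (hΨ : ContDiff ℝ 1 Ψ) (hc : HasCompactSupport Ψ)
    {V : E n → E n} (hV : Continuous V) : Integrable fun x => fderiv ℝ Ψ x (V x) := by
  have h1 : Continuous (fderiv ℝ Ψ) := hΨ.continuous_fderiv one_ne_zero
  refine Continuous.integrable_of_hasCompactSupport (h1.clm_apply hV) ?_
  refine (hc.fderiv ℝ).mono fun x hx => ?_
  simp only [Function.mem_support] at hx ⊢
  intro h0
  simp [h0] at hx

theorem integrable_mul_of_hasCompactSupport {Ψ g : E n → ℝ} (hΨ : Continuous Ψ)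
    (hc : HasCompactSupport Ψ) (hg : Continuous g) : Integrable fun x => Ψ x * g x :=
  (hΨ.mul hg).integrable_of_hasCompactSupport hc.mul_right

namespace IsWeakNegLap

variable {h₁ h₂ g₁ g₂ : E n → ℝ} {V₁ V₂ : E n → E n}

theorem const_mul (H : IsWeakNegLap h₁ V₁ g₁) (c : ℝ) :
    IsWeakNegLap (fun x => c * h₁ x) (fun x => c • V₁ x) (fun x => c * g₁ x) where
  hasFDerivAt x := by simpa using (H.hasFDerivAt x).const_mul c
  continuous_grad := H.continuous_grad.const_smul c
  continuous_rhs := continuous_const.mul H.continuous_rhs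
  integral_eq Ψ hΨ hc := by
    simp only [map_smul, smul_eq_mul, mul_left_comm _ c]
    rw [integral_const_mul, integral_const_mul, H.integral_eq Ψ hΨ hc]

theorem sub (H₁ : IsWeakNegLap h₁ V₁ g₁) (H₂ : IsWeakNegLap h₂ V₂ g₂) :
    IsWeakNegLap (fun x => h₁ x - h₂ x) (fun x => V₁ x - V₂ x) (fun x => g₁ x - g₂ x) where
  hasFDerivAt x := by
    have := (H₁.hasFDerivAt x).sub (H₂.hasFDerivAt x)
    rw [← map_sub] at this
    exact this
  continuous_grad := H₁.continuous_grad.sub H₂.continuous_grad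
  continuous_rhs := H₁.continuous_rhs.sub H₂.continuous_rhs
  integral_eq Ψ hΨ hc := by
    simp only [map_sub, mul_sub]
    rw [integral_sub (integrable_fderiv_apply hΨ hc H₁.continuous_grad)
      (integrable_fderiv_apply hΨ hc H₂.continuous_grad),
      integral_sub (integrable_mul_of_hasCompactSupport hΨ.continuous hc H₁.continuous_rhs)
      (integrable_mul_of_hasCompactSupport hΨ.continuous hc H₂.continuous_rhs),
      H₁.integral_eq Ψ hΨ hc, H₂.integral_eq Ψ hΨ hc]

/-- Test functions determine a continuous right-hand side. This later identifies the classical `Δu`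
with a Riesz potential. -/
theorem rhs_unique (H₁ : IsWeakNegLap h₁ V₁ g₁) (H₂ : IsWeakNegLap h₁ V₁ g₂) : g₁ = g₂ := by
  have h : ∀ᵐ x : E n, g₁ x = g₂ x := by
    refine ae_eq_of_integral_contDiff_smul_eq H₁.continuous_rhs.locallyIntegrable
      H₂.continuous_rhs.locallyIntegrable fun Ψ hΨ hc => ?_
    have hΨ1 : ContDiff ℝ 1 Ψ := hΨ.of_le (by exact_mod_cast le_top)
    exact (H₁.integral_eq Ψ hΨ1 hc).symm.trans (H₂.integral_eq Ψ hΨ1 hc)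
  exact Continuous.ae_eq_iff_eq volume H₁.continuous_rhs H₂.continuous_rhs |>.1 h

end IsWeakNegLap

/-! ### Smooth functions -/

theorem fderiv_partialDeriv {u : E n → ℝ} (hu : ContDiff ℝ 2 u) (i : Fin n) (x v : E n) :
    fderiv ℝ (partialDeriv i u) x v = fderiv ℝ (fderiv ℝ u) x v (EuclideanSpace.single i 1) := by
  have h1 : DifferentiableAt ℝ (fderiv ℝ u) x :=
    (hu.fderiv_right (m := 1) (by norm_num)).differentiable one_ne_zero x
  unfold partialDeriv
  rw [fderiv_clm_apply h1 (differentiableAt_const _)]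
  simp

theorem laplacian_eq_sum_partialDeriv {u : E n → ℝ} (hu : ContDiff ℝ 2 u) (x : E n) :
    Laplacian.laplacian u x = ∑ i, partialDeriv i (partialDeriv i u) x := by
  rw [InnerProductSpace.laplacian_eq_iteratedFDeriv_orthonormalBasis u
    (EuclideanSpace.basisFun (Fin n) ℝ)]
  refine Finset.sum_congr rfl fun i _ => ?_
  rw [iteratedFDeriv_two_apply]
  conv_rhs => rw [partialDeriv]
  rw [fderiv_partialDeriv hu]
  simp

theorem contDiff_partialDeriv {u : E n → ℝ} (hu : ContDiff ℝ ∞ u) (i : Fin n) :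
    ContDiff ℝ ∞ (partialDeriv i u) :=
  (hu.fderiv_right (m := ∞) (by simp)).clm_apply contDiff_const

theorem contDiff_two_of_infty {u : E n → ℝ} (hu : ContDiff ℝ ∞ u) : ContDiff ℝ 2 u :=
  hu.of_le (WithTop.coe_le_coe.2 le_top)

theorem contDiff_neg_laplacian {u : E n → ℝ} (hu : ContDiff ℝ ∞ u) :
    ContDiff ℝ ∞ (-Laplacian.laplacian u) := by
  have : (-Laplacian.laplacian u) = fun x => -∑ i, partialDeriv i (partialDeriv i u) x := by
    ext x
    rw [Pi.neg_apply, laplacian_eq_sum_partialDeriv (contDiff_two_of_infty hu)]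
  rw [this]
  exact (ContDiff.sum fun i _ => contDiff_partialDeriv (contDiff_partialDeriv hu i) i).neg

theorem contDiff_iterate_neg_laplacian {u : E n → ℝ} (hu : ContDiff ℝ ∞ u) (j : ℕ) :
    ContDiff ℝ ∞ ((fun f : E n → ℝ => -Laplacian.laplacian f)^[j] u) := by
  induction j with
  | zero => simpa using hu
  | succ j ih =>
    rw [Function.iterate_succ_apply']
    exact contDiff_neg_laplacian ih

theorem inner_gradient_eq_fderiv (u : E n → ℝ) (x : E n) :
    innerSL ℝ (gradient u x) = fderiv ℝ u x := by
  ext v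
  simp [gradient]

theorem continuous_gradient {u : E n → ℝ} (hu : ContDiff ℝ 1 u) : Continuous (gradient u) :=
  (InnerProductSpace.toDual ℝ (E n)).symm.continuous.comp (hu.continuous_fderiv one_ne_zero)

theorem gradient_apply (u : E n → ℝ) (x : E n) (i : Fin n) :
    gradient u x i = partialDeriv i u x := by
  rw [partialDeriv, ← inner_gradient_eq_fderiv, innerSL_apply_apply,
    EuclideanSpace.inner_single_right]
  simp

theorem fderiv_apply_eq_sum (Ψ : E n → ℝ) (x v : E n) :
    fderiv ℝ Ψ x v = ∑ i, partialDeriv i Ψ x * v i := by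
  rw [← inner_gradient_eq_fderiv, innerSL_apply_apply, PiLp.inner_apply]
  simp [gradient_apply, mul_comm]

theorem isWeakNegLap_of_contDiff {u : E n → ℝ} (hu : ContDiff ℝ ∞ u) :
    IsWeakNegLap u (gradient u) (-Laplacian.laplacian u) where
  hasFDerivAt x := by
    rw [inner_gradient_eq_fderiv]
    exact (hu.differentiable (by simp) x).hasFDerivAt
  continuous_grad := continuous_gradient (hu.of_le (by exact_mod_cast le_top))
  continuous_rhs := (contDiff_neg_laplacian hu).continuous
  integral_eq Ψ hΨ hc := by
    have hcp : ∀ i, Continuous (partialDeriv i u) := fun i => (contDiff_partialDeriv hu i).continuous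
    have hcpp : ∀ i, Continuous (partialDeriv i (partialDeriv i u)) := fun i =>
      (contDiff_partialDeriv (contDiff_partialDeriv hu i) i).continuous
    have hcΨ : ∀ i, Continuous (partialDeriv i Ψ) := fun i =>
      (hΨ.continuous_fderiv one_ne_zero).clm_apply continuous_const
    have hsΨ : ∀ i, HasCompactSupport (partialDeriv i Ψ) := fun i =>
      hc.fderiv_apply (𝕜 := ℝ) (EuclideanSpace.single i 1)
    have h1 : ∀ i, Integrable fun x => partialDeriv i Ψ x * partialDeriv i u x := fun i =>
      integrable_mul_of_hasCompactSupport (hcΨ i) (hsΨ i) (hcp i)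
    have h2 : ∀ i, Integrable fun x => Ψ x * partialDeriv i (partialDeriv i u) x := fun i =>
      integrable_mul_of_hasCompactSupport hΨ.continuous hc (hcpp i)
    have h3 : ∀ i, ∫ x, Ψ x * partialDeriv i (partialDeriv i u) x
        = -∫ x, partialDeriv i Ψ x * partialDeriv i u x := fun i =>
      integral_mul_fderiv_eq_neg_fderiv_mul_of_integrable (h1 i) (h2 i)
        (integrable_mul_of_hasCompactSupport hΨ.continuous hc (hcp i))
        (fun x _ => hΨ.differentiable one_ne_zero x)
        (fun x _ => (contDiff_partialDeriv hu i).differentiable (by simp) x)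
    simp only [fderiv_apply_eq_sum, gradient_apply, Pi.neg_apply, laplacian_eq_sum_partialDeriv
      (contDiff_two_of_infty hu), mul_neg, Finset.mul_sum]
    rw [integral_neg, integral_finsetSum _ fun i _ => h1 i, integral_finsetSum _ fun i _ => h2 i,
      ← Finset.sum_neg_distrib]
    exact Finset.sum_congr rfl fun i _ => by rw [h3 i, neg_neg]

/-! ### Potentials -/

section
variable {f : E n → ℝ}

/-- Fubini, after restricting `x` to a ball containing the support of `fderiv ℝ Ψ`, where the
potential is jointly integrable. The weak equations for potentials thus follow from the divergences
of single kernels. -/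
theorem integral_fderiv_vectorPotential [NeZero n] (hf : Continuous f) (hi : Integrable f)
    {a : ℕ} (ha : a < n) {Ψ : E n → ℝ} (hΨ : ContDiff ℝ 1 Ψ) (hc : HasCompactSupport Ψ) :
    ∫ x, fderiv ℝ Ψ x (vectorPotential f (a + 1) x)
      = ∫ y, f y * ∫ x, fderiv ℝ Ψ x (radialKernel (a + 1) (x - y)) := by
  have hcf : Continuous (fderiv ℝ Ψ) := hΨ.continuous_fderiv one_ne_zero
  obtain ⟨R, hR⟩ := (hc.fderiv ℝ).isCompact.isBounded.subset_ball 0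
  obtain ⟨M, hM⟩ := (hc.fderiv ℝ).exists_bound_of_continuous hcf
  have h0 : ∀ x ∉ Metric.ball (0 : E n) R, fderiv ℝ Ψ x = 0 := fun x hx =>
    image_eq_zero_of_notMem_tsupport fun h => hx (hR h)
  have : IsFiniteMeasure (volume.restrict (Metric.ball (0 : E n) R)) :=
    isFiniteMeasure_restrict.2 measure_ball_lt_top.ne
  have hI := integrable_vectorPotential_prod hf hi ha (volume.restrict (Metric.ball (0 : E n) R))
    measurable_id (ae_restrict_mem measurableSet_ball)
  have hJ : Integrable (Function.uncurry fun x y =>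
      fderiv ℝ Ψ x (f y • radialKernel (a + 1) (x - y)))
      ((volume.restrict (Metric.ball (0 : E n) R)).prod volume) := by
    refine (hI.norm.const_mul M).mono' ?_ (Filter.Eventually.of_forall fun q => ?_)
    · have hm := measurable_radialKernel (n := n) (a + 1)
      refine Measurable.aestronglyMeasurable ?_
      exact ((isBoundedBilinearMap_apply (𝕜 := ℝ) (E := E n) (F := ℝ)).continuous.measurable).comp
        ((hcf.measurable.comp measurable_fst).prodMk
          (by fun_prop : Measurable fun q : E n × E n => f q.2 • radialKernel (a + 1) (q.1 - q.2)))
    · exact (ContinuousLinearMap.le_opNorm _ _).trans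
        (mul_le_mul_of_nonneg_right (hM _) (norm_nonneg _))
  rw [← setIntegral_eq_integral_of_forall_compl_eq_zero (s := Metric.ball (0 : E n) R)
    (fun x hx => by simp [h0 x hx])]
  calc _ = ∫ x in Metric.ball (0 : E n) R, ∫ y, fderiv ℝ Ψ x (f y • radialKernel (a + 1) (x - y)) := by
        congr 1; ext x
        exact ((fderiv ℝ Ψ x).integral_comp_comm (integrable_vectorPotential hf hi ha x)).symm
    _ = ∫ y, ∫ x in Metric.ball (0 : E n) R, fderiv ℝ Ψ x (f y • radialKernel (a + 1) (x - y)) :=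
        integral_integral_swap hJ
    _ = _ := by
        congr 1; ext y
        rw [setIntegral_eq_integral_of_forall_compl_eq_zero (fun x hx => by simp [h0 x hx])]
        simp only [map_smul, smul_eq_mul]
        rw [integral_const_mul]

theorem integral_mul_rieszPotential [NeZero n] (hf : Continuous f) (hi : Integrable f)
    {b : ℕ} (hb : b < n) {Ψ : E n → ℝ} (hΨ : Continuous Ψ) (hc : HasCompactSupport Ψ) :
    ∫ x, Ψ x * rieszPotential f b x = ∫ y, f y * ∫ x, Ψ x * (‖x - y‖ ^ b)⁻¹ := by
  obtain ⟨R, hR⟩ := hc.isCompact.isBounded.subset_ball 0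
  obtain ⟨M, hM⟩ := hc.exists_bound_of_continuous hΨ
  have h0 : ∀ x ∉ Metric.ball (0 : E n) R, Ψ x = 0 := fun x hx =>
    image_eq_zero_of_notMem_tsupport fun h => hx (hR h)
  have : IsFiniteMeasure (volume.restrict (Metric.ball (0 : E n) R)) :=
    isFiniteMeasure_restrict.2 measure_ball_lt_top.ne
  have hI := integrable_potential_prod hf hi hb (volume.restrict (Metric.ball (0 : E n) R))
    measurable_id (ae_restrict_mem measurableSet_ball)
  have hJ : Integrable (Function.uncurry fun x y => Ψ x * (f y * (‖x - y‖ ^ b)⁻¹))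
      ((volume.restrict (Metric.ball (0 : E n) R)).prod volume) :=
    hI.bdd_mul (c := M) (hΨ.comp continuous_fst).aestronglyMeasurable
      (Filter.Eventually.of_forall fun q => hM _)
  rw [← setIntegral_eq_integral_of_forall_compl_eq_zero (s := Metric.ball (0 : E n) R)
    (fun x hx => by simp [h0 x hx])]
  simp only [rieszPotential, ← integral_const_mul]
  rw [integral_integral_swap hJ]
  congr 1; ext y
  rw [setIntegral_eq_integral_of_forall_compl_eq_zero (fun x hx => by simp [h0 x hx])]
  congr 1; ext x
  ring

theorem integral_fderiv_vectorPotential_of_lt [NeZero n] (hf : Continuous f) (hi : Integrable f)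
    {a : ℕ} (ha : a + 1 < n) {Ψ : E n → ℝ} (hΨ : ContDiff ℝ 1 Ψ) (hc : HasCompactSupport Ψ) :
    ∫ x, fderiv ℝ Ψ x (vectorPotential f (a + 1) x)
      = -((n : ℝ) - (a + 1 : ℕ)) * ∫ x, Ψ x * rieszPotential f (a + 1) x := by
  rw [integral_fderiv_vectorPotential hf hi (by omega) hΨ hc,
    integral_mul_rieszPotential hf hi ha hΨ.continuous hc, ← integral_const_mul]
  congr 1; ext y
  rw [integral_fderiv_radialKernel hΨ hc ha]
  ring

theorem integral_fderiv_vectorPotential_dim [NeZero n] (hf : Continuous f) (hi : Integrable f)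
    {Ψ : E n → ℝ} (hΨ : ContDiff ℝ 1 Ψ) (hc : HasCompactSupport Ψ) :
    ∫ x, fderiv ℝ Ψ x (vectorPotential f n x)
      = -(unitSphereMeasure n).real Set.univ * ∫ x, Ψ x * f x := by
  obtain ⟨a, ha⟩ : ∃ a, a + 1 = n := ⟨n - 1, by have := NeZero.pos n; omega⟩
  have h := integral_fderiv_vectorPotential hf hi (a := a) (by omega) hΨ hc
  rw [ha] at h
  rw [h, ← integral_const_mul]
  congr 1; ext y
  rw [integral_fderiv_radialKernel_dim hΨ hc]
  ring

theorem continuous_rieszPotential [NeZero n] (hn : 2 ≤ n) (hf : Continuous f)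
    (hi : Integrable f) {j : ℕ} (hj : 2 * j + 2 ≤ n) : Continuous (rieszPotential f (2 * j)) :=
  continuous_iff_continuousAt.2 fun x => (hasFDerivAt_rieszPotential hn hf hi hj x).continuousAt

theorem isWeakNegLap_logPotential [NeZero n] (hn : 4 ≤ n) (hf : Continuous f)
    (hi : Integrable f) :
    IsWeakNegLap (logPotential f) (fun x => -vectorPotential f 2 x)
      (fun x => ((n : ℝ) - 2) * rieszPotential f 2 x) where
  hasFDerivAt := hasFDerivAt_logPotential (by omega) hf hi
  continuous_grad := (continuous_vectorPotential hf hi (a := 1) (by omega)).neg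
  continuous_rhs := continuous_const.mul
    (continuous_rieszPotential (by omega) hf hi (j := 1) (by omega))
  integral_eq Ψ hΨ hc := by
    simp only [map_neg, mul_left_comm _ ((n : ℝ) - 2)]
    rw [integral_neg, integral_fderiv_vectorPotential_of_lt hf hi (by omega) hΨ hc,
      integral_const_mul]
    push_cast; ring

/-- The gradient of `|z|^{-2j}` is `-2j z |z|^{-2j-2}`, whose divergence is `-2j (n-2j-2)
|z|^{-2j-2}`. -/
theorem isWeakNegLap_rieszPotential [NeZero n] (hf : Continuous f)
    (hi : Integrable f) {j : ℕ} (hj : 2 * j + 4 ≤ n) :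
    IsWeakNegLap (rieszPotential f (2 * j))
      (fun x => (-(2 * j : ℕ) : ℝ) • vectorPotential f (2 * j + 2) x)
      (fun x => (2 * j * (n - 2 * j - 2) : ℝ) * rieszPotential f (2 * (j + 1)) x) where
  hasFDerivAt := hasFDerivAt_rieszPotential (by omega) hf hi (by omega)
  continuous_grad := (continuous_vectorPotential hf hi (a := 2 * j + 1) (by omega)).const_smul
    (-(2 * j : ℕ) : ℝ)
  continuous_rhs := continuous_const.mul
    (continuous_rieszPotential (by omega) hf hi (j := j + 1) (by omega))
  integral_eq Ψ hΨ hc := by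
    simp only [map_smul, mul_left_comm _ (2 * j * (n - 2 * j - 2) : ℝ)]
    rw [integral_smul, integral_fderiv_vectorPotential_of_lt hf hi (by omega) hΨ hc,
      integral_const_mul]
    simp only [smul_eq_mul, show 2 * j + 1 + 1 = 2 * (j + 1) by ring]
    push_cast; ring

/-- At the critical order the gradient field has a point mass as divergence, which returns the
density itself. -/
theorem isWeakNegLap_rieszPotential_dim [NeZero n] (hf : Continuous f)
    (hi : Integrable f) {j : ℕ} (hj : 2 * j + 2 = n) :
    IsWeakNegLap (rieszPotential f (2 * j))
      (fun x => (-(2 * j : ℕ) : ℝ) • vectorPotential f (2 * j + 2) x)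
      (fun x => (2 * j * (unitSphereMeasure n).real Set.univ : ℝ) * f x) where
  hasFDerivAt := hasFDerivAt_rieszPotential (by omega) hf hi (by omega)
  continuous_grad := (continuous_vectorPotential hf hi (a := 2 * j + 1) (by omega)).const_smul
    (-(2 * j : ℕ) : ℝ)
  continuous_rhs := continuous_const.mul hf
  integral_eq Ψ hΨ hc := by
    simp only [map_smul, mul_left_comm _ (2 * j * (unitSphereMeasure n).real Set.univ : ℝ)]
    rw [integral_smul, hj, integral_fderiv_vectorPotential_dim hf hi hΨ hc, integral_const_mul]
    simp only [smul_eq_mul]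
    push_cast; ring

end

/-! ### The fundamental solution of `(-Δ)ᵐ` in dimension `2m` -/

theorem unitSphereMeasure_real_univ_even {m : ℕ} (hm : 1 ≤ m) :
    (unitSphereMeasure (2 * m)).real Set.univ
      = 2 * m * (Real.pi ^ m / (Nat.factorial m : ℝ)) := by
  have : Nontrivial (E (2 * m)) :=
    Module.nontrivial_of_finrank_pos (R := ℝ) (by rw [finrank_euclideanSpace_fin]; omega)
  rw [unitSphereMeasure, Measure.toSphere_real_apply_univ, finrank_euclideanSpace_fin,
    measureReal_def, InnerProductSpace.volume_ball_of_dim_even (k := m) (by simp)]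
  have h : (0 : ℝ) ≤ Real.pi ^ m / (Nat.factorial m : ℝ) := by positivity
  simp [ENNReal.toReal_ofReal h]

theorem sphereVolume_even (m : ℕ) :
    sphereVolume (2 * m)
      = (2 * m + 1) * (Real.pi ^ m * 2 ^ (m + 1) / (Nat.doubleFactorial (2 * m + 1) : ℝ)) := by
  rw [sphereVolume, unitSphereMeasure, Measure.toSphere_real_apply_univ, finrank_euclideanSpace_fin,
    measureReal_def, InnerProductSpace.volume_ball_of_dim_odd (k := m) (by simp)]
  have h : (0 : ℝ) ≤ Real.pi ^ m * 2 ^ (m + 1) / (Nat.doubleFactorial (2 * m + 1) : ℝ) := by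
    positivity
  simp [ENNReal.toReal_ofReal h]

/-- The normalisation `2 / ((n-1)! |𝕊ⁿ|)` of the logarithmic potential. -/
def logConst (n : ℕ) : ℝ := 2 / ((Nat.factorial (n - 1) : ℝ) * sphereVolume n)

/-- The second factor is the constant that `(-Δ)ᵐ` produces from `-log |z|` in dimension `2m`, so
this identity says that the normalised logarithm is a fundamental solution. -/
theorem logConst_normalisation {m : ℕ} (hm : 1 ≤ m) :
    logConst (2 * m) * (4 ^ (m - 1) * (Nat.factorial (m - 1) : ℝ) ^ 2 *
      (unitSphereMeasure (2 * m)).real Set.univ) = 1 := by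
  obtain ⟨k, rfl⟩ : ∃ k, m = k + 1 := ⟨m - 1, by omega⟩
  -- Two expressions for `(2m+1)!` eliminate the double factorial that enters through the volume of
  -- the odd-dimensional ball.
  have h1 : (Nat.factorial (2 * (k + 1) + 1) : ℝ)
      = Nat.doubleFactorial (2 * (k + 1) + 1) * (2 ^ (k + 1) * Nat.factorial (k + 1)) := by
    rw [Nat.factorial_eq_mul_doubleFactorial (2 * (k + 1)), Nat.doubleFactorial_two_mul]
    push_cast; ring
  have h2 : (Nat.factorial (2 * (k + 1) + 1) : ℝ)
      = (2 * (k + 1) + 1) * (2 * (k + 1)) * Nat.factorial (2 * (k + 1) - 1) := by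
    rw [show 2 * (k + 1) = (2 * (k + 1) - 1) + 1 by omega, Nat.factorial_succ, Nat.factorial_succ]
    simp only [show 2 * (k + 1) - 1 = 2 * k + 1 by omega]
    push_cast; ring
  have hd : (0 : ℝ) < Nat.doubleFactorial (2 * (k + 1) + 1) := by
    exact_mod_cast Nat.doubleFactorial_pos _
  have hf : (0 : ℝ) < Nat.factorial (2 * (k + 1) - 1) := by exact_mod_cast Nat.factorial_pos _
  have hk : (0 : ℝ) < Nat.factorial k := by exact_mod_cast Nat.factorial_pos _
  have h3 : (Nat.factorial (k + 1) : ℝ) = (k + 1) * Nat.factorial k := by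
    rw [Nat.factorial_succ]; push_cast; ring
  have hπ := Real.pi_pos
  rw [h1, h3] at h2
  have h4 : (Nat.doubleFactorial (2 * (k + 1) + 1) : ℝ) = (2 * (k + 1) + 1) * 2 *
      Nat.factorial (2 * (k + 1) - 1) / (2 ^ (k + 1) * Nat.factorial k) := by
    rw [eq_div_iff (by positivity)]
    have : (k + 1 : ℝ) ≠ 0 := by positivity
    refine mul_left_cancel₀ this ?_
    linarith
  rw [logConst, unitSphereMeasure_real_univ_even hm, sphereVolume_even, h4, h3,
    Nat.add_sub_cancel, show (4 : ℝ) = 2 * 2 by norm_num, mul_pow]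
  push_cast
  field_simp
  ring

/-- The coefficients of `(-Δ)ʲ` of the normalised logarithmic kernel in dimension `2m`. -/
def logCoeff (m j : ℕ) : ℝ :=
  logConst (2 * m) * 2 * 4 ^ (j - 1) * Nat.factorial (j - 1) * Nat.factorial (m - 1)
    / Nat.factorial (m - 1 - j)

theorem logCoeff_one {m : ℕ} (hm : 2 ≤ m) :
    logCoeff m 1 = logConst (2 * m) * (((2 * m : ℕ) : ℝ) - 2) := by
  obtain ⟨k, rfl⟩ : ∃ k, m = k + 2 := ⟨m - 2, by omega⟩
  have hk : (Nat.factorial k : ℝ) ≠ 0 := by exact_mod_cast Nat.factorial_ne_zero _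
  rw [logCoeff, show k + 2 - 1 = k + 1 by omega, show k + 1 - 1 = k by omega, Nat.factorial_succ]
  field_simp
  push_cast
  simp
  ring

theorem logCoeff_succ {m j : ℕ} (hj : 1 ≤ j) (hjm : j + 2 ≤ m) :
    logCoeff m (j + 1) = logCoeff m j * (2 * j * (((2 * m : ℕ) : ℝ) - 2 * j - 2)) := by
  obtain ⟨i, rfl⟩ : ∃ i, j = i + 1 := ⟨j - 1, by omega⟩
  obtain ⟨k, rfl⟩ : ∃ k, m = i + 3 + k := ⟨m - i - 3, by omega⟩
  have hk : (Nat.factorial k : ℝ) ≠ 0 := by exact_mod_cast Nat.factorial_ne_zero _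
  rw [logCoeff, logCoeff, show i + 3 + k - 1 - (i + 1) = k + 1 by omega,
    show i + 3 + k - 1 - (i + 1 + 1) = k by omega, show i + 1 + 1 - 1 = i + 1 by omega,
    show i + 1 - 1 = i by omega, Nat.factorial_succ i, Nat.factorial_succ k]
  push_cast
  field_simp
  ring

theorem logCoeff_last {m : ℕ} (hm : 2 ≤ m) :
    logCoeff m (m - 1) * (2 * ((m - 1 : ℕ) : ℝ) * (unitSphereMeasure (2 * m)).real Set.univ)
      = 1 := by
  refine Eq.trans ?_ (logConst_normalisation (m := m) (by omega))
  rw [logCoeff]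
  obtain ⟨k, rfl⟩ : ∃ k, m = k + 2 := ⟨m - 2, by omega⟩
  rw [show k + 2 - 1 = k + 1 by omega, show k + 1 - 1 = k by omega, Nat.sub_self,
    Nat.factorial_succ]
  push_cast
  simp
  ring

/-- `(-Δ)ᵐ h = g` through a chain of weak equations `-Δ hⱼ = hⱼ₊₁`. -/
def IsWeakPolyLap (m : ℕ) (h g : E n → ℝ) : Prop :=
  ∃ (H : ℕ → E n → ℝ) (V : ℕ → E n → E n), H 0 = h ∧ H m = g ∧
    ∀ j < m, IsWeakNegLap (H j) (V j) (H (j + 1))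

theorem isWeakPolyLap_of_contDiff {u : E n → ℝ} (hu : ContDiff ℝ ∞ u) (m : ℕ) :
    IsWeakPolyLap m u ((fun f : E n → ℝ => -Laplacian.laplacian f)^[m] u) := by
  refine ⟨fun j => (fun f : E n → ℝ => -Laplacian.laplacian f)^[j] u,
    fun j => gradient ((fun f : E n → ℝ => -Laplacian.laplacian f)^[j] u), rfl, rfl, fun j _ => ?_⟩
  simp only [Function.iterate_succ_apply']
  exact isWeakNegLap_of_contDiff (contDiff_iterate_neg_laplacian hu j)

theorem IsWeakPolyLap.sub {m : ℕ} {h₁ h₂ g₁ g₂ : E n → ℝ} (H₁ : IsWeakPolyLap m h₁ g₁)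
    (H₂ : IsWeakPolyLap m h₂ g₂) :
    IsWeakPolyLap m (fun x => h₁ x - h₂ x) (fun x => g₁ x - g₂ x) := by
  obtain ⟨A, V, rfl, rfl, hA⟩ := H₁
  obtain ⟨B, W, rfl, rfl, hB⟩ := H₂
  exact ⟨fun j x => A j x - B j x, fun j x => V j x - W j x, rfl, rfl,
    fun j hj => (hA j hj).sub (hB j hj)⟩

/-- The normalised logarithmic potential of `f` solves `(-Δ)ᵐ v = f` in dimension `2m`. -/
theorem isWeakPolyLap_logPotential {m : ℕ} (hm : 2 ≤ m) {f : E (2 * m) → ℝ} (hf : Continuous f)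
    (hi : Integrable f) :
    IsWeakPolyLap m (fun x => logConst (2 * m) * logPotential f x) f := by
  have : NeZero (2 * m) := ⟨by omega⟩
  -- The chain runs from the logarithm through the Riesz potentials of orders `2, 4, …, 2m - 2` to
  -- `f`; `logCoeff_one`, `logCoeff_succ` and `logCoeff_last` match the constants at its links.
  refine ⟨fun j x => if j = 0 then logConst (2 * m) * logPotential f x else
      if j = m then f x else logCoeff m j * rieszPotential f (2 * j) x,
    fun j x => if j = 0 then logConst (2 * m) • -vectorPotential f 2 x else
      logCoeff m j • (-(2 * j : ℕ) : ℝ) • vectorPotential f (2 * j + 2) x, by simp,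
      by ext x; simp [show m ≠ 0 by omega], fun j hj => ?_⟩
  rcases Nat.eq_zero_or_pos j with rfl | hj0
  · simp only [if_true, zero_add, one_ne_zero, if_false, show 1 ≠ m by omega, logCoeff_one hm,
      mul_assoc]
    exact (isWeakNegLap_logPotential (by omega) hf hi).const_mul _
  · simp only [hj0.ne', if_false, hj.ne, Nat.succ_ne_zero]
    by_cases hj' : j + 1 = m
    · have hl := logCoeff_last hm
      simp only [hj', if_true]
      have h := (isWeakNegLap_rieszPotential_dim hf hi (j := j) (by omega)).const_mul (logCoeff m j)
      simp only [← mul_assoc] at h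
      rw [show m - 1 = j by omega] at hl
      simp only [← mul_assoc] at hl
      rw [hl] at h
      simpa using h
    · simp only [hj', if_false, logCoeff_succ hj0 (by omega : j + 2 ≤ m), mul_assoc]
      have h := (isWeakNegLap_rieszPotential hf hi (j := j) (by omega)).const_mul (logCoeff m j)
      simp only [mul_assoc] at h
      exact h

/-! ### Radial averages of weakly polyharmonic functions -/

/-- Stated for affine motions `p z + t • q z` so as to cover both derivatives needed below: in the
scale (`p = x`, `q = z`) and in the centre (`q` constant). -/
theorem hasDerivAt_integral_mul_comp_affine {φ h : E n → ℝ} {V p q : E n → E n}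
    (hφ : Continuous φ) (hc : HasCompactSupport φ)
    (hh : ∀ x, HasFDerivAt h (innerSL ℝ (V x)) x) (hV : Continuous V)
    (hp : Continuous p) (hq : Continuous q) (t₀ : ℝ) :
    HasDerivAt (fun t : ℝ => ∫ z, φ z * h (p z + t • q z))
      (∫ z, φ z * inner ℝ (V (p z + t₀ • q z)) (q z)) t₀ := by
  have hhc : Continuous h := continuous_iff_continuousAt.2 fun x => (hh x).continuousAt
  obtain ⟨M, hM⟩ := ((isCompact_closedBall t₀ 1).prod hc.isCompact).exists_bound_of_continuousOn
    (f := fun w : ℝ × E n => inner ℝ (V (p w.2 + w.1 • q w.2)) (q w.2))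
    (by fun_prop : Continuous _).continuousOn
  refine (hasDerivAt_integral_of_dominated_loc_of_deriv_le (s := Metric.ball t₀ 1)
    (bound := fun z => ‖φ z‖ * M)
    (F' := fun t z => φ z * inner ℝ (V (p z + t • q z)) (q z)) (Metric.ball_mem_nhds t₀ one_pos)
    (Filter.Eventually.of_forall fun t => (by fun_prop : Continuous _).aestronglyMeasurable)
    (integrable_mul_of_hasCompactSupport hφ hc (by fun_prop))
    (by fun_prop : Continuous _).aestronglyMeasurable
    (Filter.Eventually.of_forall fun z t ht => ?_)
    ((hφ.norm.integrable_of_hasCompactSupport hc.norm).mul_const M)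
    (Filter.Eventually.of_forall fun z t _ => ?_)).2
  · rw [norm_mul]
    by_cases hz : φ z = 0
    · simp [hz]
    · gcongr
      exact hM (t, z) ⟨Metric.ball_subset_closedBall ht, subset_tsupport _ hz⟩
  · refine HasDerivAt.const_mul _ ?_
    have h1 : HasDerivAt (fun t : ℝ => p z + t • q z) (q z) t := by
      simpa using ((hasDerivAt_id t).smul_const (q z)).const_add (p z)
    have h2 := (hh (p z + t • q z)).comp_hasDerivAt t h1
    simpa [Function.comp_def] using h2

theorem integral_comp_add_smul (F : E n → ℝ) (x : E n) (ρ : ℝ) :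
    ∫ z, F (x + ρ • z) = |(ρ ^ n)⁻¹| * ∫ y, F y := by
  have h := Measure.integral_comp_smul (volume : Measure (E n)) (fun y => F (x + y)) ρ
  rw [h, integral_add_left_eq_self F x, finrank_euclideanSpace_fin, smul_eq_mul]

theorem IsWeakNegLap.integral_comp_add_smul {h g : E n → ℝ} {V : E n → E n}
    (H : IsWeakNegLap h V g) {Ψ : E n → ℝ} (hΨ : ContDiff ℝ 1 Ψ) (hc : HasCompactSupport Ψ)
    (x : E n) {ρ : ℝ} (hρ : ρ ≠ 0) :
    ∫ z, fderiv ℝ Ψ z (V (x + ρ • z)) = ρ * ∫ z, Ψ z * g (x + ρ • z) := by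
  have hA : ContDiff ℝ 1 fun y : E n => ρ⁻¹ • (y - x) := by fun_prop
  set Θ : E n → ℝ := fun y => Ψ (ρ⁻¹ • (y - x)) with hΘ
  have hΘc : HasCompactSupport Θ := by
    have h1 : HasCompactSupport fun y : E n => Ψ (ρ⁻¹ • y) :=
      hc.comp_homeomorph (Homeomorph.smulOfNeZero (α := E n) ρ⁻¹ (inv_ne_zero hρ))
    exact h1.comp_homeomorph (Homeomorph.subRight x)
  have hd : ∀ y, fderiv ℝ Θ y (V y) = ρ⁻¹ * fderiv ℝ Ψ (ρ⁻¹ • (y - x)) (V y) := by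
    intro y
    have h1 : HasFDerivAt (fun y : E n => ρ⁻¹ • (y - x)) (ρ⁻¹ • ContinuousLinearMap.id ℝ (E n)) y :=
      ((hasFDerivAt_id y).sub_const x).const_smul ρ⁻¹
    have h2 := (hΨ.differentiable one_ne_zero (ρ⁻¹ • (y - x))).hasFDerivAt.comp y h1
    have h3 : fderiv ℝ Θ y = _ := h2.fderiv
    rw [h3]
    simp
  have hz : ∀ z : E n, ρ⁻¹ • (x + ρ • z - x) = z := fun z => by
    rw [add_sub_cancel_left, smul_smul, inv_mul_cancel₀ hρ, one_smul]
  have h4 := congrArg (fun t => |(ρ ^ n)⁻¹| * t) (H.integral_eq Θ (hΨ.comp hA) hΘc)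
  simp only [← ConformalMass.integral_comp_add_smul _ x ρ, hd] at h4
  simp only [hΘ, hz, integral_const_mul] at h4
  rw [← h4, ← mul_assoc, mul_inv_cancel₀ hρ, one_mul]

section
variable {G : ℝ → ℝ} {b : ℝ}

theorem hasCompactSupport_comp_norm_sq (hb : ∀ t, b ≤ t → G t = 0) :
    HasCompactSupport fun z : E n => G (‖z‖ ^ 2) := by
  refine HasCompactSupport.of_support_subset_isCompact (isCompact_closedBall 0 (|b| + 1))
    fun z hz => ?_
  by_contra hz'
  refine hz (hb _ ?_)
  have h1 : |b| + 1 < ‖z‖ := by simpa using hz'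
  nlinarith [le_abs_self b, abs_nonneg b]

/-- The radial primitive `½ ∫_{t}^{b} G`. -/
def radialPrimitive (G : ℝ → ℝ) (b t : ℝ) : ℝ := -(1 / 2) * ∫ s in b..t, G s

theorem hasDerivAt_radialPrimitive (hG : Continuous G) (b t : ℝ) :
    HasDerivAt (radialPrimitive G b) (-(1 / 2) * G t) t :=
  (intervalIntegral.integral_hasDerivAt_right (hG.intervalIntegrable _ _)
    hG.aestronglyMeasurable.stronglyMeasurableAtFilter hG.continuousAt).const_mul _

theorem radialPrimitive_eq_zero (hb : ∀ t, b ≤ t → G t = 0) (t : ℝ) (ht : b ≤ t) :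
    radialPrimitive G b t = 0 := by
  rw [radialPrimitive, intervalIntegral.integral_zero_ae, mul_zero]
  refine Filter.Eventually.of_forall fun s hs => hb s ?_
  rw [Set.uIoc_of_le ht] at hs
  exact hs.1.le

theorem continuous_radialPrimitive (hG : Continuous G) : Continuous (radialPrimitive G b) :=
  continuous_iff_continuousAt.2 fun t => (hasDerivAt_radialPrimitive hG b t).continuousAt

theorem hasFDerivAt_comp_norm_sq {A : ℝ → ℝ} {a : ℝ} {z : E n}
    (hA : HasDerivAt A a (‖z‖ ^ 2)) :
    HasFDerivAt (fun z : E n => A (‖z‖ ^ 2)) ((2 * a) • innerSL ℝ z) z := by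
  have h := hA.comp_hasFDerivAt z (hasStrictFDerivAt_norm_sq z).hasFDerivAt
  refine h.congr_fderiv ?_
  ext v
  simp
  ring

theorem contDiff_comp_norm_sq {A a : ℝ → ℝ} (hA : ∀ t, HasDerivAt A (a t) t)
    (ha : Continuous a) : ContDiff ℝ 1 fun z : E n => A (‖z‖ ^ 2) := by
  have h1 : ContDiff ℝ 1 A := by
    rw [contDiff_one_iff_deriv]
    refine ⟨fun t => (hA t).differentiableAt, ?_⟩
    rwa [show deriv A = a from funext fun t => (hA t).deriv]
  exact h1.comp (contDiff_norm_sq ℝ)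

/-- The field `G(|z|²) z` is minus the gradient of the radial primitive evaluated at `|z|²`, so the
scale derivative of the average can be integrated by parts against the weak equation. -/
theorem IsWeakNegLap.hasDerivAt_radial {h g : E n → ℝ} {V : E n → E n}
    (H : IsWeakNegLap h V g) (hG : Continuous G) (hb : ∀ t, b ≤ t → G t = 0) (x : E n) (ρ : ℝ) :
    HasDerivAt (fun ρ : ℝ => ∫ z, G (‖z‖ ^ 2) * h (x + ρ • z))
      (-ρ * ∫ z, radialPrimitive G b (‖z‖ ^ 2) * g (x + ρ • z)) ρ := by
  have h1 := hasDerivAt_integral_mul_comp_affine (φ := fun z : E n => G (‖z‖ ^ 2))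
    (p := fun _ => x) (q := fun z => z) (by fun_prop) (hasCompactSupport_comp_norm_sq hb)
    H.hasFDerivAt H.continuous_grad continuous_const continuous_id ρ
  convert h1 using 1
  rcases eq_or_ne ρ 0 with rfl | hρ
  -- At scale zero the rescaled weak equation is not available, but the integrand is odd.
  · have h2 := integral_neg_eq_self (fun z : E n => G (‖z‖ ^ 2) * inner ℝ (V x) z) volume
    simp only [norm_neg, inner_neg_right, mul_neg, integral_neg] at h2
    simp only [zero_smul, add_zero, neg_zero, zero_mul]
    linarith
  · have h2 := H.integral_comp_add_smul
      (contDiff_comp_norm_sq (hasDerivAt_radialPrimitive hG b) (by fun_prop))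
      (hasCompactSupport_comp_norm_sq (radialPrimitive_eq_zero hb)) x hρ
    rw [neg_mul, ← h2, ← integral_neg]
    congr 1; ext z
    rw [(hasFDerivAt_comp_norm_sq (hasDerivAt_radialPrimitive hG b _)).fderiv]
    simp [real_inner_comm]

end

theorem exists_polynomial_derivative_eq (q : Polynomial ℝ) :
    ∃ p : Polynomial ℝ, Polynomial.derivative p = q := by
  induction q using Polynomial.induction_on' with
  | add p q hp hq =>
    obtain ⟨p', rfl⟩ := hp
    obtain ⟨q', rfl⟩ := hq
    exact ⟨p' + q', Polynomial.derivative_add⟩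
  | monomial k a =>
    refine ⟨Polynomial.monomial (k + 1) (a / (k + 1)), ?_⟩
    rw [Polynomial.derivative_monomial]
    congr 1
    push_cast
    field_simp

theorem IsWeakPolyLap.succ {m : ℕ} {h g : E n → ℝ} (H : IsWeakPolyLap (m + 1) h g) :
    ∃ V h', IsWeakNegLap h V h' ∧ IsWeakPolyLap m h' g := by
  obtain ⟨A, V, rfl, rfl, hA⟩ := H
  exact ⟨V 0, A 1, hA 0 (by omega), fun j => A (j + 1), fun j => V (j + 1), rfl, rfl,
    fun j hj => hA (j + 1) (by omega)⟩

/-- Radial averages of a weakly polyharmonic function are polynomial in the scale. -/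
theorem IsWeakPolyLap.exists_polynomial {m : ℕ} {h : E n → ℝ}
    (H : IsWeakPolyLap m h (fun _ => 0)) {G : ℝ → ℝ} {b : ℝ} (hG : Continuous G)
    (hb : ∀ t, b ≤ t → G t = 0) (x : E n) :
    ∃ p : Polynomial ℝ, ∀ ρ : ℝ, ∫ z, G (‖z‖ ^ 2) * h (x + ρ • z) = p.eval ρ := by
  induction m generalizing h G with
  | zero =>
    obtain ⟨A, V, rfl, h0, -⟩ := H
    exact ⟨0, fun ρ => by simp [h0]⟩
  | succ m ih =>
    obtain ⟨V, g, hg, hm⟩ := H.succ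
    obtain ⟨q, hq⟩ := ih hm (continuous_radialPrimitive hG) (radialPrimitive_eq_zero hb)
    obtain ⟨p, hp⟩ := exists_polynomial_derivative_eq (-Polynomial.X * q)
    -- The derivative of this average is `-ρ` times an average of the next function in the chain,
    -- with the primitive of `G` as weight. This is why the induction must allow `G` to vary.
    set P : ℝ → ℝ := fun ρ => ∫ z, G (‖z‖ ^ 2) * h (x + ρ • z) with hP
    have hd : ∀ ρ, HasDerivAt (fun ρ => P ρ - p.eval ρ) 0 ρ := by
      intro ρ
      have h1 := (hg.hasDerivAt_radial hG hb x ρ).sub (p.hasDerivAt ρ)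
      rw [hq ρ, hp] at h1
      exact h1.congr_deriv (by simp)
    refine ⟨p + Polynomial.C (P 0 - p.eval 0), fun ρ => ?_⟩
    have h2 := is_const_of_deriv_eq_zero (fun ρ => (hd ρ).differentiableAt)
      (fun ρ => (hd ρ).deriv) ρ 0
    simp only [Polynomial.eval_add, Polynomial.eval_C]
    change P ρ = _
    linarith

/-! ### The scalar curvature of a conformally flat metric -/

theorem inv_conformalMetric (u : E n → ℝ) (x : E n) :
    (conformalMetric u x)⁻¹ = Real.exp (-(2 * u x)) • (1 : Matrix (Fin n) (Fin n) ℝ) := by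
  refine Matrix.inv_eq_right_inv ?_
  rw [conformalMetric, Matrix.smul_mul, Matrix.mul_smul, one_mul, smul_smul, ← Real.exp_add]
  simp

theorem conformalMetric_apply (u : E n → ℝ) (x : E n) (i j : Fin n) :
    conformalMetric u x i j = (if i = j then 1 else 0) * Real.exp (2 * u x) := by
  simp [conformalMetric, Matrix.one_apply]

theorem partialDeriv_const_mul_exp {u : E n → ℝ} (hu : Differentiable ℝ u) (c : ℝ) (i : Fin n)
    (x : E n) : partialDeriv i (fun y => c * Real.exp (2 * u y)) x
      = 2 * c * Real.exp (2 * u x) * partialDeriv i u x := by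
  unfold partialDeriv
  rw [(((hu x).hasFDerivAt.const_mul 2).exp.const_mul c).fderiv]
  simp
  ring

theorem partialDeriv_lin_comb {f₁ f₂ f₃ : E n → ℝ} (h₁ : Differentiable ℝ f₁)
    (h₂ : Differentiable ℝ f₂) (h₃ : Differentiable ℝ f₃) (c₁ c₂ c₃ : ℝ) (i : Fin n) (x : E n) :
    partialDeriv i (fun y => c₁ * f₁ y + c₂ * f₂ y - c₃ * f₃ y) x
      = c₁ * partialDeriv i f₁ x + c₂ * partialDeriv i f₂ x - c₃ * partialDeriv i f₃ x := by
  unfold partialDeriv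
  have h := (((h₁ x).hasFDerivAt.const_mul c₁).add ((h₂ x).hasFDerivAt.const_mul c₂)).sub
    ((h₃ x).hasFDerivAt.const_mul c₃)
  have h' : fderiv ℝ (fun y => c₁ * f₁ y + c₂ * f₂ y - c₃ * f₃ y) x = _ := h.fderiv
  rw [h']
  simp

theorem christoffel_conformalMetric {u : E n → ℝ} (hu : Differentiable ℝ u) (k i j : Fin n) :
    christoffel (conformalMetric u) k i j = fun x =>
      (if j = k then 1 else 0) * partialDeriv i u x + (if i = k then 1 else 0) * partialDeriv j u x
        - (if i = j then 1 else 0) * partialDeriv k u x := by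
  ext x
  have he : Real.exp (-(2 * u x)) * Real.exp (2 * u x) = 1 := by rw [← Real.exp_add]; simp
  simp only [christoffel, inv_conformalMetric, conformalMetric_apply,
    partialDeriv_const_mul_exp hu, Matrix.smul_apply, Matrix.one_apply, smul_eq_mul]
  rw [Finset.sum_eq_single k (fun l _ hl => by simp [hl.symm]) (by simp)]
  simp only [if_true]
  linear_combination ((if j = k then 1 else 0) * partialDeriv i u x
    + (if i = k then 1 else 0) * partialDeriv j u x
    - (if i = j then 1 else 0) * partialDeriv k u x) * he

theorem partialDeriv_christoffel_conformalMetric {u : E n → ℝ} (hu : ContDiff ℝ ∞ u)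
    (m k i j : Fin n) (x : E n) :
    partialDeriv m (christoffel (conformalMetric u) k i j) x =
      (if j = k then 1 else 0) * partialDeriv m (partialDeriv i u) x
      + (if i = k then 1 else 0) * partialDeriv m (partialDeriv j u) x
        - (if i = j then 1 else 0) * partialDeriv m (partialDeriv k u) x := by
  have hd : ∀ i, Differentiable ℝ (partialDeriv i u) := fun i =>
    (contDiff_partialDeriv hu i).differentiable (by simp)
  rw [christoffel_conformalMetric (hu.differentiable (by simp)),
    partialDeriv_lin_comb (hd i) (hd j) (hd k)]

theorem norm_gradient_sq (u : E n → ℝ) (x : E n) :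
    ‖gradient u x‖ ^ 2 = ∑ i, partialDeriv i u x ^ 2 := by
  rw [EuclideanSpace.norm_sq_eq]
  simp [gradient_apply]

/-- The Euclidean trace of the Ricci tensor with `a = ∇u` and `H = ∇²u`, isolated as pure algebra.
The trace leaves only diagonal entries of `H`, so symmetry is not needed. -/
theorem sum_conformal_ricci_trace (a : Fin n → ℝ) (H : Fin n → Fin n → ℝ) :
    ∑ j, ∑ i, (((if j = i then 1 else 0) * H i j + (if j = i then 1 else 0) * H i j
    - (if j = j then 1 else 0) * H i i) - ((if j = i then 1 else 0) * H j i +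
      (if i = i then 1 else 0) * H j j - (if i = j then 1 else 0) * H j i)
    + ∑ p, (((if p = i then 1 else 0) * a i + (if i = i then 1 else 0) * a p
      - (if i = p then 1 else 0) * a i) * ((if j = p then 1 else 0) * a j
      + (if j = p then 1 else 0) * a j - (if j = j then 1 else 0) * a p)
      - ((if p = i then 1 else 0) * a j + (if j = i then 1 else 0) * a p
        - (if j = p then 1 else 0) * a i) * ((if j = p then 1 else 0) * a i
        + (if i = p then 1 else 0) * a j - (if i = j then 1 else 0) * a p)))
      = -2 * (n - 1) * ∑ i, H i i - (n - 1) * (n - 2) * ∑ i, a i ^ 2 := by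
  -- Products of Kronecker deltas are rewritten as single or nested conditionals, which the sum
  -- lemmas can collapse.
  have e1 : ∀ i j p : Fin n, (((if p = i then 1 else 0) * a i + (if i = i then 1 else 0) * a p
      - (if i = p then 1 else 0) * a i) * ((if j = p then 1 else 0) * a j
      + (if j = p then 1 else 0) * a j - (if j = j then 1 else 0) * a p)
      - ((if p = i then 1 else 0) * a j + (if j = i then 1 else 0) * a p
        - (if j = p then 1 else 0) * a i) * ((if j = p then 1 else 0) * a i
        + (if i = p then 1 else 0) * a j - (if i = j then 1 else 0) * a p))
      = (if j = p then 2 * a p ^ 2 else 0) - a p ^ 2 - (if i = p then a j ^ 2 else 0)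
        + (if j = i then a p ^ 2 else 0) + (if j = p then a i ^ 2 else 0)
        - (if j = i then (if j = p then 2 * a p ^ 2 else 0) else 0) := by
    intro i j p
    by_cases h1 : i = p <;> by_cases h2 : j = p <;> by_cases h3 : i = j <;>
      simp_all [eq_comm] <;> ring
  have e2 : ∀ i j : Fin n, (((if j = i then 1 else 0) * H i j + (if j = i then 1 else 0) * H i j
    - (if j = j then 1 else 0) * H i i) - ((if j = i then 1 else 0) * H j i +
      (if i = i then 1 else 0) * H j j - (if i = j then 1 else 0) * H j i))
      = (if j = i then 2 * H i i else 0) - H i i - H j j := by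
    intro i j
    by_cases h : i = j <;> simp_all [eq_comm] <;> ring
  trans ∑ j : Fin n, ∑ i : Fin n, (((if j = i then 2 * H i i else 0) - H i i - H j j) + ∑ p : Fin n,
      ((if j = p then 2 * a p ^ 2 else 0) - a p ^ 2 - (if i = p then a j ^ 2 else 0)
        + (if j = i then a p ^ 2 else 0) + (if j = p then a i ^ 2 else 0)
        - (if j = i then (if j = p then 2 * a p ^ 2 else 0) else 0)))
  · refine Finset.sum_congr rfl fun j _ => Finset.sum_congr rfl fun i _ => ?_
    rw [e2 i j]
    congr 1
    exact Finset.sum_congr rfl fun p _ => e1 i j p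
  simp only [Finset.sum_add_distrib, Finset.sum_sub_distrib, Finset.sum_ite_eq,
    Finset.mem_univ, if_true, Finset.sum_const, Finset.card_univ, Fintype.card_fin, nsmul_eq_mul,
    ← Finset.mul_sum]
  have e3 : ∀ j : Fin n, ∑ i, ∑ p, (if j = i then a p ^ 2 else 0) = ∑ p, a p ^ 2 := by
    intro j
    rw [Finset.sum_comm]
    simp
  have e4 : ∀ j : Fin n, ∑ i, ∑ p, (if j = i then (if j = p then 2 * a p ^ 2 else 0)
      else 0) = 2 * a j ^ 2 := by
    intro j
    rw [Finset.sum_comm]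
    simp
  simp only [e3, e4, ← Finset.mul_sum, Finset.sum_const, Finset.card_univ, Fintype.card_fin, nsmul_eq_mul]
  ring

/-- `R e^{2u} = -2(n-1) Δu - (n-1)(n-2) |∇u|²` for the metric `e^{2u} |dx|²`. -/
theorem scalarCurvature_conformalMetric {u : E n → ℝ} (hu : ContDiff ℝ ∞ u) (x : E n) :
    scalarCurvature (conformalMetric u) x * Real.exp (2 * u x)
      = -2 * (n - 1) * Laplacian.laplacian u x - (n - 1) * (n - 2) * ‖gradient u x‖ ^ 2 := by
  have he : Real.exp (-(2 * u x)) * Real.exp (2 * u x) = 1 := by rw [← Real.exp_add]; simp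
  have h1 : scalarCurvature (conformalMetric u) x * Real.exp (2 * u x)
      = ∑ j, ricci (conformalMetric u) j j x := by
    rw [scalarCurvature, Finset.sum_mul]
    refine Finset.sum_congr rfl fun j _ => ?_
    rw [inv_conformalMetric, Finset.sum_eq_single j (fun l _ hl => by simp [hl.symm]) (by simp)]
    simp only [Matrix.smul_apply, Matrix.one_apply_eq, smul_eq_mul, mul_one]
    linear_combination ricci (conformalMetric u) j j x * he
  rw [h1, norm_gradient_sq, laplacian_eq_sum_partialDeriv (contDiff_two_of_infty hu)]
  set a : Fin n → ℝ := fun i => partialDeriv i u x with ha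
  set H : Fin n → Fin n → ℝ := fun i j => partialDeriv i (partialDeriv j u) x with hH
  have hR : ∀ j, ricci (conformalMetric u) j j x = ∑ i, (((if j = i then 1 else 0) * H i j + (if j = i then 1 else 0) * H i j
    - (if j = j then 1 else 0) * H i i) - ((if j = i then 1 else 0) * H j i +
      (if i = i then 1 else 0) * H j j - (if i = j then 1 else 0) * H j i)
    + ∑ p, (((if p = i then 1 else 0) * a i + (if i = i then 1 else 0) * a p
      - (if i = p then 1 else 0) * a i) * ((if j = p then 1 else 0) * a j
      + (if j = p then 1 else 0) * a j - (if j = j then 1 else 0) * a p)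
      - ((if p = i then 1 else 0) * a j + (if j = i then 1 else 0) * a p
        - (if j = p then 1 else 0) * a i) * ((if j = p then 1 else 0) * a i
        + (if i = p then 1 else 0) * a j - (if i = j then 1 else 0) * a p))) := by
    intro j
    refine Finset.sum_congr rfl fun i _ => ?_
    rw [partialDeriv_christoffel_conformalMetric hu, partialDeriv_christoffel_conformalMetric hu]
    congr 1
    refine Finset.sum_congr rfl fun p _ => ?_
    simp only [christoffel_conformalMetric (hu.differentiable (by simp : (∞ : WithTop ℕ∞) ≠ 0)), ha]
  refine (Finset.sum_congr rfl fun j _ => hR j).trans ?_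
  exact sum_conformal_ricci_trace a H

/-! ### Averages of potentials over large spheres -/

/-- With `d = ‖θ - y‖`, moving outwards by at most `d` keeps the distance to `y` below `2d`, so the
ray integral is at least `d (2d)⁻³ = d⁻² / 8`. -/
theorem ofReal_inv_sq_le_lintegral_ray {y θ : E n} (hθ : ‖θ‖ = 1) :
    ENNReal.ofReal ((‖θ - y‖ ^ 2)⁻¹) ≤ 8 * ∫⁻ r in Set.Ioo (1 : ℝ) (1 + ‖θ - y‖),
      ENNReal.ofReal ((‖r • θ - y‖ ^ 3)⁻¹) := by
  set d := ‖θ - y‖ with hd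
  rcases eq_or_lt_of_le (norm_nonneg (θ - y)) with h0 | h0
  · rw [← hd] at h0; simp [← h0]
  rw [← hd] at h0
  have h1 : ∀ r ∈ Set.Ioo (1 : ℝ) (1 + d),
      ENNReal.ofReal (((2 * d) ^ 3)⁻¹) ≤ ENNReal.ofReal ((‖r • θ - y‖ ^ 3)⁻¹) := by
    intro r hr
    have e : r • θ - y = (θ - y) + (r - 1) • θ := by rw [sub_smul, one_smul]; abel
    have h2 : ‖(r - 1) • θ‖ = r - 1 := by
      rw [norm_smul, hθ, mul_one, Real.norm_of_nonneg (by linarith [hr.1])]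
    have h3 : ‖r • θ - y‖ ≤ d + (r - 1) := by
      have := norm_add_le (θ - y) ((r - 1) • θ)
      rwa [← e, h2] at this
    have h4 : d - (r - 1) ≤ ‖r • θ - y‖ := by
      have := norm_sub_le_norm_add (θ - y) ((r - 1) • θ)
      rwa [← e, h2] at this
    have h5 : 0 < ‖r • θ - y‖ := by linarith [hr.2]
    apply ENNReal.ofReal_le_ofReal
    gcongr
    linarith [hr.2]
  have h6 : ∫⁻ r in Set.Ioo (1 : ℝ) (1 + d), ENNReal.ofReal (((2 * d) ^ 3)⁻¹)
      ≤ ∫⁻ r in Set.Ioo (1 : ℝ) (1 + d), ENNReal.ofReal ((‖r • θ - y‖ ^ 3)⁻¹) :=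
    setLIntegral_mono' measurableSet_Ioo h1
  refine le_trans ?_ (mul_le_mul_right h6 8)
  rw [setLIntegral_const, Real.volume_Ioo, show (8 : ENNReal) = ENNReal.ofReal 8 by norm_num,
    ← ENNReal.ofReal_mul (by positivity), ← ENNReal.ofReal_mul (by positivity)]
  apply ENNReal.ofReal_le_ofReal
  rw [add_sub_cancel_left]
  apply le_of_eq
  field_simp
  norm_num

/-- The ray estimate trades an inverse square on the sphere for an inverse cube in space, which is
locally integrable since `n ≥ 4`. For `‖y‖ ≥ 2` the kernel is at most one. -/
theorem exists_lintegral_sphere_inv_norm_sub_sq_le (hn : 4 ≤ n) :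
    ∃ C : ℝ, 0 ≤ C ∧ ∀ y : E n,
      ∫⁻ θ : Metric.sphere (0 : E n) 1, ENNReal.ofReal ((‖(θ : E n) - y‖ ^ 2)⁻¹)
        ∂(unitSphereMeasure n) ≤ ENNReal.ofReal C := by
  have : NeZero n := ⟨by omega⟩
  obtain ⟨C, hC0, hC⟩ := exists_lintegral_inv_norm_sub_pow_le (n := n) (b := 3) (by omega) 5
  refine ⟨8 * C + (unitSphereMeasure n).real Set.univ, by positivity, fun y => ?_⟩
  rw [ENNReal.ofReal_add (by positivity) (by positivity)]
  by_cases hy : ‖y‖ < 2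
  · refine le_trans ?_ le_self_add
    rw [ENNReal.ofReal_mul (by norm_num), show ENNReal.ofReal 8 = 8 by norm_num]
    refine le_trans ?_ (mul_le_mul_right (hC 0 y) 8)
    rw [← lintegral_indicator measurableSet_ball, lintegral_polar
      (Measurable.indicator (by fun_prop) measurableSet_ball), ← lintegral_const_mul' _ _ (by norm_num)]
    refine lintegral_mono fun θ => ?_
    have hθ : ‖(θ : E n)‖ = 1 := by simp
    refine (ofReal_inv_sq_le_lintegral_ray hθ).trans (mul_le_mul_right ?_ 8)
    have hd : ‖(θ : E n) - y‖ < 3 := by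
      have := norm_sub_le (θ : E n) y
      rw [hθ] at this
      linarith
    have hsub : Set.Ioo (1 : ℝ) (1 + ‖(θ : E n) - y‖) ⊆ Set.Ioi 0 := fun r hr =>
      lt_trans one_pos hr.1
    refine le_trans ?_ (lintegral_mono_set hsub)
    refine setLIntegral_mono' measurableSet_Ioo fun r hr => ?_
    have hr0 : (0 : ℝ) < r := lt_trans one_pos hr.1
    have hmem : r • (θ : E n) ∈ Metric.ball (0 : E n) 5 := by
      rw [mem_ball_zero_iff, norm_smul, hθ, mul_one, Real.norm_of_nonneg hr0.le]
      linarith [hr.2]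
    rw [Set.indicator_of_mem hmem]
    -- The rays start at radius one, so the polar Jacobian is at least one and can be dropped.
    refine le_mul_of_one_le_left (zero_le) ?_
    rw [← ENNReal.ofReal_one]
    exact ENNReal.ofReal_le_ofReal (one_le_pow₀ hr.1.le)
  · refine le_trans ?_ le_add_self
    rw [measureReal_def, ENNReal.ofReal_toReal (measure_ne_top _ _), ← one_mul
      ((unitSphereMeasure n) Set.univ), ← lintegral_const]
    refine lintegral_mono fun θ => ?_
    rw [← ENNReal.ofReal_one]
    apply ENNReal.ofReal_le_ofReal
    have hθ : ‖(θ : E n)‖ = 1 := by simp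
    have h1 : 1 ≤ ‖(θ : E n) - y‖ := by
      have := norm_sub_norm_le y (θ : E n)
      rw [hθ, norm_sub_rev] at this
      linarith [not_lt.1 hy]
    exact inv_le_one_of_one_le₀ (one_le_pow₀ h1)

section
variable {f : E n → ℝ} {K : E n → E n → ℝ} {M k : ℝ}

theorem exists_lintegral_sphere_kernel_le (hn : 4 ≤ n)
    (hM : ∀ θ w, ‖θ‖ = 1 → |K θ w| ≤ M * (1 + (‖θ - w‖ ^ 2)⁻¹)) :
    ∃ C : ℝ, 0 ≤ C ∧ ∀ w, ∫⁻ θ : Metric.sphere (0 : E n) 1, ENNReal.ofReal |K θ w|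
      ∂(unitSphereMeasure n) ≤ ENNReal.ofReal C := by
  obtain ⟨C, hC0, hC⟩ := exists_lintegral_sphere_inv_norm_sub_sq_le hn
  refine ⟨|M| * ((unitSphereMeasure n).real Set.univ + C), by positivity, fun w => ?_⟩
  calc ∫⁻ θ : Metric.sphere (0 : E n) 1, ENNReal.ofReal |K θ w| ∂(unitSphereMeasure n)
      ≤ ∫⁻ θ : Metric.sphere (0 : E n) 1, ENNReal.ofReal |M| * (1 +
          ENNReal.ofReal ((‖(θ : E n) - w‖ ^ 2)⁻¹)) ∂(unitSphereMeasure n) := by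
        refine lintegral_mono fun θ => ?_
        rw [← ENNReal.ofReal_one, ← ENNReal.ofReal_add one_pos.le (by positivity),
          ← ENNReal.ofReal_mul (abs_nonneg M)]
        apply ENNReal.ofReal_le_ofReal
        refine (hM θ w (by simp)).trans ?_
        gcongr
        exact le_abs_self M
    _ ≤ ENNReal.ofReal |M| * ((unitSphereMeasure n) Set.univ + ENNReal.ofReal C) := by
        rw [lintegral_const_mul' _ _ ENNReal.ofReal_ne_top]
        gcongr
        rw [lintegral_add_left measurable_const, lintegral_one]
        gcongr
        exact hC w
    _ = _ := by
        rw [ENNReal.ofReal_mul (abs_nonneg M), ENNReal.ofReal_add (by positivity) hC0,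
          measureReal_def, ENNReal.ofReal_toReal (measure_ne_top _ _)]

theorem measurable_sphere_kernel (hK : Measurable (Function.uncurry K)) {X : Type*}
    [MeasurableSpace X] {p q : X → E n} (hp : Measurable p) (hq : Measurable q) :
    Measurable fun t => K (p t) (q t) :=
  hK.comp (hp.prodMk hq)

theorem integrable_sphere_kernel_prod (hn : 4 ≤ n) (hi : Integrable f)
    (hK : Measurable (Function.uncurry K)) (hM : ∀ θ w, ‖θ‖ = 1 → |K θ w| ≤ M * (1 + (‖θ - w‖ ^ 2)⁻¹))
    (x : E n) (r : ℝ) :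
    Integrable (fun p : Metric.sphere (0 : E n) 1 × E n => f p.2 * K p.1 (r⁻¹ • (p.2 - x)))
      ((unitSphereMeasure n).prod volume) := by
  obtain ⟨C, hC0, hC⟩ := exists_lintegral_sphere_kernel_le hn hM
  have hKm : Measurable fun p : Metric.sphere (0 : E n) 1 × E n =>
      K p.1 (r⁻¹ • (p.2 - x)) :=
    measurable_sphere_kernel hK (by fun_prop) (by fun_prop)
  have hfm : AEStronglyMeasurable (fun p : Metric.sphere (0 : E n) 1 × E n => f p.2)
      ((unitSphereMeasure n).prod volume) := hi.aestronglyMeasurable.comp_snd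
  have hm : AEStronglyMeasurable (fun p : Metric.sphere (0 : E n) 1 × E n =>
      f p.2 * K p.1 (r⁻¹ • (p.2 - x))) ((unitSphereMeasure n).prod volume) :=
    hfm.mul hKm.aestronglyMeasurable
  refine ⟨hm, ?_⟩
  rw [hasFiniteIntegral_iff_norm, lintegral_prod_symm _ hm.norm.aemeasurable.ennreal_ofReal]
  calc _ ≤ ∫⁻ y, ENNReal.ofReal ‖f y‖ * ENNReal.ofReal C := by
        refine lintegral_mono fun y => ?_
        simp only [norm_mul, ENNReal.ofReal_mul (norm_nonneg _)]
        rw [lintegral_const_mul' _ _ ENNReal.ofReal_ne_top]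
        gcongr
        exact hC _
    _ < ⊤ := by
        rw [lintegral_mul_const' _ _ ENNReal.ofReal_ne_top]
        exact ENNReal.mul_lt_top ((hasFiniteIntegral_iff_norm _).1 hi.2) ENNReal.ofReal_lt_top

theorem abs_integral_sphere_kernel_le {C : ℝ} (hC0 : 0 ≤ C) {w : E n}
    (hC : ∫⁻ θ : Metric.sphere (0 : E n) 1, ENNReal.ofReal |K θ w|
      ∂(unitSphereMeasure n) ≤ ENNReal.ofReal C) :
    |∫ θ : Metric.sphere (0 : E n) 1, K θ w ∂(unitSphereMeasure n)| ≤ C := by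
  have h := norm_integral_le_lintegral_norm
    (fun θ : Metric.sphere (0 : E n) 1 => K θ w) (μ := unitSphereMeasure n)
  refine h.trans ?_
  exact (ENNReal.toReal_mono ENNReal.ofReal_ne_top hC).trans (ENNReal.toReal_ofReal hC0).le

theorem tendsto_integral_sphere_kernel_zero (hK : Measurable (Function.uncurry K))
    (hM : ∀ θ w, ‖θ‖ = 1 → |K θ w| ≤ M * (1 + (‖θ - w‖ ^ 2)⁻¹))
    (hk : ∀ θ, ‖θ‖ = 1 → Tendsto (K θ) (𝓝 0) (𝓝 k)) :
    Tendsto (fun w => ∫ θ : Metric.sphere (0 : E n) 1, K θ w ∂(unitSphereMeasure n)) (𝓝 0)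
      (𝓝 ((unitSphereMeasure n).real Set.univ * k)) := by
  have h := tendsto_integral_filter_of_dominated_convergence
    (μ := unitSphereMeasure n) (l := 𝓝 (0 : E n)) (F := fun w (θ : Metric.sphere (0 : E n) 1) => K θ w)
    (f := fun _ => k) (fun _ => |M| * 5)
    (Filter.Eventually.of_forall fun w => 
      (measurable_sphere_kernel hK (by fun_prop) (by fun_prop)).aestronglyMeasurable) ?_
    (integrable_const _) (Filter.Eventually.of_forall fun θ => hk θ (by simp))
  · simpa using h
  -- For `‖w‖ < 1/2` the inverse square is at most `4`, whence the bound `|M| (1 + 4)`.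
  · filter_upwards [Metric.ball_mem_nhds (0 : E n) (by norm_num : (0 : ℝ) < 1 / 2)] with w hw
    refine Filter.Eventually.of_forall fun θ => ?_
    have hθ : ‖(θ : E n)‖ = 1 := by simp
    have hw' : ‖w‖ < 1 / 2 := by simpa using hw
    have h1 : 1 / 2 ≤ ‖(θ : E n) - w‖ := by
      have := norm_sub_norm_le (θ : E n) w
      rw [hθ] at this
      linarith
    have h2 : (‖(θ : E n) - w‖ ^ 2)⁻¹ ≤ 4 := by
      rw [inv_le_comm₀ (by positivity) (by norm_num)]
      nlinarith
    refine (hM θ w (by simp)).trans ?_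
    refine mul_le_mul (le_abs_self M) (by linarith) (by positivity) (abs_nonneg M)

/-- Averages over large spheres of superpositions of kernels with an inverse square singularity. -/
theorem tendsto_integral_sphere_kernel (hn : 4 ≤ n) (hi : Integrable f)
    (hK : Measurable (Function.uncurry K)) (hM : ∀ θ w, ‖θ‖ = 1 → |K θ w| ≤ M * (1 + (‖θ - w‖ ^ 2)⁻¹))
    (hk : ∀ θ, ‖θ‖ = 1 → Tendsto (K θ) (𝓝 0) (𝓝 k)) (x : E n) :
    Tendsto (fun r : ℝ => ∫ θ : Metric.sphere (0 : E n) 1, ∫ y, f y * K θ (r⁻¹ • (y - x))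
      ∂volume ∂(unitSphereMeasure n)) atTop
      (𝓝 ((∫ y, f y) * ((unitSphereMeasure n).real Set.univ * k))) := by
  obtain ⟨C, hC0, hC⟩ := exists_lintegral_sphere_kernel_le hn hM
  set A : E n → ℝ := fun w => ∫ θ : Metric.sphere (0 : E n) 1, K θ w ∂(unitSphereMeasure n) with hA
  -- Integrating over the sphere first gives a function of `y` that is bounded uniformly in `r`, so
  -- dominated convergence applies even though the kernel is singular at points of the sphere.
  have hsw : ∀ r : ℝ, ∫ θ : Metric.sphere (0 : E n) 1, ∫ y, f y * K θ (r⁻¹ • (y - x))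
      ∂volume ∂(unitSphereMeasure n) = ∫ y, f y * A (r⁻¹ • (y - x)) := by
    intro r
    rw [integral_integral_swap (integrable_sphere_kernel_prod hn hi hK hM x r)]
    congr 1; ext y
    rw [integral_const_mul]
  simp only [hsw]
  have hAm : StronglyMeasurable A := by
    have h1 : Measurable fun p : E n × Metric.sphere (0 : E n) 1 => K p.2 p.1 :=
      measurable_sphere_kernel hK (by fun_prop) (by fun_prop)
    exact h1.stronglyMeasurable.integral_prod_right
  rw [← integral_mul_const]
  refine tendsto_integral_filter_of_dominated_convergence (fun y => ‖f y‖ * C)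
    (Filter.Eventually.of_forall fun r => hi.aestronglyMeasurable.mul
      (hAm.comp_measurable (by fun_prop)).aestronglyMeasurable)
    (Filter.Eventually.of_forall fun r => Filter.Eventually.of_forall fun y => ?_)
    (hi.norm.mul_const C) (Filter.Eventually.of_forall fun y => ?_)
  · rw [norm_mul]
    gcongr
    exact abs_integral_sphere_kernel_le hC0 (hC _)
  · refine Tendsto.const_mul _ ((tendsto_integral_sphere_kernel_zero hK hM hk).comp ?_)
    have := tendsto_inv_atTop_zero (𝕜 := ℝ) |>.smul_const (y - x)
    simpa using this

end

/-! ### Mean squares of the gradient of the logarithmic potential -/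

/-- Cauchy–Schwarz with weight `|f|`, from the discriminant of `t ↦ ∫ |f| (g - t)²`. It replaces the
square of a potential by a single potential with squared kernel, to which the sphere averages apply.
-/
theorem sq_integral_abs_mul_le {X : Type*} [MeasurableSpace X] {μ : Measure X} {f g : X → ℝ}
    (hf : Integrable f μ) (hfg : Integrable (fun y => |f y| * g y) μ)
    (hfg2 : Integrable (fun y => |f y| * g y ^ 2) μ) :
    (∫ y, |f y| * g y ∂μ) ^ 2 ≤ (∫ y, |f y| ∂μ) * ∫ y, |f y| * g y ^ 2 ∂μ := by
  have h : ∀ t : ℝ, 0 ≤ (∫ y, |f y| ∂μ) * (t * t) + (-2 * ∫ y, |f y| * g y ∂μ) * t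
      + ∫ y, |f y| * g y ^ 2 ∂μ := by
    intro t
    have h1 : 0 ≤ ∫ y, |f y| * (g y - t) ^ 2 ∂μ := integral_nonneg fun y => by positivity
    have h2 : ∫ y, |f y| * (g y - t) ^ 2 ∂μ = ∫ y, (|f y| * (t * t) + (-2 * (|f y| * g y)) * t
      + |f y| * g y ^ 2) ∂μ := by congr 1; ext y; ring
    have i1 : Integrable (fun y => |f y| * (t * t)) μ := hf.abs.mul_const _
    have i2 : Integrable (fun y => -2 * (|f y| * g y) * t) μ := (hfg.const_mul _).mul_const _
    have i3 : Integrable (fun y => |f y| * (t * t) + -2 * (|f y| * g y) * t) μ := i1.add i2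
    rw [h2, integral_add i3 hfg2, integral_add i1 i2, integral_mul_const,
      integral_mul_const, integral_const_mul] at h1
    exact h1
  have := discrim_le_zero h
  rw [discrim] at this
  linarith

/-- The difference between the rescaled kernel `(θ - w) / |θ - w|²` and its value at `w = 0`. -/
def kernelDefect (θ w : E n) : E n := radialKernel 2 (θ - w) - θ

theorem measurable_kernelDefect : Measurable (Function.uncurry (kernelDefect : E n → E n → E n)) := by
  have := measurable_radialKernel (n := n) 2
  unfold kernelDefect Function.uncurry
  fun_prop

theorem norm_kernelDefect_sq_le {θ w : E n} (hθ : ‖θ‖ = 1) :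
    ‖kernelDefect θ w‖ ^ 2 ≤ 2 * (1 + (‖θ - w‖ ^ 2)⁻¹) := by
  have h1 : ‖kernelDefect θ w‖ ≤ ‖θ - w‖⁻¹ + 1 := by
    refine (norm_sub_le _ _).trans ?_
    rw [hθ]
    gcongr
    simpa using norm_radialKernel_succ 1 (θ - w)
  rw [← inv_pow]
  nlinarith [norm_nonneg (kernelDefect θ w), sq_nonneg (‖θ - w‖⁻¹ - 1),
    pow_le_pow_left₀ (norm_nonneg _) h1 2]

theorem norm_kernelDefect_le {θ w : E n} (hθ : ‖θ‖ = 1) :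
    ‖kernelDefect θ w‖ ≤ 2 * (1 + (‖θ - w‖ ^ 2)⁻¹) := by
  have h1 := norm_kernelDefect_sq_le (w := w) hθ
  have h2 : 0 ≤ (‖θ - w‖ ^ 2)⁻¹ := by positivity
  nlinarith [norm_nonneg (kernelDefect θ w), sq_nonneg (‖kernelDefect θ w‖ - 1)]

theorem tendsto_kernelDefect {θ : E n} (hθ : ‖θ‖ = 1) :
    Tendsto (kernelDefect θ) (𝓝 0) (𝓝 0) := by
  have h0 : θ - 0 ≠ 0 := by
    rw [sub_zero, ← norm_ne_zero_iff, hθ]; norm_num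
  have h1 : ContinuousAt (fun w => radialKernel 2 (θ - w) - θ) 0 :=
    ((continuousAt_radialKernel 2 h0).comp (f := fun w : E n => θ - w) (by fun_prop)).sub
      continuousAt_const
  have h2 : ContinuousAt (kernelDefect θ) 0 := h1
  simpa [kernelDefect, radialKernel, hθ] using h2.tendsto

theorem sphere_point_sub {x y θ : E n} {r : ℝ} (hr : r ≠ 0) :
    x + r • θ - y = r • (θ - r⁻¹ • (y - x)) := by
  rw [smul_sub, smul_smul, mul_inv_cancel₀ hr, one_smul]; abel

theorem smul_radialKernel_two_smul {r : ℝ} (hr : r ≠ 0) (z : E n) :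
    r • radialKernel 2 (r • z) = radialKernel 2 z := by
  rw [radialKernel, radialKernel, norm_smul, smul_smul, smul_smul, mul_pow, Real.norm_eq_abs,
    sq_abs]
  congr 1
  field_simp

section
variable {f : E n → ℝ}

theorem tendsto_sphere_rieszPotential (hn : 4 ≤ n) (hi : Integrable f) (x : E n) :
    Tendsto (fun r : ℝ => r ^ 2 * ∫ θ : Metric.sphere (0 : E n) 1,
      rieszPotential f 2 (x + r • (θ : E n)) ∂(unitSphereMeasure n)) atTop
      (𝓝 ((unitSphereMeasure n).real Set.univ * ∫ y, f y)) := by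
  have h := tendsto_integral_sphere_kernel (K := fun θ w : E n => (‖θ - w‖ ^ 2)⁻¹) (M := 1) (k := 1)
    hn hi (by unfold Function.uncurry; fun_prop)
    (fun θ w _ => by rw [abs_of_nonneg (by positivity)]; linarith) (fun θ hθ => ?_) x
  · rw [mul_one, mul_comm] at h
    refine h.congr' ?_
    filter_upwards [eventually_gt_atTop 0] with r hr
    rw [← integral_const_mul]
    congr 1; ext θ
    rw [rieszPotential, ← integral_const_mul]
    congr 1; ext y
    rw [sphere_point_sub hr.ne', norm_smul, mul_pow, Real.norm_eq_abs, sq_abs]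
    field_simp
  · have h0 : ‖θ - 0‖ ^ 2 ≠ 0 := by rw [sub_zero, hθ]; norm_num
    have h1 : ContinuousAt (fun w : E n => (‖θ - w‖ ^ 2)⁻¹) 0 := by
      fun_prop (disch := assumption)
    simpa [hθ] using h1.tendsto

theorem vectorPotential_sphere_eq (hn : 4 ≤ n) (hf : Continuous f) (hi : Integrable f) (x : E n)
    {r : ℝ} (hr : 0 < r) (θ : E n) :
    Integrable (fun y => f y • kernelDefect θ (r⁻¹ • (y - x))) ∧
    r • vectorPotential f 2 (x + r • θ)
      = (∫ y, f y) • θ + ∫ y, f y • kernelDefect θ (r⁻¹ • (y - x)) := by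
  have : NeZero n := ⟨by omega⟩
  have h1 := (integrable_vectorPotential hf hi (a := 1) (by omega) (x + r • θ)).smul r
  have h2 : (fun y => r • (f y • radialKernel (1 + 1) (x + r • θ - y)))
      = fun y => f y • radialKernel 2 (θ - r⁻¹ • (y - x)) := by
    ext1 y
    rw [smul_comm, sphere_point_sub hr.ne', smul_radialKernel_two_smul hr.ne']
  have h3 : Integrable (fun y => f y • kernelDefect θ (r⁻¹ • (y - x))) := by
    simp only [kernelDefect, smul_sub]
    have h4 : Integrable (fun y => f y • radialKernel 2 (θ - r⁻¹ • (y - x))) := by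
      rw [← h2]; exact h1
    simp only [smul_sub] at h4
    exact h4.sub (hi.smul_const θ)
  refine ⟨h3, ?_⟩
  rw [vectorPotential, ← integral_smul, h2, ← integral_smul_const,
    ← integral_add (hi.smul_const θ) h3]
  congr 1; ext1 y
  rw [kernelDefect, smul_sub (f y), add_sub_cancel]

/-- On the sphere the rescaled potential is `β θ + ε`, so its square differs from `β²` by at most `2
|β| ‖ε‖ + ‖ε‖²`. Both terms are dominated by averages of kernels that vanish as `w → 0`. -/
theorem tendsto_sphere_vectorPotential_sq (hn : 4 ≤ n) (hf : Continuous f) (hi : Integrable f)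
    (x : E n) :
    Tendsto (fun r : ℝ => r ^ 2 * ∫ θ : Metric.sphere (0 : E n) 1,
      ‖vectorPotential f 2 (x + r • (θ : E n))‖ ^ 2 ∂(unitSphereMeasure n)) atTop
      (𝓝 ((unitSphereMeasure n).real Set.univ * (∫ y, f y) ^ 2)) := by
  have : NeZero n := ⟨by omega⟩
  set β := ∫ y, f y with hβ
  set F := ∫ y, |f y| with hF
  have hm1 : Measurable (Function.uncurry fun θ w : E n => ‖kernelDefect θ w‖) :=
    measurable_kernelDefect.norm
  have hm2 : Measurable (Function.uncurry fun θ w : E n => ‖kernelDefect θ w‖ ^ 2) :=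
    measurable_kernelDefect.norm.pow_const 2
  have hb1 : ∀ θ w : E n, ‖θ‖ = 1 → |‖kernelDefect θ w‖| ≤ 2 * (1 + (‖θ - w‖ ^ 2)⁻¹) :=
    fun θ w hθ => by rw [abs_norm]; exact norm_kernelDefect_le hθ
  have hb2 : ∀ θ w : E n, ‖θ‖ = 1 → |‖kernelDefect θ w‖ ^ 2| ≤ 2 * (1 + (‖θ - w‖ ^ 2)⁻¹) :=
    fun θ w hθ => by rw [abs_of_nonneg (by positivity)]; exact norm_kernelDefect_sq_le hθ
  have t1 := tendsto_integral_sphere_kernel hn hi.abs hm1 hb1 (k := 0)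
    (fun θ hθ => by simpa using (tendsto_kernelDefect hθ).norm) x
  have t2 := tendsto_integral_sphere_kernel hn hi.abs hm2 hb2 (k := 0)
    (fun θ hθ => by simpa using (tendsto_kernelDefect hθ).norm.pow 2) x
  rw [mul_zero, mul_zero] at t1 t2
  have t3 := (t1.const_mul (2 * |β|)).add (t2.const_mul F)
  rw [mul_zero, mul_zero, add_zero] at t3
  rw [tendsto_iff_norm_sub_tendsto_zero]
  refine squeeze_zero' (Filter.Eventually.of_forall fun r => norm_nonneg _) ?_ t3
  filter_upwards [eventually_gt_atTop 0] with r hr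
  have i1 := integrable_sphere_kernel_prod hn hi.abs hm1 hb1 x r
  have i2 := integrable_sphere_kernel_prod hn hi.abs hm2 hb2 x r
  have hcV : Continuous fun θ : Metric.sphere (0 : E n) 1 =>
      r ^ 2 * ‖vectorPotential f 2 (x + r • (θ : E n))‖ ^ 2 := by
    have := continuous_vectorPotential hf hi (a := 1) (by omega)
    fun_prop
  have e1 : (unitSphereMeasure n).real Set.univ * β ^ 2
      = ∫ θ : Metric.sphere (0 : E n) 1, β ^ 2 ∂(unitSphereMeasure n) := by simp
  rw [← integral_const_mul, e1, ← integral_sub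
    (hcV.integrable_of_hasCompactSupport (HasCompactSupport.of_compactSpace _)) (integrable_const _),
    ← integral_const_mul, ← integral_const_mul,
    ← integral_add (i1.integral_prod_left.const_mul _) (i2.integral_prod_left.const_mul _)]
  refine norm_integral_le_of_norm_le
    ((i1.integral_prod_left.const_mul _).add (i2.integral_prod_left.const_mul _)) ?_
  filter_upwards [i1.prod_right_ae, i2.prod_right_ae] with θ j1 j2
  have hθ : ‖(θ : E n)‖ = 1 := by simp
  obtain ⟨hI, hV⟩ := vectorPotential_sphere_eq hn hf hi x hr (θ : E n)
  set ε := ∫ y, f y • kernelDefect (θ : E n) (r⁻¹ • (y - x)) with hε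
  have h1 : r ^ 2 * ‖vectorPotential f 2 (x + r • (θ : E n))‖ ^ 2 = ‖β • (θ : E n) + ε‖ ^ 2 := by
    rw [← hV, norm_smul, mul_pow, Real.norm_eq_abs, sq_abs]
  have h2 : ‖ε‖ ≤ ∫ y, |f y| * ‖kernelDefect (θ : E n) (r⁻¹ • (y - x))‖ := by
    refine (norm_integral_le_integral_norm _).trans (le_of_eq ?_)
    simp only [norm_smul, Real.norm_eq_abs]
  have h3 : ‖ε‖ ^ 2 ≤ F * ∫ y, |f y| * ‖kernelDefect (θ : E n) (r⁻¹ • (y - x))‖ ^ 2 :=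
    (pow_le_pow_left₀ (norm_nonneg _) h2 2).trans (sq_integral_abs_mul_le hi j1 j2)
  have h4 : |inner ℝ (β • (θ : E n)) ε| ≤ |β| * ‖ε‖ := by
    refine (abs_real_inner_le_norm _ _).trans ?_
    rw [norm_smul, hθ, mul_one, Real.norm_eq_abs]
  rw [h1, norm_add_sq_real, norm_smul, hθ, mul_one, Real.norm_eq_abs, Real.norm_eq_abs, sq_abs,
    show β ^ 2 + 2 * inner ℝ (β • (θ : E n)) ε + ‖ε‖ ^ 2 - β ^ 2
      = 2 * inner ℝ (β • (θ : E n)) ε + ‖ε‖ ^ 2 by ring]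
  refine (abs_add_le _ _).trans ?_
  rw [abs_mul, abs_two, abs_of_nonneg (sq_nonneg ‖ε‖)]
  refine add_le_add ?_ h3
  rw [mul_assoc]
  gcongr
  exact h4.trans (by gcongr)

end

/-! ### The conformal mass of a normal metric -/

theorem zpow_mul_sphereIntegral (hn : 1 ≤ n) (f : E n → ℝ) (x : E n) {r : ℝ} (hr : 0 < r) :
    r ^ (3 - (n : ℤ)) * sphereIntegral f x r
      = r ^ 2 * ∫ θ : Metric.sphere (0 : E n) 1, f (x + r • (θ : E n)) ∂(unitSphereMeasure n) := by
  rw [sphereIntegral, ← mul_assoc, ← zpow_natCast r (n - 1), ← zpow_add₀ hr.ne',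
    ← zpow_natCast r 2]
  congr 2
  push_cast [Nat.cast_sub hn]
  ring

theorem sphereVolume_pred (hn : 1 ≤ n) :
    sphereVolume (n - 1) = (unitSphereMeasure n).real Set.univ := by
  -- The sphere of dimension `n - 1` is defined in dimension `n - 1 + 1`, which equals `n` only
  -- after transport along an equality.
  have h : ∀ k, k = n → (unitSphereMeasure k).real Set.univ
      = (unitSphereMeasure n).real Set.univ := by rintro _ rfl; rfl
  exact h _ (by omega)

theorem unitSphereMeasure_real_univ_pos (hn : 1 ≤ n) :
    0 < (unitSphereMeasure n).real Set.univ := by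
  rw [unitSphereMeasure, Measure.toSphere_real_apply_univ, finrank_euclideanSpace_fin]
  have h1 : 0 < (volume : Measure (E n)).real (Metric.ball 0 1) :=
    ENNReal.toReal_pos (Metric.measure_ball_pos _ _ one_pos).ne' measure_ball_lt_top.ne
  have h2 : (0 : ℝ) < n := by exact_mod_cast hn
  positivity

/-- `(n-1)(n-2)|𝕊ⁿ⁻¹|`. -/
def massConst (n : ℕ) : ℝ := ((n : ℝ) - 1) * ((n : ℝ) - 2) * sphereVolume (n - 1)

theorem massConst_pos (hn : 4 ≤ n) : 0 < massConst n := by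
  have h1 : (4 : ℝ) ≤ n := by exact_mod_cast hn
  have h2 := unitSphereMeasure_real_univ_pos (n := n) (by omega)
  rw [massConst, sphereVolume_pred (by omega)]
  have h3 : (0 : ℝ) < n - 1 := by linarith
  have h4 : (0 : ℝ) < n - 2 := by linarith
  positivity

/-- The function of the radius whose lower limit enters the conformal mass. -/
def massFunction (u : E n → ℝ) (x : E n) (r : ℝ) : ℝ :=
  r ^ (3 - (n : ℤ)) * sphereIntegral
    (fun y => scalarCurvature (conformalMetric u) y * Real.exp (2 * u y)) x r

theorem conformalMass_eq (u : E n → ℝ) :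
    conformalMass u = ((1 / massConst n : ℝ) : EReal) *
      ⨅ x : E n, liminf (fun r : ℝ => (massFunction u x r : EReal)) atTop := rfl

theorem conformalMass_eq_of_tendsto (hn : 4 ≤ n) {u : E n → ℝ} {L : ℝ}
    (h : ∀ x, Tendsto (massFunction u x) atTop (𝓝 (massConst n * L))) :
    conformalMass u = (L : EReal) := by
  have h1 : ∀ x : E n, liminf (fun r : ℝ => (massFunction u x r : EReal)) atTop
      = ((massConst n * L : ℝ) : EReal) := fun x =>
    ((continuous_coe_real_ereal.tendsto _).comp (h x)).liminf_eq
  rw [conformalMass_eq]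
  simp only [h1, iInf_const]
  rw [← EReal.coe_mul]
  congr 1
  have := (massConst_pos hn).ne'
  field_simp

/-- The infimum over centres yields a lower bound at every centre, which the mean value argument
needs; the threshold radius may depend on the centre. -/
theorem exists_le_massFunction (hn : 4 ≤ n) {u : E n → ℝ} (h : ⊥ < conformalMass u) (x : E n) :
    ∃ A : ℝ, ∀ᶠ r in atTop, A ≤ massFunction u x r := by
  have hpos : 0 < 1 / massConst n := one_div_pos.2 (massConst_pos hn)
  have h1 : ⊥ < liminf (fun r : ℝ => (massFunction u x r : EReal)) atTop := by
    rw [bot_lt_iff_ne_bot]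
    intro hbot
    have h2 : ⨅ x : E n, liminf (fun r : ℝ => (massFunction u x r : EReal)) atTop = ⊥ :=
      le_bot_iff.1 ((iInf_le _ x).trans hbot.le)
    rw [conformalMass_eq, h2, EReal.coe_mul_bot_of_pos hpos] at h
    exact lt_irrefl _ h
  obtain ⟨A, -, hA⟩ := EReal.lt_iff_exists_real_btwn.1 h1
  refine ⟨A, (eventually_lt_of_lt_liminf hA).mono fun r hr => ?_⟩
  exact (EReal.coe_lt_coe_iff.1 hr).le

theorem massFunction_eq (hn : 1 ≤ n) {u : E n → ℝ} (hu : ContDiff ℝ ∞ u) (x : E n) {r : ℝ}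
    (hr : 0 < r) :
    massFunction u x r = r ^ 2 * ∫ θ : Metric.sphere (0 : E n) 1,
      (-2 * (n - 1) * Laplacian.laplacian u (x + r • (θ : E n))
        - (n - 1) * (n - 2) * ‖gradient u (x + r • (θ : E n))‖ ^ 2) ∂(unitSphereMeasure n) := by
  rw [massFunction, zpow_mul_sphereIntegral hn _ _ hr]
  simp only [scalarCurvature_conformalMetric hu]

/-- `Q e^{nu} = (-Δ)^{n/2} u`. -/
theorem qCurvature_mul_exp (u : E n → ℝ) :
    (fun y => qCurvature u y * Real.exp (n * u y))
      = (fun f : E n → ℝ => -Laplacian.laplacian f)^[n / 2] u := by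
  ext y
  rw [qCurvature, mul_right_comm, ← Real.exp_add]
  simp

theorem continuous_qCurvature_mul_exp {u : E n → ℝ} (hu : ContDiff ℝ ∞ u) :
    Continuous fun y => qCurvature u y * Real.exp (n * u y) := by
  rw [qCurvature_mul_exp]
  exact (contDiff_iterate_neg_laplacian hu _).continuous

theorem isNormal_iff (hn : 4 ≤ n) {u : E n → ℝ} (hu : ContDiff ℝ ∞ u)
    (hQ : HasFiniteTotalQ u) :
    IsNormal u ↔ ∃ C : ℝ, ∀ x, u x = logConst n *
      logPotential (fun y => qCurvature u y * Real.exp (n * u y)) x + C := by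
  have : NeZero n := ⟨by omega⟩
  refine exists_congr fun C => forall_congr' fun x => ?_
  exact and_iff_right (integrable_logPotential (by omega) (continuous_qCurvature_mul_exp hu) hQ x)

theorem tendsto_massFunction_of_isNormal (hn : 4 ≤ n) {u : E n → ℝ} (hu : ContDiff ℝ ∞ u)
    (hQ : HasFiniteTotalQ u) (hN : IsNormal u) (x : E n) :
    Tendsto (massFunction u x) atTop (𝓝 (massConst n * (alphaZero u * (2 - alphaZero u)))) := by
  have : NeZero n := ⟨by omega⟩
  obtain ⟨C, hC⟩ := (isNormal_iff hn hu hQ).1 hN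
  set f : E n → ℝ := fun y => qCurvature u y * Real.exp (n * u y) with hf
  have hfc : Continuous f := continuous_qCurvature_mul_exp hu
  have hfi : Integrable f := hQ
  set c := logConst n with hc
  have hα : alphaZero u = c * ∫ y, f y := rfl
  have hW := (isWeakNegLap_logPotential hn hfc hfi).const_mul c
  have hW' : IsWeakNegLap u (fun x => c • -vectorPotential f 2 x)
      (fun x => c * (((n : ℝ) - 2) * rieszPotential f 2 x)) :=
    { hW with
      hasFDerivAt := fun x => by
        have := (hW.hasFDerivAt x).add_const C
        exact this.congr_of_eventuallyEq (Filter.Eventually.of_forall hC) }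
  have hU := isWeakNegLap_of_contDiff hu
  have hgrad : ∀ y, gradient u y = c • -vectorPotential f 2 y := fun y =>
    ext_inner_right ℝ fun v =>
      DFunLike.congr_fun ((hU.hasFDerivAt y).unique (hW'.hasFDerivAt y)) v
  -- Both weak equations hold for the same function and gradient, so their right-hand sides agree.
  have hlap : ∀ y, Laplacian.laplacian u y = -(c * (((n : ℝ) - 2) * rieszPotential f 2 y)) := by
    intro y
    have hU' : IsWeakNegLap u (fun x => c • -vectorPotential f 2 x) (-Laplacian.laplacian u) := by
      rwa [show gradient u = fun x => c • -vectorPotential f 2 x from funext hgrad] at hU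
    have := congrFun (hU'.rhs_unique hW') y
    rw [← this]; simp
  have t1 := (tendsto_sphere_rieszPotential hn hfi x).const_mul (2 * (n - 1) * (n - 2) * c)
  have t2 := (tendsto_sphere_vectorPotential_sq hn hfc hfi x).const_mul ((n - 1) * (n - 2) * c ^ 2)
  have t3 := t1.sub t2
  have eL : 2 * (n - 1) * (n - 2) * c * ((unitSphereMeasure n).real Set.univ * ∫ y, f y)
      - (n - 1) * (n - 2) * c ^ 2 * ((unitSphereMeasure n).real Set.univ * (∫ y, f y) ^ 2)
      = massConst n * (alphaZero u * (2 - alphaZero u)) := by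
    rw [hα, massConst, sphereVolume_pred (by omega)]
    ring
  rw [eL] at t3
  refine t3.congr' ?_
  filter_upwards [eventually_gt_atTop 0] with r hr
  rw [massFunction_eq (by omega) hu x hr]
  simp only [hlap, hgrad, norm_smul, norm_neg, mul_pow, Real.norm_eq_abs, sq_abs]
  have hcR := continuous_rieszPotential (by omega) hfc hfi (j := 1) (by omega)
  have hcV := continuous_vectorPotential hfc hfi (a := 1) (by omega)
  have i1 : Integrable (fun θ : Metric.sphere (0 : E n) 1 =>
      rieszPotential f 2 (x + r • (θ : E n))) (unitSphereMeasure n) :=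
    (by fun_prop : Continuous _).integrable_of_hasCompactSupport
      (HasCompactSupport.of_compactSpace _)
  have i2 : Integrable (fun θ : Metric.sphere (0 : E n) 1 =>
      ‖vectorPotential f 2 (x + r • (θ : E n))‖ ^ 2) (unitSphereMeasure n) :=
    (by fun_prop : Continuous _).integrable_of_hasCompactSupport
      (HasCompactSupport.of_compactSpace _)
  have e1 : ∫ θ : Metric.sphere (0 : E n) 1, (-2 * ((n : ℝ) - 1) *
        -(c * (((n : ℝ) - 2) * rieszPotential f 2 (x + r • (θ : E n))))
        - (n - 1) * (n - 2) * (c ^ 2 * ‖vectorPotential f 2 (x + r • (θ : E n))‖ ^ 2))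
        ∂(unitSphereMeasure n)
      = ∫ θ : Metric.sphere (0 : E n) 1, ((2 * (n - 1) * (n - 2) * c) *
        rieszPotential f 2 (x + r • (θ : E n))
        - ((n - 1) * (n - 2) * c ^ 2) * ‖vectorPotential f 2 (x + r • (θ : E n))‖ ^ 2)
        ∂(unitSphereMeasure n) := by
    congr 1; ext θ; ring
  rw [e1, integral_sub (i1.const_mul _) (i2.const_mul _), integral_const_mul, integral_const_mul]
  ring

/-! ### A radial weight supported in an annulus -/

/-- The profile `((t - 1)₊ (4 - t)₊)²` of the weight `z ↦ annulusProfile |z|²`. -/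
def annulusProfile (t : ℝ) : ℝ := max 0 ((t - 1) * (4 - t)) ^ 2

/-- Minus twice the derivative of `annulusProfile`. -/
def annulusSlope (t : ℝ) : ℝ := -4 * max 0 ((t - 1) * (4 - t)) * (5 - 2 * t)

theorem hasDerivAt_max_zero_sq (s : ℝ) : HasDerivAt (fun s : ℝ => max 0 s ^ 2) (2 * max 0 s) s := by
  rcases lt_trichotomy s 0 with h | rfl | h
  · rw [max_eq_left h.le, mul_zero]
    refine (hasDerivAt_const s (0 : ℝ)).congr_of_eventuallyEq ?_
    filter_upwards [gt_mem_nhds h] with t ht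
    simp [max_eq_left (le_of_lt ht)]
  · simp only [max_self, mul_zero]
    rw [hasDerivAt_iff_isLittleO_nhds_zero]
    simp only [zero_add, max_self, ne_eq, OfNat.ofNat_ne_zero, not_false_eq_true, zero_pow,
      sub_zero, smul_zero]
    rw [Asymptotics.isLittleO_iff]
    intro ε hε
    filter_upwards [Metric.ball_mem_nhds (0 : ℝ) hε] with t ht
    have ht' : |t| < ε := by simpa using ht
    have h1 : max 0 t ≤ |t| := max_le (abs_nonneg t) (le_abs_self t)
    have h0 : 0 ≤ max 0 t := le_max_left _ _
    rw [norm_pow, Real.norm_of_nonneg h0, Real.norm_eq_abs]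
    nlinarith
  · rw [max_eq_right h.le]
    have h1 : HasDerivAt (fun s : ℝ => s ^ 2) (2 * s) s := by simpa using hasDerivAt_pow 2 s
    refine h1.congr_of_eventuallyEq ?_
    filter_upwards [lt_mem_nhds h] with t ht
    rw [max_eq_right (le_of_lt ht)]

theorem hasDerivAt_annulusProfile (t : ℝ) :
    HasDerivAt annulusProfile (-(1 / 2) * annulusSlope t) t := by
  have h1 : HasDerivAt (fun t : ℝ => (t - 1) * (4 - t)) (5 - 2 * t) t := by
    have := ((hasDerivAt_id t).sub_const 1).mul ((hasDerivAt_id t).const_sub 4)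
    exact this.congr_deriv (by simp; ring)
  exact ((hasDerivAt_max_zero_sq _).comp t h1).congr_deriv (by rw [annulusSlope]; ring)

theorem continuous_annulusSlope : Continuous annulusSlope := by
  unfold annulusSlope
  fun_prop

theorem continuous_annulusProfile : Continuous annulusProfile := by
  unfold annulusProfile
  fun_prop

theorem annulusProfile_nonneg (t : ℝ) : 0 ≤ annulusProfile t := sq_nonneg _

theorem annulusProfile_of_le_one {t : ℝ} (ht : t ≤ 1) : annulusProfile t = 0 := by
  rw [annulusProfile, max_eq_left (by nlinarith [sq_nonneg (t - 1)])]; simp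

theorem annulusProfile_of_four_le (t : ℝ) (ht : 4 ≤ t) : annulusProfile t = 0 := by
  rw [annulusProfile, max_eq_left (by nlinarith [sq_nonneg (t - 4)])]; simp

theorem annulusSlope_of_le_one {t : ℝ} (ht : t ≤ 1) : annulusSlope t = 0 := by
  rw [annulusSlope, max_eq_left (by nlinarith [sq_nonneg (t - 1)])]; simp

theorem annulusSlope_of_four_le (t : ℝ) (ht : 4 ≤ t) : annulusSlope t = 0 := by
  rw [annulusSlope, max_eq_left (by nlinarith [sq_nonneg (t - 4)])]; simp

theorem contDiff_annulusProfile : ContDiff ℝ 1 fun z : E n => annulusProfile (‖z‖ ^ 2) :=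
  contDiff_comp_norm_sq hasDerivAt_annulusProfile (continuous_annulusSlope.const_mul _)

theorem hasCompactSupport_annulusProfile :
    HasCompactSupport fun z : E n => annulusProfile (‖z‖ ^ 2) :=
  hasCompactSupport_comp_norm_sq annulusProfile_of_four_le

theorem fderiv_annulusProfile (z v : E n) :
    fderiv ℝ (fun z : E n => annulusProfile (‖z‖ ^ 2)) z v
      = -(annulusSlope (‖z‖ ^ 2) * inner ℝ z v) := by
  rw [(hasFDerivAt_comp_norm_sq (hasDerivAt_annulusProfile _)).fderiv]
  simp

/-- The bump `576 · 1_{|z| ≤ 2}`. -/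
def annulusBump (z : E n) : ℝ := (Metric.closedBall (0 : E n) 2).indicator (fun _ => 576) z

theorem integrable_annulusBump : Integrable (annulusBump : E n → ℝ) := by
  unfold annulusBump
  rw [integrable_indicator_iff measurableSet_closedBall]
  exact integrableOn_const measure_closedBall_lt_top.ne

theorem annulusBump_nonneg (z : E n) : 0 ≤ annulusBump z :=
  Set.indicator_nonneg (fun _ _ => by norm_num) z

/-- Young's inequality. It works because the profile is a square `q²`, so its slope is controlled by
`q`. -/
theorem two_mul_abs_annulusSlope_le (z : E n) (s : ℝ) :
    2 * (|annulusSlope (‖z‖ ^ 2)| * ‖z‖ * s)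
      ≤ annulusProfile (‖z‖ ^ 2) * s ^ 2 + annulusBump z := by
  have hb := annulusBump_nonneg z
  have hp := annulusProfile_nonneg (‖z‖ ^ 2)
  have hn0 := norm_nonneg z
  by_cases h1 : ‖z‖ ^ 2 ≤ 1
  · rw [annulusSlope_of_le_one h1]; simp; positivity
  by_cases h4 : 4 ≤ ‖z‖ ^ 2
  · rw [annulusSlope_of_four_le _ h4]; simp; positivity
  push Not at h1 h4
  have hz : ‖z‖ ≤ 2 := by nlinarith
  have e : annulusBump z = 576 := by
    rw [annulusBump, Set.indicator_of_mem (by simpa using hz)]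
  set t := ‖z‖ ^ 2 with ht
  have hq : 0 ≤ max 0 ((t - 1) * (4 - t)) := le_max_left _ _
  rw [e, annulusSlope, annulusProfile, abs_mul, abs_mul, abs_of_nonneg hq]
  set q := max 0 ((t - 1) * (4 - t)) with hqdef
  -- On the annulus `|5 - 2t| ≤ 3` and `‖z‖ ≤ 2`, so completing the square costs `16 · 6² = 576`.
  have h5 : |5 - 2 * t| ≤ 3 := by rw [abs_le]; constructor <;> linarith
  have h6 : (|5 - 2 * t| * ‖z‖) ^ 2 ≤ 36 := by
    have : |5 - 2 * t| * ‖z‖ ≤ 3 * 2 := by gcongr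
    nlinarith [mul_nonneg (abs_nonneg (5 - 2 * t)) hn0]
  rw [show |(-4 : ℝ)| = 4 by norm_num]
  nlinarith [sq_nonneg (q * s - 4 * (|5 - 2 * t| * ‖z‖))]

theorem abs_annulusSlope_le_mul_norm (z : E n) :
    |annulusSlope (‖z‖ ^ 2)| ≤ |annulusSlope (‖z‖ ^ 2)| * ‖z‖ := by
  by_cases h1 : ‖z‖ ^ 2 ≤ 1
  · rw [annulusSlope_of_le_one h1]; simp
  · push Not at h1
    refine le_mul_of_one_le_right (abs_nonneg _) ?_
    nlinarith [norm_nonneg z]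

/-- The slope changes sign. Testing the divergence of `z / ‖z‖²` against the profile gives its
integral as `(n - 2) ∫ annulusProfile(‖z‖²) ‖z‖⁻²`, which is positive. -/
theorem integral_annulusSlope_pos (hn : 4 ≤ n) : 0 < ∫ z : E n, annulusSlope (‖z‖ ^ 2) := by
  have : NeZero n := ⟨by omega⟩
  have h := integral_fderiv_radialKernel (n := n) contDiff_annulusProfile
    hasCompactSupport_annulusProfile (a := 1) (by omega) 0
  have e1 : ∀ z : E n, fderiv ℝ (fun z : E n => annulusProfile (‖z‖ ^ 2)) z
      (radialKernel (1 + 1) (z - 0)) = -annulusSlope (‖z‖ ^ 2) := by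
    intro z
    rw [fderiv_annulusProfile, sub_zero, radialKernel, inner_smul_right, real_inner_self_eq_norm_sq]
    rcases eq_or_ne z 0 with rfl | hz
    · rw [annulusSlope_of_le_one (by simp)]; simp
    · have := norm_ne_zero_iff.2 hz
      field_simp
      ring
  simp only [e1] at h
  simp only [integral_neg, sub_zero] at h
  have h2 : (4 : ℝ) ≤ n := by exact_mod_cast hn
  have i1 := integrable_mul_inv_norm_sub_pow (n := n) (b := 1 + 1) (by omega)
    contDiff_annulusProfile.continuous hasCompactSupport_annulusProfile
  have h3 : 0 < ∫ z : E n, annulusProfile (‖z‖ ^ 2) := by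
    have hx : ∃ z : E n, annulusProfile (‖z‖ ^ 2) ≠ 0 := by
      refine ⟨EuclideanSpace.single ⟨0, by omega⟩ (3 / 2), ?_⟩
      rw [PiLp.norm_single, annulusProfile]
      norm_num
    obtain ⟨z, hz⟩ := hx
    exact contDiff_annulusProfile.continuous.integral_pos_of_hasCompactSupport_nonneg_nonzero
      hasCompactSupport_annulusProfile (fun z => annulusProfile_nonneg _) hz
  have h4 : (1 / 4) * ∫ z : E n, annulusProfile (‖z‖ ^ 2)
      ≤ ∫ z : E n, annulusProfile (‖z‖ ^ 2) * (‖z‖ ^ (1 + 1))⁻¹ := by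
    rw [← integral_const_mul]
    refine integral_mono ((contDiff_annulusProfile.continuous.integrable_of_hasCompactSupport
      hasCompactSupport_annulusProfile).const_mul _) i1 fun z => ?_
    simp only
    by_cases h1 : ‖z‖ ^ 2 ≤ 1
    · rw [annulusProfile_of_le_one h1]; simp
    by_cases h4 : 4 ≤ ‖z‖ ^ 2
    · rw [annulusProfile_of_four_le _ h4]; simp
    push Not at h1 h4
    rw [mul_comm]
    refine mul_le_mul_of_nonneg_left ?_ (annulusProfile_nonneg _)
    rw [one_div]
    exact inv_anti₀ (by simp only [Nat.reduceAdd]; linarith) h4.le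
  have h5 : ((n : ℝ) - 2) * ∫ z : E n, annulusProfile (‖z‖ ^ 2) * (‖z‖ ^ (1 + 1))⁻¹
      = ∫ z : E n, annulusSlope (‖z‖ ^ 2) := by
    push_cast at h
    linarith
  rw [← h5]
  have h6 : (0 : ℝ) < n - 2 := by linarith
  exact mul_pos h6 (by linarith)

/-- A bound on large spheres gives a bound on the averages over large annuli. -/
theorem integral_annulus_le_of_sphere_le (hn : 1 ≤ n) {H : E n → ℝ} (hH : Continuous H)
    (x : E n) {A R₀ : ℝ} (hA : 0 ≤ A) (hR₀ : 0 < R₀)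
    (hS : ∀ r, R₀ ≤ r → r ^ 2 * ∫ θ : Metric.sphere (0 : E n) 1, H (x + r • (θ : E n))
      ∂(unitSphereMeasure n) ≤ A) {ρ : ℝ} (hρ : R₀ ≤ ρ) :
    ρ ^ 2 * ∫ z, annulusProfile (‖z‖ ^ 2) * H (x + ρ • z)
      ≤ A * ∫ r in Set.Ioi (0 : ℝ), r ^ (n - 1) * annulusProfile (r ^ 2) := by
  have : NeZero n := ⟨by omega⟩
  have hρ0 : 0 < ρ := hR₀.trans_le hρ
  have hi : Integrable fun z : E n => annulusProfile (‖z‖ ^ 2) * H (x + ρ • z) :=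
    integrable_mul_of_hasCompactSupport contDiff_annulusProfile.continuous
      hasCompactSupport_annulusProfile (by fun_prop)
  rw [integral_polar' hi, ← integral_const_mul, ← integral_const_mul]
  have hRHS : IntegrableOn (fun r : ℝ => A * (r ^ (n - 1) * annulusProfile (r ^ 2)))
      (Set.Ioi 0) := by
    have hc := continuous_annulusProfile
    have hs : HasCompactSupport fun r : ℝ => annulusProfile (r ^ 2) := by
      refine HasCompactSupport.of_support_subset_isCompact (isCompact_Icc (a := (-2 : ℝ)) (b := 2))
        fun r hr => ?_
      by_contra h
      refine hr (annulusProfile_of_four_le _ ?_)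
      rw [Set.mem_Icc, not_and_or, not_le, not_le] at h
      rcases h with h | h <;> nlinarith
    exact (((by fun_prop : Continuous fun r : ℝ =>
      r ^ (n - 1) * annulusProfile (r ^ 2)).integrable_of_hasCompactSupport
        hs.mul_left).const_mul A).integrableOn
  have hle : ∀ r ∈ Set.Ioi (0 : ℝ), ρ ^ 2 * (r ^ (n - 1) * ∫ θ : Metric.sphere (0 : E n) 1,
      annulusProfile (‖r • (θ : E n)‖ ^ 2) * H (x + ρ • r • (θ : E n)) ∂(unitSphereMeasure n))
      ≤ A * (r ^ (n - 1) * annulusProfile (r ^ 2)) := by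
    intro r hr
    have hr0 : (0 : ℝ) < r := hr
    have e : ∀ θ : Metric.sphere (0 : E n) 1, annulusProfile (‖r • (θ : E n)‖ ^ 2)
        * H (x + ρ • r • (θ : E n)) = annulusProfile (r ^ 2) * H (x + (ρ * r) • (θ : E n)) := by
      intro θ
      have hθ : ‖(θ : E n)‖ = 1 := by simp
      rw [norm_smul, hθ, mul_one, Real.norm_of_nonneg hr0.le, smul_smul]
    simp only [e]
    rw [integral_const_mul]
    by_cases h1 : r ^ 2 ≤ 1
    · rw [annulusProfile_of_le_one h1]; simp
    push Not at h1
    -- The weight vanishes inside the unit ball, so only spheres of radius `ρ r ≥ ρ ≥ R₀` enter.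
    have hr1 : 1 ≤ r := by nlinarith
    have h2 := hS (ρ * r) (by nlinarith)
    have h3 : ρ ^ 2 * ∫ θ : Metric.sphere (0 : E n) 1, H (x + (ρ * r) • (θ : E n))
        ∂(unitSphereMeasure n) ≤ A := by
      set I := ∫ θ : Metric.sphere (0 : E n) 1, H (x + (ρ * r) • (θ : E n)) ∂(unitSphereMeasure n)
      rcases le_total I 0 with hI | hI
      · exact (mul_nonpos_of_nonneg_of_nonpos (sq_nonneg ρ) hI).trans hA
      · refine le_trans ?_ h2
        gcongr
        nlinarith
    have h4 : 0 ≤ r ^ (n - 1) * annulusProfile (r ^ 2) :=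
      mul_nonneg (pow_nonneg hr0.le _) (annulusProfile_nonneg _)
    nlinarith [mul_le_mul_of_nonneg_left h3 h4]
  by_cases hint : IntegrableOn (fun r : ℝ => ρ ^ 2 * (r ^ (n - 1) *
      ∫ θ : Metric.sphere (0 : E n) 1, annulusProfile (‖r • (θ : E n)‖ ^ 2)
        * H (x + ρ • r • (θ : E n)) ∂(unitSphereMeasure n))) (Set.Ioi 0)
  · exact setIntegral_mono_on hint hRHS measurableSet_Ioi hle
  -- A nonintegrable function has integral zero by convention, and the bound is nonnegative;
  -- integrability of the left side need not be proved.
  · rw [integral_undef hint]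
    exact setIntegral_nonneg measurableSet_Ioi fun r hr =>
      mul_nonneg hA (mul_nonneg (pow_nonneg (le_of_lt hr) _) (annulusProfile_nonneg _))

/-! ### Metrics whose mass is bounded below are normal -/

/-- The field `W` has size `O(1/ρ)` in the mean over annuli of scale `ρ` about each point. -/
def HasAnnularDecay (W : E n → E n) : Prop :=
  ∀ x, ∃ C R₀ : ℝ, 0 < R₀ ∧ ∀ ρ, R₀ ≤ ρ →
    ρ ^ 2 * ∫ z, annulusProfile (‖z‖ ^ 2) * ‖W (x + ρ • z)‖ ^ 2 ≤ C

theorem integrable_annulus_mul {g : E n → ℝ} (hg : Continuous g) :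
    Integrable fun z : E n => annulusProfile (‖z‖ ^ 2) * g z :=
  integrable_mul_of_hasCompactSupport contDiff_annulusProfile.continuous
    hasCompactSupport_annulusProfile hg

theorem hasCompactSupport_annulusSlope :
    HasCompactSupport fun z : E n => annulusSlope (‖z‖ ^ 2) :=
  hasCompactSupport_comp_norm_sq annulusSlope_of_four_le

/-- The mass bounds `2(n-1) Δu + (n-1)(n-2) |∇u|²` from above on annuli. After integration by parts
the Laplacian term costs at most `n - 1` copies of the gradient energy plus a constant, leaving the
coefficient `(n-1)(n-3) > 0`. -/
theorem hasAnnularDecay_gradient (hn : 4 ≤ n) {u : E n → ℝ} (hu : ContDiff ℝ ∞ u)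
    (hm : ∀ x, ∃ A : ℝ, ∀ᶠ r in atTop, A ≤ massFunction u x r) :
    HasAnnularDecay (gradient u) := by
  intro x
  obtain ⟨A, hA⟩ := hm x
  obtain ⟨R, hR⟩ := eventually_atTop.1 hA
  have hU := isWeakNegLap_of_contDiff hu
  have hcg : Continuous (gradient u) := hU.continuous_grad
  have hcl : Continuous (Laplacian.laplacian u) := by
    have := hU.continuous_rhs.neg
    simpa using this
  have hn4 : (4 : ℝ) ≤ n := by exact_mod_cast hn
  set H : E n → ℝ := fun y => 2 * (n - 1) * Laplacian.laplacian u y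
    + (n - 1) * (n - 2) * ‖gradient u y‖ ^ 2 with hH
  have hHc : Continuous H := by fun_prop
  have hS : ∀ r, max R 1 ≤ r → r ^ 2 * ∫ θ : Metric.sphere (0 : E n) 1, H (x + r • (θ : E n))
      ∂(unitSphereMeasure n) ≤ |A| := by
    intro r hr
    have h1 := hR r ((le_max_left _ _).trans hr)
    have hr0 : 0 < r := one_pos.trans_le ((le_max_right _ _).trans hr)
    rw [massFunction_eq (by omega) hu x hr0] at h1
    have h2 : ∫ θ : Metric.sphere (0 : E n) 1, H (x + r • (θ : E n)) ∂(unitSphereMeasure n)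
        = -∫ θ : Metric.sphere (0 : E n) 1,
      (-2 * (n - 1) * Laplacian.laplacian u (x + r • (θ : E n))
        - (n - 1) * (n - 2) * ‖gradient u (x + r • (θ : E n))‖ ^ 2) ∂(unitSphereMeasure n) := by
      rw [← integral_neg]
      congr 1; ext θ
      simp only [hH]; ring
    rw [h2, mul_neg]
    linarith [neg_abs_le A]
  set B := |A| * ∫ r in Set.Ioi (0 : ℝ), r ^ (n - 1) * annulusProfile (r ^ 2) with hB
  refine ⟨|B| + ∫ z : E n, annulusBump z, max R 1, by positivity, fun ρ hρ => ?_⟩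
  have hρ0 : 0 < ρ := one_pos.trans_le ((le_max_right _ _).trans hρ)
  have h1 := integral_annulus_le_of_sphere_le (by omega) hHc x (abs_nonneg A)
    (by positivity : 0 < max R 1) hS hρ
  have iL : Integrable fun z : E n => annulusProfile (‖z‖ ^ 2) * Laplacian.laplacian u (x + ρ • z) :=
    integrable_annulus_mul (by fun_prop)
  have iG : Integrable fun z : E n => annulusProfile (‖z‖ ^ 2) * ‖gradient u (x + ρ • z)‖ ^ 2 :=
    integrable_annulus_mul (by fun_prop)
  set L := ∫ z, annulusProfile (‖z‖ ^ 2) * Laplacian.laplacian u (x + ρ • z) with hL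
  set X := ∫ z, annulusProfile (‖z‖ ^ 2) * ‖gradient u (x + ρ • z)‖ ^ 2 with hX
  have hX0 : 0 ≤ X := integral_nonneg fun z =>
    mul_nonneg (annulusProfile_nonneg _) (sq_nonneg _)
  have h2 : ∫ z, annulusProfile (‖z‖ ^ 2) * H (x + ρ • z)
      = 2 * (n - 1) * L + (n - 1) * (n - 2) * X := by
    rw [hL, hX, ← integral_const_mul, ← integral_const_mul,
      ← integral_add (iL.const_mul _) (iG.const_mul _)]
    congr 1; ext z
    simp only [hH]; ring
  have h3 := hU.integral_comp_add_smul contDiff_annulusProfile hasCompactSupport_annulusProfile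
    x hρ0.ne'
  simp only [fderiv_annulusProfile, Pi.neg_apply, mul_neg, integral_neg] at h3
  have h4 : 2 * (ρ * ∫ z, -(annulusSlope (‖z‖ ^ 2) * inner ℝ z (gradient u (x + ρ • z))))
      ≤ ρ ^ 2 * X + ∫ z : E n, annulusBump z := by
    rw [hX, ← integral_const_mul, ← integral_const_mul, ← integral_const_mul,
      ← integral_add (iG.const_mul _) integrable_annulusBump]
    refine integral_mono ?_ ((iG.const_mul _).add integrable_annulusBump) fun z => ?_
    · refine Integrable.const_mul (Integrable.const_mul (Integrable.neg ?_) _) _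
      have := continuous_annulusSlope
      exact integrable_mul_of_hasCompactSupport (by fun_prop) hasCompactSupport_annulusSlope
        (by fun_prop)
    · have h5 := two_mul_abs_annulusSlope_le z (ρ * ‖gradient u (x + ρ • z)‖)
      have h6 : -(annulusSlope (‖z‖ ^ 2) * inner ℝ z (gradient u (x + ρ • z)))
          ≤ |annulusSlope (‖z‖ ^ 2)| * (‖z‖ * ‖gradient u (x + ρ • z)‖) := by
        refine (neg_le_abs _).trans ?_
        rw [abs_mul]
        gcongr
        exact abs_real_inner_le_norm _ _
      simp only
      nlinarith [mul_le_mul_of_nonneg_left h6 hρ0.le]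
  rw [h2] at h1
  rw [integral_neg] at h4
  set Y := ∫ z, annulusSlope (‖z‖ ^ 2) * inner ℝ z (gradient u (x + ρ • z))
  set b := ∫ z : E n, annulusBump z
  have hb : 0 ≤ b := integral_nonneg annulusBump_nonneg
  have hY : Y = ρ * L := by linarith
  have hZ : 0 ≤ ρ ^ 2 * X := by positivity
  rw [hY] at h4
  -- Since `n ≥ 4`, the remaining coefficient `(n-1)(n-3)` is at least `n - 1`; `e2` is the surplus.
  have h5 : ((n : ℝ) - 1) * (ρ ^ 2 * X) ≤ (n - 1) * (|B| + b) := by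
    have e1 : ((n : ℝ) - 1) * (2 * (ρ * -(ρ * L))) ≤ (n - 1) * (ρ ^ 2 * X + b) :=
      mul_le_mul_of_nonneg_left h4 (by linarith)
    have e2 : 0 ≤ ((n : ℝ) - 1) * (n - 4) * (ρ ^ 2 * X) :=
      mul_nonneg (mul_nonneg (by linarith) (by linarith)) hZ
    have e3 : 0 ≤ ((n : ℝ) - 2) * |B| := mul_nonneg (by linarith) (abs_nonneg B)
    linarith [le_abs_self B]
  exact le_of_mul_le_mul_left h5 (by linarith)

theorem HasAnnularDecay.add_smul {W₁ W₂ : E n → E n} (h₁ : HasAnnularDecay W₁)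
    (h₂ : HasAnnularDecay W₂) (hc₁ : Continuous W₁) (hc₂ : Continuous W₂) (c : ℝ) :
    HasAnnularDecay fun x => W₁ x + c • W₂ x := by
  intro x
  obtain ⟨C₁, R₁, hR₁, H₁⟩ := h₁ x
  obtain ⟨C₂, R₂, hR₂, H₂⟩ := h₂ x
  refine ⟨2 * C₁ + 2 * c ^ 2 * C₂, max R₁ R₂, lt_max_of_lt_left hR₁, fun ρ hρ => ?_⟩
  have a₁ := H₁ ρ ((le_max_left _ _).trans hρ)
  have a₂ := H₂ ρ ((le_max_right _ _).trans hρ)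
  have i₁ : Integrable fun z : E n => annulusProfile (‖z‖ ^ 2) * ‖W₁ (x + ρ • z)‖ ^ 2 :=
    integrable_annulus_mul (by fun_prop)
  have i₂ : Integrable fun z : E n => annulusProfile (‖z‖ ^ 2) * ‖W₂ (x + ρ • z)‖ ^ 2 :=
    integrable_annulus_mul (by fun_prop)
  have h : ∫ z, annulusProfile (‖z‖ ^ 2) * ‖W₁ (x + ρ • z) + c • W₂ (x + ρ • z)‖ ^ 2
      ≤ 2 * (∫ z, annulusProfile (‖z‖ ^ 2) * ‖W₁ (x + ρ • z)‖ ^ 2)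
        + 2 * c ^ 2 * ∫ z, annulusProfile (‖z‖ ^ 2) * ‖W₂ (x + ρ • z)‖ ^ 2 := by
    rw [← integral_const_mul, ← integral_const_mul,
      ← integral_add (i₁.const_mul _) (i₂.const_mul _)]
    refine integral_mono (integrable_annulus_mul (by fun_prop))
      ((i₁.const_mul _).add (i₂.const_mul _)) fun z => ?_
    have h1 : ‖W₁ (x + ρ • z) + c • W₂ (x + ρ • z)‖ ^ 2
        ≤ 2 * ‖W₁ (x + ρ • z)‖ ^ 2 + 2 * c ^ 2 * ‖W₂ (x + ρ • z)‖ ^ 2 := by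
      have h2 := norm_add_le (W₁ (x + ρ • z)) (c • W₂ (x + ρ • z))
      rw [norm_smul, Real.norm_eq_abs] at h2
      have h3 := pow_le_pow_left₀ (norm_nonneg _) h2 2
      nlinarith [sq_nonneg (‖W₁ (x + ρ • z)‖ - |c| * ‖W₂ (x + ρ • z)‖), sq_abs c]
    have := mul_le_mul_of_nonneg_left h1 (annulusProfile_nonneg (‖z‖ ^ 2))
    simp only
    linarith
  nlinarith [mul_le_mul_of_nonneg_left h (sq_nonneg ρ)]

theorem hasAnnularDecay_vectorPotential (hn : 4 ≤ n) {f : E n → ℝ} (hf : Continuous f)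
    (hi : Integrable f) : HasAnnularDecay (vectorPotential f 2) := by
  have : NeZero n := ⟨by omega⟩
  intro x
  have hcV := continuous_vectorPotential hf hi (a := 1) (by omega)
  set L := (unitSphereMeasure n).real Set.univ * (∫ y, f y) ^ 2
  have hL : 0 ≤ L := by positivity
  obtain ⟨R, hR⟩ := eventually_atTop.1
    ((tendsto_sphere_vectorPotential_sq hn hf hi x).eventually_le_const (lt_add_one L))
  exact ⟨_, max R 1, by positivity, fun ρ hρ => integral_annulus_le_of_sphere_le (by omega)
    (H := fun y => ‖vectorPotential f 2 y‖ ^ 2) (by fun_prop) x (A := L + 1) (by positivity)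
    (by positivity : 0 < max R 1) (fun r hr => hR r ((le_max_left _ _).trans hr)) hρ⟩

/-- First moments against the slope of the weight are controlled by annular decay. -/
theorem HasAnnularDecay.exists_slope_bound {W : E n → E n} (hW : HasAnnularDecay W)
    (hc : Continuous W) (x : E n) :
    ∃ C R₀ : ℝ, 0 < R₀ ∧ ∀ ρ, R₀ ≤ ρ →
      ρ * ∫ z, |annulusSlope (‖z‖ ^ 2)| * ‖z‖ * ‖W (x + ρ • z)‖ ≤ C := by
  obtain ⟨C, R₀, hR₀, H⟩ := hW x
  refine ⟨(C + ∫ z : E n, annulusBump z) / 2, R₀, hR₀, fun ρ hρ => ?_⟩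
  have hρ0 : 0 < ρ := hR₀.trans_le hρ
  have i : Integrable fun z : E n => annulusProfile (‖z‖ ^ 2) * ‖W (x + ρ • z)‖ ^ 2 :=
    integrable_annulus_mul (by fun_prop)
  have h1 : 2 * (ρ * ∫ z, |annulusSlope (‖z‖ ^ 2)| * ‖z‖ * ‖W (x + ρ • z)‖)
      ≤ ρ ^ 2 * (∫ z, annulusProfile (‖z‖ ^ 2) * ‖W (x + ρ • z)‖ ^ 2)
        + ∫ z : E n, annulusBump z := by
    rw [← integral_const_mul, ← integral_const_mul, ← integral_const_mul,
      ← integral_add (i.const_mul _) integrable_annulusBump]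
    refine integral_mono ?_ ((i.const_mul _).add integrable_annulusBump) fun z => ?_
    · refine Integrable.const_mul (Integrable.const_mul ?_ _) _
      have := continuous_annulusSlope
      simp only [mul_assoc]
      exact integrable_mul_of_hasCompactSupport (by fun_prop)
        hasCompactSupport_annulusSlope.abs (by fun_prop)
    · have h5 := two_mul_abs_annulusSlope_le z (ρ * ‖W (x + ρ • z)‖)
      simp only
      linarith
  linarith [H ρ hρ]

/-! ### A Liouville theorem for weakly polyharmonic functions -/

/-- A polynomial bounded at `+∞` is constant, and `X * q` has zero constant term. -/
theorem polynomial_eq_zero_of_bounded_mul_X {q : Polynomial ℝ} {C : ℝ}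
    (h : ∀ᶠ ρ in atTop, |ρ * q.eval ρ| ≤ C) : q = 0 := by
  have h1 : ¬ 0 < (Polynomial.X * q).degree := by
    intro hd
    have h2 := (Polynomial.abs_tendsto_atTop _ hd).eventually_gt_atTop C
    obtain ⟨ρ, h3, h4⟩ := (h.and h2).exists
    simp only [Polynomial.eval_mul, Polynomial.eval_X] at h4
    linarith
  have h2 := Polynomial.eq_C_of_degree_le_zero (not_lt.1 h1)
  rw [Polynomial.coeff_X_mul_zero, Polynomial.C_0] at h2
  exact (mul_eq_zero.1 h2).resolve_left Polynomial.X_ne_zero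

/-- A weakly polyharmonic function whose gradient decays in the mean is constant. -/
theorem IsWeakPolyLap.eq_const_of_hasAnnularDecay (hn : 4 ≤ n) {m : ℕ} {w : E n → ℝ}
    {W : E n → E n} (H : IsWeakPolyLap m w (fun _ => 0))
    (hw : ∀ x, HasFDerivAt w (innerSL ℝ (W x)) x) (hW : Continuous W)
    (hd : HasAnnularDecay W) (x y : E n) : w x = w y := by
  have hcs := continuous_annulusSlope
  have hss := hasCompactSupport_annulusSlope (n := n)
  have hχ : Continuous fun z : E n => annulusSlope (‖z‖ ^ 2) := by fun_prop
  set M := ∫ z : E n, annulusSlope (‖z‖ ^ 2) with hM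
  have hM0 : 0 < M := integral_annulusSlope_pos hn
  -- The average is a polynomial in `ρ` whose derivative is `O(1/ρ)` by the decay of `W`, hence
  -- constant; `ρ = 0` gives its value. The slope is the weight because annular decay controls its
  -- first moments.
  have mean : ∀ x : E n, ∀ ρ : ℝ, ∫ z, annulusSlope (‖z‖ ^ 2) * w (x + ρ • z) = M * w x := by
    intro x
    obtain ⟨p, hp⟩ := H.exists_polynomial continuous_annulusSlope annulusSlope_of_four_le x
    obtain ⟨C, R₀, hR₀, hC⟩ := hd.exists_slope_bound hW x
    have hder : ∀ ρ, (Polynomial.derivative p).eval ρ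
        = ∫ z, annulusSlope (‖z‖ ^ 2) * inner ℝ (W (x + ρ • z)) z := by
      intro ρ
      have h1 := hasDerivAt_integral_mul_comp_affine (p := fun _ => x) (q := fun z => z)
        hχ hss hw hW continuous_const continuous_id ρ
      simp only [hp] at h1
      exact (p.hasDerivAt ρ).unique h1
    have hz : Polynomial.derivative p = 0 := by
      refine polynomial_eq_zero_of_bounded_mul_X (C := C) ?_
      filter_upwards [eventually_ge_atTop R₀] with ρ hρ
      refine le_trans ?_ (hC ρ hρ)
      have hρ0 : 0 < ρ := hR₀.trans_le hρ
      rw [abs_mul, abs_of_pos hρ0, hder]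
      refine mul_le_mul_of_nonneg_left ?_ hρ0.le
      rw [← Real.norm_eq_abs]
      refine norm_integral_le_of_norm_le ?_ (Filter.Eventually.of_forall fun z => ?_)
      · simp only [mul_assoc]
        exact integrable_mul_of_hasCompactSupport (by fun_prop) hss.abs (by fun_prop)
      · rw [norm_mul, Real.norm_eq_abs, mul_assoc]
        gcongr
        refine (norm_inner_le_norm _ _).trans (le_of_eq (mul_comm _ _))
    have hconst := Polynomial.derivative_eq_zero.1 hz
    intro ρ
    rw [hp, Polynomial.eq_C_of_natDegree_eq_zero hconst]
    have h0 := hp 0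
    rw [Polynomial.eq_C_of_natDegree_eq_zero hconst] at h0
    simp only [zero_smul, add_zero, Polynomial.eval_C] at h0 ⊢
    rw [← h0, integral_mul_const]
  have hW0 : ∀ x, W x = 0 := by
    intro x
    obtain ⟨C, R₀, hR₀, hC⟩ := hd.exists_slope_bound hW x
    -- Differentiate the mean value identity in the centre, in the direction `W x` itself. The left
    -- side grows with `ρ` unless `W x = 0`.
    have key : ∀ ρ, R₀ ≤ ρ → ρ * (M * ‖W x‖ ^ 2) ≤ C * ‖W x‖ := by
      intro ρ hρ
      have hρ0 : 0 < ρ := hR₀.trans_le hρ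
      have h1 := hasDerivAt_integral_mul_comp_affine (p := fun z => x + ρ • z) (q := fun _ => W x)
        hχ hss hw hW (by fun_prop) continuous_const 0
      have e : (fun t : ℝ => ∫ z : E n, annulusSlope (‖z‖ ^ 2) * w (x + ρ • z + t • W x))
          = fun t => M * w (x + t • W x) := by
        ext t
        rw [← mean (x + t • W x) ρ]
        congr 1; ext z
        rw [add_right_comm]
      rw [e] at h1
      have h2 : HasDerivAt (fun t : ℝ => x + t • W x) (W x) 0 := by
        simpa using ((hasDerivAt_id (0 : ℝ)).smul_const (W x)).const_add x
      have h3 := ((hw (x + (0 : ℝ) • W x)).comp_hasDerivAt (0 : ℝ) h2).const_mul M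
      have h4 := h1.unique h3
      simp only [zero_smul, add_zero, innerSL_apply_apply, real_inner_self_eq_norm_sq] at h4
      rw [← h4]
      have h5 : ∫ z : E n, annulusSlope (‖z‖ ^ 2) * inner ℝ (W (x + ρ • z)) (W x)
          ≤ (∫ z : E n, |annulusSlope (‖z‖ ^ 2)| * ‖z‖ * ‖W (x + ρ • z)‖) * ‖W x‖ := by
        rw [← integral_mul_const]
        refine integral_mono (integrable_mul_of_hasCompactSupport hχ hss (by fun_prop)) ?_
          fun z => ?_
        · simp only [mul_assoc]
          exact integrable_mul_of_hasCompactSupport (by fun_prop) hss.abs (by fun_prop)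
        · calc annulusSlope (‖z‖ ^ 2) * inner ℝ (W (x + ρ • z)) (W x)
              ≤ |annulusSlope (‖z‖ ^ 2)| * (‖W (x + ρ • z)‖ * ‖W x‖) := by
                refine (le_abs_self _).trans ?_
                rw [abs_mul]
                gcongr
                exact abs_real_inner_le_norm _ _
            _ ≤ (|annulusSlope (‖z‖ ^ 2)| * ‖z‖) * (‖W (x + ρ • z)‖ * ‖W x‖) := by
                gcongr
                exact abs_annulusSlope_le_mul_norm z
            _ = _ := by ring
      calc _ ≤ ρ * ((∫ z : E n, |annulusSlope (‖z‖ ^ 2)| * ‖z‖ * ‖W (x + ρ • z)‖) * ‖W x‖) := by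
            gcongr
        _ = (ρ * ∫ z : E n, |annulusSlope (‖z‖ ^ 2)| * ‖z‖ * ‖W (x + ρ • z)‖) * ‖W x‖ := by ring
        _ ≤ C * ‖W x‖ := by gcongr; exact hC ρ hρ
    by_contra hne
    have hpos : 0 < M * ‖W x‖ ^ 2 := by
      have := norm_pos_iff.2 hne
      positivity
    obtain ⟨ρ, h1, h2⟩ := ((eventually_ge_atTop R₀).and
      ((tendsto_id.atTop_mul_const hpos).eventually_gt_atTop (C * ‖W x‖))).exists
    exact absurd (key ρ h1) (not_le.2 h2)
  refine is_const_of_fderiv_eq_zero (𝕜 := ℝ) (fun x => (hw x).differentiableAt) (fun x => ?_) x y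
  rw [(hw x).fderiv, hW0, map_zero]

/-- The Liouville theorem is applied to `u` minus its normalised potential: the chains of weak
equations for the two end in the same `f`, and both gradients have annular decay. -/
theorem isNormal_of_massFunction_bddBelow {n : ℕ} (hn : 4 ≤ n) (hn_even : Even n) {u : E n → ℝ}
    (hu : ContDiff ℝ ∞ u) (hQ : HasFiniteTotalQ u)
    (hm : ∀ x, ∃ A : ℝ, ∀ᶠ r in atTop, A ≤ massFunction u x r) : IsNormal u := by
  obtain ⟨m, rfl⟩ := hn_even.two_dvd
  have : NeZero (2 * m) := ⟨by omega⟩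
  rw [isNormal_iff hn hu hQ]
  set f : E (2 * m) → ℝ := fun y => qCurvature u y * Real.exp ((2 * m : ℕ) * u y) with hf
  have hfc : Continuous f := continuous_qCurvature_mul_exp hu
  have hfi : Integrable f := hQ
  have hP := (isWeakPolyLap_of_contDiff hu m).sub (isWeakPolyLap_logPotential (by omega) hfc hfi)
  have hfe : f = (fun f : E (2 * m) → ℝ => -Laplacian.laplacian f)^[m] u := by
    rw [hf, qCurvature_mul_exp, Nat.mul_div_cancel_left m two_pos]
  simp only [← hfe, sub_self] at hP
  have hcV : Continuous (vectorPotential f 2) := continuous_vectorPotential hfc hfi (a := 1) (by omega)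
  have hcg := (isWeakNegLap_of_contDiff hu).continuous_grad
  have hconst := hP.eq_const_of_hasAnnularDecay hn
    (W := fun x => gradient u x + logConst (2 * m) • vectorPotential f 2 x)
    (fun x => by
      have h1 := ((isWeakNegLap_of_contDiff hu).hasFDerivAt x).sub
        (((isWeakNegLap_logPotential hn hfc hfi).const_mul (logConst (2 * m))).hasFDerivAt x)
      rw [← map_sub, smul_neg, sub_neg_eq_add] at h1
      exact h1)
    (by fun_prop)
    ((hasAnnularDecay_gradient hn hu hm).add_smul (hasAnnularDecay_vectorPotential hn hfc hfi)
      hcg hcV _)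
  refine ⟨u 0 - logConst (2 * m) * logPotential f 0, fun x => ?_⟩
  linarith [hconst x 0]

end ConformalMass
end

theorem mainTheorem1 (n : ℕ) (hn : 4 ≤ n) (hn_even : Even n)
    (u : EuclideanSpace ℝ (Fin n) → ℝ) (hu : ContDiff ℝ ∞ u)
    (hQ : ConformalMass.HasFiniteTotalQ u) :
    (ConformalMass.IsNormal u ↔ ⊥ < ConformalMass.conformalMass u) ∧
    (ConformalMass.IsNormal u →
      ConformalMass.conformalMass u =
        ((ConformalMass.alphaZero u * (2 - ConformalMass.alphaZero u) : ℝ) : EReal)) := by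
  have h : ConformalMass.IsNormal u → ConformalMass.conformalMass u =
      ((ConformalMass.alphaZero u * (2 - ConformalMass.alphaZero u) : ℝ) : EReal) := fun hN =>
    ConformalMass.conformalMass_eq_of_tendsto hn
      (ConformalMass.tendsto_massFunction_of_isNormal hn hu hQ hN)
  refine ⟨⟨fun hN => ?_, fun hm => ?_⟩, h⟩
  · rw [h hN]
    exact EReal.bot_lt_coe _
  · exact ConformalMass.isNormal_of_massFunction_bddBelow hn hn_even hu hQ
      (ConformalMass.exists_le_massFunction hn hm)
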